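/- \textbf{Setting.} Fix constants $\gamma,R,K>0$, integers $k,k^\star\ge 1$ and a function $K_r:\mathbb R_{\ge0}\to\mathbb R_{>0}$. Let $p=p(n)$ be integers with $p(n)/n\to\gamma$ as $n\to\infty$. For a real random variable write $\|X\|_{\psi_2}=\inf\{t>0:\mathbb E\,e^{X^2/t^2}\le 2\}$, and for a random vector $\|X\|_{\psi_2}=\sup_{\|u\|_2=1}\|u^{\mathsf T}X\|_{\psi_2}$. For every $n$ let $S_n\subseteq\{\theta\in\mathbb R^{p}:\|\theta\|_2\le R\}$ be convex and symmetric ($S_n=-S_n$), let $C_n\subseteq S_n$ be compact and non-empty, let $\Theta^\star_n=(\theta^\star_1,\dots,\theta^\star_{k^\star})\in\mathbb R^{p\times k^\star}$ have all its columns in $S_n$, let $r_n:\mathbb R^{p\times k}\to\mathbb R$, let $\mu_n$ and $\nu_n$ be probability laws on $\mathbb R^{p}$ and $\mathbb R$, and let $\Sigma_n$ be a positive semidefinite $p\times p$ matrix. (In particular these objects may depend on $n$ only through $p(n)$.) Let $\ell:\mathbb R^{k+1}\to\mathbb R$ be nonnegative and let $\eta:\mathbb R^{k^\star+1}\to\mathbb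 R$. On a probability space let, for every $n$, $x_1,\dots,x_n\sim\mu_n$ be i.i.d., $g_1,\dots,g_n\sim\mathcal N(0,\Sigma_n)$ be i.i.d., and $\epsilon_1,\dots,\epsilon_n\sim\nu_n$ be i.i.d., with $(\epsilon_i)$ independent of $(x_i)$ and independent of $(g_i)$. Put $X=(x_1,\dots,x_n)^{\mathsf T}$, $G=(g_1,\dots,g_n)^{\mathsf T}$, and, for $Z=(z_1,\dots,z_n)^{\mathsf T}$ equal to $X$ or $G$, $$y_i(Z)=\eta(\Theta_n^{\star\mathsf T}z_i,\epsilon_i),\qquad \widehat R_n^\star(Z,y(Z))=\inf_{\Theta=(\theta_1,\dots,\theta_k),\ \theta_j\in C_n}\Big\{\frac1n\sum_{i=1}^n\ell(\Theta^{\mathsf T}z_i;y_i(Z))+r_n(\Theta)\Big\}.$$ \textbf{Assumptions.} \begin{itemize} \item Either (1) $\ell$ and $\eta$ are $K$-Lipschitz; or (1$'$) $\ell$ and $\eta$ are differentiable with $K$-Lipschitz gradients and for every $\beta>0$ there is a finite constant $B(\beta)$ such that $\mathbb E\exp\{\beta|\ell(v,\eta(v^\star,V))|\}\le B(\beta)$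 for all random variables $v\in\mathbb R^k$, $v^\star\in\mathbb R^{k^\star}$, $V\in\mathbb R$ (with any joint law) satisfying $\|v\|_{\psi_2}\vee\|v^\star\|_{\psi_2}\vee\|V\|_{\psi_2}\le 2(R+1)K$. \item The noise law $\nu_n$ has subgaussian norm $\|\epsilon_i\|_{\psi_2}\le K$. \item $|r_n(\Theta_0)-r_n(\Theta_1)|\le K_r(B)\|\Theta_0-\Theta_1\|_F$ for all $n$, all $B>0$ and all $\Theta_0,\Theta_1$ with $\|\Theta_0\|_F,\|\Theta_1\|_F\le B$. \item $\|\theta^{\mathsf T}x_1\|_{\psi_2}\le K$ and $\|\Sigma_n^{1/2}\theta\|_2\le K$ for all $n$ and all $\theta\in S_n$ with $\|\theta\|_2\le1$. \item For every bounded Lipschitz $\varphi:\mathbb R\to\mathbb R$, $\ \lim_{n\to\infty}\sup_{\theta\in S_n}\big|\mathbb E\varphi(\theta^{\mathsf T}x_1)-\mathbb E\varphi(\theta^{\mathsf T}g_1)\big|=0$. \end{itemize} \textbf{Conclusion.} For every bounded Lipschitz $\psi:\mathbb R\to\mathbb R$, $$\lim_{n\to\infty}\Big|\mathbb E\,\psi\big(\widehat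 R_n^\star(X,y(X))\big)-\mathbb E\,\psi\big(\widehat R_n^\star(G,y(G))\big)\Big|=0.$$ Hence, for all $\rho\in\mathbb R$ and $\delta>0$, $$\lim_{n}\mathbb P\big(\widehat R_n^\star(X,y(X))\ge\rho+\delta\big)\le\lim_{n}\mathbb P\big(\widehat R_n^\star(G,y(G))\ge\rho\big),\qquad \lim_{n}\mathbb P\big(\widehat R_n^\star(X,y(X))\le\rho-\delta\big)\le\lim_{n}\mathbb P\big(\widehat R_n^\star(G,y(G))\le\rho\big),$$ where, since the limits need not exist, each inequality is asserted both with $\limsup$ on the two sides and with $\liminf$ on the two sides. Consequently, for every $\rho\in\mathbb R$, $\widehat R_n^\star(X,y(X))\to\rho$ in probability if and only if $\widehat R_n^\star(G,y(G))\to\rho$ in probability. -/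

import Mathlib

open MeasureTheory ProbabilityTheory Filter Topology
open scoped NNReal ENNReal MatrixOrder

namespace EmpiricalRisk

noncomputable section

/-- The subgaussian norm `inf {t > 0 : E exp (X² / t²) ≤ 2}` of a real random variable
(it is `∞` if there is no such `t`). -/
def psi2Norm {α : Type*} [MeasurableSpace α] (X : α → ℝ) (P : Measure α) : ℝ≥0∞ :=
  ⨅ (t : ℝ≥0)
    (_ : 0 < t ∧ ∫⁻ a, ENNReal.ofReal (Real.exp ((X a) ^ 2 / (t : ℝ) ^ 2)) ∂P ≤ 2), (t : ℝ≥0∞)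

/-- The subgaussian norm of a random vector: the supremum of the subgaussian norms of its
one-dimensional projections along unit vectors. -/
def vecPsi2Norm {α : Type*} [MeasurableSpace α] {d : ℕ}
    (X : α → EuclideanSpace ℝ (Fin d)) (P : Measure α) : ℝ≥0∞ :=
  ⨆ (u : EuclideanSpace ℝ (Fin d)) (_ : ‖u‖ = 1), psi2Norm (fun a => inner ℝ u (X a)) P

/-- Bounded Lipschitz functions on the real line. -/
def BoundedLipschitz (φ : ℝ → ℝ) : Prop :=
  (∃ M : ℝ, ∀ t, |φ t| ≤ M) ∧ ∃ L : ℝ≥0, LipschitzWith L φ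

/-- The matrices `Θ = (θ₁, …, θ_k) ∈ ℝ^{p × k}`, as lists of `k` columns in `ℝ^p`. The norm of
this space is `(∑ j, ‖θ_j‖²)^{1/2}`, the Frobenius norm. -/
abbrev Params (p k : ℕ) : Type := PiLp 2 (fun _ : Fin k => EuclideanSpace ℝ (Fin p))

/-- `Θᵀ x ∈ ℝ^k`. -/
def proj {p k : ℕ} (Θ : Params p k) (x : EuclideanSpace ℝ (Fin p)) : EuclideanSpace ℝ (Fin k) :=
  WithLp.toLp 2 (fun j => inner ℝ (Θ j) x)

/-- The point `(v, t) ∈ ℝ^{d+1}` with `v ∈ ℝ^d` and `t ∈ ℝ`. -/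
def append {d : ℕ} (v : EuclideanSpace ℝ (Fin d)) (t : ℝ) : EuclideanSpace ℝ (Fin (d + 1)) :=
  WithLp.toLp 2 (Fin.snoc (α := fun _ => ℝ) (fun j => v j) t)

/-- The response `η (Θ⋆ᵀ x, e)`. -/
def response {p kstar : ℕ} (η : EuclideanSpace ℝ (Fin (kstar + 1)) → ℝ) (Θstar : Params p kstar)
    (x : EuclideanSpace ℝ (Fin p)) (e : ℝ) : ℝ :=
  η (append (proj Θstar x) e)

/-- The regularized empirical risk `(1/n) ∑ i, ℓ (Θᵀ x_i; y_i) + r Θ`. -/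
def risk {n p k : ℕ} (ℓ : EuclideanSpace ℝ (Fin (k + 1)) → ℝ) (r : Params p k → ℝ)
    (X : Fin n → EuclideanSpace ℝ (Fin p)) (y : Fin n → ℝ) (Θ : Params p k) : ℝ :=
  (1 / (n : ℝ)) * ∑ i, ℓ (append (proj Θ (X i)) (y i)) + r Θ

/-- The minimum `inf {risk Θ : Θ ∈ C^k}` of the regularized empirical risk. -/
def minRisk {n p k : ℕ} (ℓ : EuclideanSpace ℝ (Fin (k + 1)) → ℝ) (r : Params p k → ℝ)
    (C : Set (EuclideanSpace ℝ (Fin p)))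
    (X : Fin n → EuclideanSpace ℝ (Fin p)) (y : Fin n → ℝ) : ℝ :=
  sInf (risk ℓ r X y '' {Θ | ∀ j, Θ j ∈ C})

/-- Loss and labeling functions, Lipschitz version. -/
def LipschitzLossLabel {k kstar : ℕ} (K : ℝ≥0) (ℓ : EuclideanSpace ℝ (Fin (k + 1)) → ℝ)
    (η : EuclideanSpace ℝ (Fin (kstar + 1)) → ℝ) : Prop :=
  (∀ v, 0 ≤ ℓ v) ∧ LipschitzWith K ℓ ∧ LipschitzWith K η

/-- Loss and labeling functions, smooth version: Lipschitz gradients and exponential integrability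
of `ℓ (v, η (v⋆, V))`, uniformly over all joint laws `π` of random variables
`(v, v⋆, V) ∈ ℝ^k × ℝ^{k⋆} × ℝ` with subgaussian norms at most `2 (R + 1) K`. -/
def SmoothLossLabel {k kstar : ℕ} (R K : ℝ≥0) (ℓ : EuclideanSpace ℝ (Fin (k + 1)) → ℝ)
    (η : EuclideanSpace ℝ (Fin (kstar + 1)) → ℝ) : Prop :=
  (∀ v, 0 ≤ ℓ v) ∧ Differentiable ℝ ℓ ∧ LipschitzWith K (gradient ℓ) ∧
  Differentiable ℝ η ∧ LipschitzWith K (gradient η) ∧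
  ∀ β : ℝ, 0 < β → ∃ B : ℝ≥0,
    ∀ π : Measure (EuclideanSpace ℝ (Fin k) × EuclideanSpace ℝ (Fin kstar) × ℝ),
      IsProbabilityMeasure π →
      vecPsi2Norm (fun z => z.1) π ≤ ((2 * (R + 1) * K : ℝ≥0) : ℝ≥0∞) →
      vecPsi2Norm (fun z => z.2.1) π ≤ ((2 * (R + 1) * K : ℝ≥0) : ℝ≥0∞) →
      psi2Norm (fun z => z.2.2) π ≤ ((2 * (R + 1) * K : ℝ≥0) : ℝ≥0∞) →
      ∫⁻ z, ENNReal.ofReal (Real.exp (β * |ℓ (append z.1 (η (append z.2.1 z.2.2)))|)) ∂π ≤ B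

/-- The regularizer is locally Lipschitz in Frobenius norm, with constant `Kr B` on the ball
of radius `B`. -/
def LocallyLipschitzReg {p k : ℕ} (Kr : ℝ → ℝ) (r : Params p k → ℝ) : Prop :=
  ∀ B : ℝ, 0 < B → ∀ Θ₀ Θ₁ : Params p k, ‖Θ₀‖ ≤ B → ‖Θ₁‖ ≤ B →
    |r Θ₀ - r Θ₁| ≤ Kr B * ‖Θ₀ - Θ₁‖

/-- Subgaussianity of the projections of the features (of law `μ`), and boundedness of
`‖Σ^{1/2} θ‖`, along the directions of `S` in the unit ball. -/
def SubgaussianAlong {p : ℕ} (K : ℝ≥0) (S : Set (EuclideanSpace ℝ (Fin p)))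
    (μ : Measure (EuclideanSpace ℝ (Fin p))) (Cov : Matrix (Fin p) (Fin p) ℝ) : Prop :=
  ∀ θ ∈ S, ‖θ‖ ≤ 1 →
    psi2Norm (fun x => inner ℝ θ x) μ ≤ (K : ℝ≥0∞) ∧
    ‖Matrix.toEuclideanCLM (𝕜 := ℝ) (CFC.sqrt Cov) θ‖ ≤ K

/-- The projections of the features along `S n` are asymptotically Gaussian: for every bounded
Lipschitz `φ`, `sup_{θ ∈ S n} |E φ(θᵀ x) - E φ(θᵀ g)| → 0`, with `x ∼ μ n` and
`g ∼ N(0, Cov n)`. -/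
def AsymptoticallyGaussianAlong {p : ℕ → ℕ} (S : ∀ n, Set (EuclideanSpace ℝ (Fin (p n))))
    (μ : ∀ n, Measure (EuclideanSpace ℝ (Fin (p n))))
    (Cov : ∀ n, Matrix (Fin (p n)) (Fin (p n)) ℝ) : Prop :=
  ∀ φ : ℝ → ℝ, BoundedLipschitz φ →
    Tendsto (fun n => ⨆ θ : S n,
      |(∫ x, φ (inner ℝ (θ : EuclideanSpace ℝ (Fin (p n))) x) ∂(μ n)) -
        ∫ x, φ (inner ℝ (θ : EuclideanSpace ℝ (Fin (p n))) x)
          ∂(multivariateGaussian 0 (Cov n))|)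
      atTop (𝓝 0)

/-- `(x_i)` are i.i.d. of law `μ`, `(ε_i)` are i.i.d. of law `ν`, and the two families are
independent of each other. -/
structure IsSample {Ω : Type*} [MeasurableSpace Ω] (P : Measure Ω) {n p : ℕ}
    (μ : Measure (EuclideanSpace ℝ (Fin p))) (ν : Measure ℝ)
    (x : Fin n → Ω → EuclideanSpace ℝ (Fin p)) (ε : Fin n → Ω → ℝ) : Prop where
  law_x : ∀ i, HasLaw (x i) μ P
  law_noise : ∀ i, HasLaw (ε i) ν P
  indep_x : iIndepFun x P
  indep_noise : iIndepFun ε P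
  indep : IndepFun (fun ω i => x i ω) (fun ω i => ε i ω) P

end

end EmpiricalRisk

open EmpiricalRisk

/-! The infimum is replaced by a free energy `softMin` over a finite net of parameters, and the
samples are exchanged one at a time, as in Lindeberg's proof of the central limit theorem.

Discretisation (`exists_softMin_approx`). The nets are measured in the gauge of the symmetric convex
set `S`, so a net of `C` at scale `α` has at most `(1 + 2/α)^p` points. If `∑ i, ⟨θ, x_i⟩²` is
`O(n)` uniformly on `S` and the squared responses sum to `O(n)`, the minimal risk differs from the
normalised free energy by `O(α)` (net) plus `(p/n) k log(1 + 2/α) / β` (entropy). Both are small for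
`α` small and then `β` large, chosen before `n → ∞`.

Exchange (`abs_integral_pi_softMin_sub_le`). Given the other samples, the free energy is a constant
plus the soft minimum of the losses of one sample under Gibbs weights `q` that do not depend on that
sample. A Taylor expansion at scale `1/n` shows that `n` swaps cost at most a constant times the
largest difference over `q` of `E softMin β q` in the two models, plus `O(1/n)`.

One sample (`exists_abs_integral_softMin_sub_le`). Here `-β softMin` is the logarithm of `Z = ∑ j,
q_j exp(-β L_j) ∈ (0, 1]`. Second moments control small values of `Z`; elsewhere the logarithm is
nearly a polynomial in `Z`. Finally `E Z^m` is a `q`-average of replicated moments `E exp(-β ∑ i,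
L_{j_i})`, each a bounded continuous function of the noise and of `m k + k⋆` projections. This
number depends neither on `p` nor on the size of the net.

Projections (`eventually_abs_integral_projWithNoise_sub_le`). Linear combinations of points of `S`
are multiples of points of `S`, so one-dimensional Gaussianity along `S` compares joint
characteristic functions. Tightness then compares the laws, uniformly in the directions. -/

namespace EmpiricalRisk

/-! ### Subgaussian variables and their eighth moments -/

/-- `E exp (X² / T²) ≤ 2`, that is, `X` has subgaussian norm at most `T`. -/
def ExpSqLe {α : Type*} [MeasurableSpace α] (T : ℝ) (X : α → ℝ) (P : Measure α) : Prop :=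
  ∫⁻ a, ENNReal.ofReal (Real.exp ((X a) ^ 2 / T ^ 2)) ∂P ≤ 2

section ExpSq

variable {α : Type*} [MeasurableSpace α] {P : Measure α} {X : α → ℝ} {T : ℝ}

/-- The infimum in `psi2Norm` is not assumed to be attained; a strict gap provides an admissible `t
< T`, and the exponential moment decreases in `t`. -/
lemma expSqLe_of_psi2Norm_le {K : ℝ≥0} {T : ℝ} (h : psi2Norm X P ≤ K) (hKT : (K : ℝ) < T) :
    ExpSqLe T X P := by
  have hT : 0 ≤ T := K.coe_nonneg.trans hKT.le
  lift T to ℝ≥0 using hT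
  have h1 : psi2Norm X P < (T : ℝ≥0∞) := h.trans_lt (by exact_mod_cast hKT)
  rw [psi2Norm] at h1
  simp only [iInf_lt_iff] at h1
  obtain ⟨t, ⟨ht, hint⟩, hlt⟩ := h1
  have htT : (t : ℝ) < T := by exact_mod_cast hlt
  refine le_trans (lintegral_mono fun a => ?_) hint
  have : (0 : ℝ) < t := ht
  gcongr

lemma ExpSqLe.const_mul (h : ExpSqLe T X P) {c : ℝ} (hc : c ≠ 0) :
    ExpSqLe (c * T) (fun a => c * X a) P := by
  have key : ∀ a, (c * X a) ^ 2 / (c * T) ^ 2 = X a ^ 2 / T ^ 2 := fun a => by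
    rw [mul_pow, mul_pow, mul_div_mul_left _ _ (pow_ne_zero 2 hc)]
  simpa only [ExpSqLe, key] using h

lemma ExpSqLe.comp {β : Type*} [MeasurableSpace β] {Q : Measure β} {f : β → α}
    (h : ExpSqLe T X P) (hX : Measurable X) (hf : HasLaw f P Q) :
    ExpSqLe T (fun b => X (f b)) Q := by
  unfold ExpSqLe at *
  rw [← hf.map_eq] at h
  rwa [lintegral_map' (by fun_prop) hf.aemeasurable] at h

lemma ExpSqLe.integrable_exp (h : ExpSqLe T X P) (hX : AEMeasurable X P) :
    Integrable (fun a => Real.exp ((X a) ^ 2 / T ^ 2)) P := by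
  refine ⟨by fun_prop, ?_⟩
  rw [hasFiniteIntegral_iff_ofReal (ae_of_all _ fun a => (Real.exp_pos _).le)]
  exact h.trans_lt (by norm_num)

lemma ExpSqLe.integral_exp_le (h : ExpSqLe T X P) (hX : AEMeasurable X P) :
    ∫ a, Real.exp ((X a) ^ 2 / T ^ 2) ∂P ≤ 2 := by
  rw [integral_eq_lintegral_of_nonneg_ae (ae_of_all _ fun a => (Real.exp_pos _).le) (by fun_prop)]
  exact ENNReal.toReal_le_of_le_ofReal (by norm_num) (by simpa [ExpSqLe] using h)

/-- The fourth-order term of the exponential series. Eighth powers are the right degree: the loss is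
quadratic in the response, the response quadratic in the projections, and second moments of the loss
are needed. -/
lemma pow_eight_le_exp (hT : 0 < T) (x : ℝ) : x ^ 8 ≤ 24 * T ^ 8 * Real.exp (x ^ 2 / T ^ 2) := by
  have h := Real.pow_div_factorial_le_exp (x ^ 2 / T ^ 2) (by positivity) 4
  have h4 : ((Nat.factorial 4 : ℕ) : ℝ) = 24 := by norm_num [Nat.factorial]
  rw [h4] at h
  have : x ^ 8 = 24 * T ^ 8 * ((x ^ 2 / T ^ 2) ^ 4 / 24) := by field_simp
  rw [this]
  gcongr

lemma ExpSqLe.integrable_pow_eight (h : ExpSqLe T X P) (hX : AEMeasurable X P) (hT : 0 < T) :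
    Integrable (fun a => (X a) ^ 8) P := by
  refine ((h.integrable_exp hX).const_mul (24 * T ^ 8)).mono' (by fun_prop)
    (ae_of_all _ fun a => ?_)
  rw [Real.norm_of_nonneg (by positivity)]
  exact pow_eight_le_exp hT _

lemma ExpSqLe.integral_pow_eight_le (h : ExpSqLe T X P) (hX : AEMeasurable X P) (hT : 0 < T) :
    ∫ a, (X a) ^ 8 ∂P ≤ 48 * T ^ 8 := by
  calc ∫ a, (X a) ^ 8 ∂P ≤ ∫ a, 24 * T ^ 8 * Real.exp ((X a) ^ 2 / T ^ 2) ∂P :=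
        integral_mono (h.integrable_pow_eight hX hT) ((h.integrable_exp hX).const_mul _)
          fun a => pow_eight_le_exp hT _
    _ = 24 * T ^ 8 * ∫ a, Real.exp ((X a) ^ 2 / T ^ 2) ∂P := integral_const_mul _ _
    _ ≤ 24 * T ^ 8 * 2 := by gcongr; exact h.integral_exp_le hX
    _ = 48 * T ^ 8 := by ring

end ExpSq

/-! ### Subgaussianity along `S` in both models -/

/-- The scale `2K` at most halves the Gaussian exponent: what remains is a multiple of the density
of variance `2v`, of total mass `√2 ≤ 2`. -/
lemma expSqLe_gaussianReal {v : ℝ≥0} {K : ℝ} (hv : (v : ℝ) ≤ K ^ 2) :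
    ExpSqLe (2 * K) (fun x => x) (gaussianReal 0 v) := by
  unfold ExpSqLe
  by_cases h0 : v = 0
  · simp only [h0, gaussianReal_zero_var]
    rw [lintegral_dirac' _ (by fun_prop)]
    simp
  have hvpos : (0 : ℝ) < v := by positivity
  rw [gaussianReal_of_var_ne_zero _ h0,
    lintegral_withDensity_eq_lintegral_mul _ (by fun_prop) (by fun_prop)]
  have hpt : ∀ x : ℝ, (gaussianPDF 0 v * fun a => ENNReal.ofReal (Real.exp (a ^ 2 / (2 * K) ^ 2))) x
      ≤ ENNReal.ofReal ((√(2 * Real.pi * v))⁻¹ * Real.exp (-(1 / (4 * v)) * x ^ 2)) := by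
    intro x
    rw [Pi.mul_apply, gaussianPDF, ← ENNReal.ofReal_mul (gaussianPDFReal_nonneg _ _ _),
      gaussianPDFReal, mul_assoc, ← Real.exp_add]
    gcongr
    have : x ^ 2 / (2 * K) ^ 2 ≤ x ^ 2 / (4 * v) := by
      gcongr
      nlinarith
    calc -(x - 0) ^ 2 / (2 * ↑v) + x ^ 2 / (2 * K) ^ 2
        ≤ -(x - 0) ^ 2 / (2 * ↑v) + x ^ 2 / (4 * v) := by gcongr
      _ = -(1 / (4 * v)) * x ^ 2 := by field_simp; ring
  refine (lintegral_mono hpt).trans ?_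
  rw [← ofReal_integral_eq_lintegral_ofReal
    ((integrable_exp_neg_mul_sq (by positivity)).const_mul _) (ae_of_all _ fun x => by positivity),
    integral_const_mul, integral_gaussian]
  rw [show (2 : ℝ≥0∞) = ENNReal.ofReal 2 by simp]
  gcongr
  rw [← Real.sqrt_inv, ← Real.sqrt_mul (by positivity)]
  rw [Real.sqrt_le_left (by norm_num)]
  have hpi := Real.pi_pos
  have : (2 * Real.pi * (v : ℝ))⁻¹ * (Real.pi / (1 / (4 * v))) = 2 := by field_simp; ring
  rw [this]; norm_num

lemma map_inner_multivariateGaussian {p : ℕ} (A : Matrix (Fin p) (Fin p) ℝ)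
    (θ : EuclideanSpace ℝ (Fin p)) :
    (multivariateGaussian 0 A).map (fun x => inner ℝ θ x) =
      gaussianReal 0 (‖Matrix.toEuclideanCLM (𝕜 := ℝ) (CFC.sqrt A) θ‖ ^ 2).toNNReal := by
  set B := Matrix.toEuclideanCLM (𝕜 := ℝ) (CFC.sqrt A) with hB
  have hsa : IsSelfAdjoint B := (CFC.sqrt_nonneg A).isSelfAdjoint.map _
  rw [multivariateGaussian, Measure.map_map (by fun_prop) (by fun_prop)]
  have : ((fun x => inner ℝ θ x) ∘ fun x => 0 + B x) = innerSL ℝ (B θ) := by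
    ext x
    simp only [Function.comp_apply, zero_add, innerSL_apply_apply]
    conv_lhs => rw [← hsa.adjoint_eq]
    rw [ContinuousLinearMap.adjoint_inner_right]
  rw [← hB, this, IsGaussian.map_eq_gaussianReal, integral_strongDual_stdGaussian,
    variance_dual_stdGaussian, innerSL_apply_norm]

lemma expSqLe_inner_multivariateGaussian {p : ℕ} {A : Matrix (Fin p) (Fin p) ℝ}
    {θ : EuclideanSpace ℝ (Fin p)} {K : ℝ}
    (h : ‖Matrix.toEuclideanCLM (𝕜 := ℝ) (CFC.sqrt A) θ‖ ≤ K) :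
    ExpSqLe (2 * K) (fun x => inner ℝ θ x) (multivariateGaussian 0 A) := by
  refine ExpSqLe.comp (P := gaussianReal 0
    (‖Matrix.toEuclideanCLM (𝕜 := ℝ) (CFC.sqrt A) θ‖ ^ 2).toNNReal) (X := fun x => x)
    (expSqLe_gaussianReal ?_) measurable_id
    ⟨by fun_prop, map_inner_multivariateGaussian A θ⟩
  rw [Real.coe_toNNReal _ (by positivity)]
  gcongr

lemma exists_smul_mem_of_bounded {E : Type*} [NormedAddCommGroup E] [NormedSpace ℝ E] {S : Set E}
    (hconv : Convex ℝ S) (h0 : (0 : E) ∈ S) {R : ℝ} (hR : 0 ≤ R)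
    (hbdd : S ⊆ Metric.closedBall 0 R) {θ : E} (hθ : θ ∈ S) :
    (R + 1)⁻¹ • θ ∈ S ∧ ‖(R + 1)⁻¹ • θ‖ ≤ 1 := by
  constructor
  · exact hconv.smul_mem_of_zero_mem h0 hθ ⟨by positivity, inv_le_one_of_one_le₀ (by linarith)⟩
  · have : ‖θ‖ ≤ R := by simpa using hbdd hθ
    rw [norm_smul, Real.norm_of_nonneg (by positivity), inv_mul_le_one₀ (by positivity)]
    linarith

lemma zero_mem_of_convex_symm {E : Type*} [AddCommGroup E] [Module ℝ E] {S : Set E}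
    (hconv : Convex ℝ S) (hsymm : ∀ θ ∈ S, -θ ∈ S) (hne : S.Nonempty) : (0 : E) ∈ S := by
  obtain ⟨θ, hθ⟩ := hne
  have := hconv hθ (hsymm θ hθ) (a := 1 / 2) (b := 1 / 2) (by norm_num) (by norm_num) (by norm_num)
  simpa using this

/-- The hypothesis concerns the unit ball only. Dividing `θ` by `R + 1 ≥ 1` keeps it in `S`, by
convexity with `0`, and brings it into the ball; homogeneity restores the scale. The factor `2` pays
both for the strict gap in `psi2Norm` and for the Gaussian integral. -/
lemma SubgaussianAlong.expSqLe {p : ℕ} {R K : ℝ≥0} (hK : 0 < K)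
    {S : Set (EuclideanSpace ℝ (Fin p))} (hconv : Convex ℝ S) (h0 : 0 ∈ S)
    (hbdd : S ⊆ Metric.closedBall 0 (R : ℝ)) {μ : Measure (EuclideanSpace ℝ (Fin p))}
    {A : Matrix (Fin p) (Fin p) ℝ} (h : SubgaussianAlong K S μ A)
    {θ : EuclideanSpace ℝ (Fin p)} (hθ : θ ∈ S) :
    ExpSqLe (2 * (R + 1) * K) (fun x => inner ℝ θ x) μ ∧
      ExpSqLe (2 * (R + 1) * K) (fun x => inner ℝ θ x) (multivariateGaussian 0 A) := by
  have hK' : (0 : ℝ) < K := hK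
  obtain ⟨hm, hn⟩ := exists_smul_mem_of_bounded hconv h0 R.coe_nonneg hbdd hθ
  obtain ⟨h1, h2⟩ := h _ hm hn
  have e1 : ExpSqLe (2 * K) (fun x => inner ℝ (((R : ℝ) + 1)⁻¹ • θ) x) μ :=
    expSqLe_of_psi2Norm_le h1 (by linarith)
  have e2 := expSqLe_inner_multivariateGaussian h2
  have hR1 : ((R : ℝ) + 1) ≠ 0 := by positivity
  have key : (fun x => inner ℝ θ x) =
      fun x => ((R : ℝ) + 1) * inner ℝ (((R : ℝ) + 1)⁻¹ • θ) x := by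
    ext x
    rw [real_inner_smul_left, mul_inv_cancel_left₀ hR1]
  have hT : (2 * ((R : ℝ) + 1) * K) = ((R : ℝ) + 1) * (2 * K) := by ring
  rw [key, hT]
  exact ⟨e1.const_mul hR1, e2.const_mul hR1⟩

/-! ### Joint laws of finitely many projections and of the noise -/

lemma expSqLe_map {α β : Type*} [MeasurableSpace α] [MeasurableSpace β] {Q : Measure β}
    {f : β → α} {X : α → ℝ} {T : ℝ} (hX : Measurable X) (hf : Measurable f)
    (h : ExpSqLe T (fun b => X (f b)) Q) : ExpSqLe T X (Q.map f) := by
  unfold ExpSqLe at *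
  rwa [lintegral_map (by fun_prop) hf]

/-- Since `x² ≤ T² exp(x²/T²)`, second moments are bounded uniformly over `A`, and Chebyshev's
inequality applies. -/
lemma isTightMeasureSet_of_expSqLe {ι : Type*} [Fintype ι] {T : ℝ} (hT : 0 < T)
    {A : Set (Measure (EuclideanSpace ℝ ι))}
    (h : ∀ m ∈ A, ∀ i, ExpSqLe T (fun z : EuclideanSpace ℝ ι => z i) m) :
    IsTightMeasureSet A := by
  refine isTightMeasureSet_of_tendsto_measure_norm_gt ?_
  set c : ℝ := Fintype.card ι * (2 * T ^ 2) with hc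
  have hbound : ∀ r : ℝ, 0 < r → (⨆ m ∈ A, m {x | r < ‖x‖}) ≤ ENNReal.ofReal (c / r ^ 2) := by
    intro r hr
    refine iSup₂_le fun m hm => ?_
    have h1 : ∫⁻ z, ENNReal.ofReal (‖z‖ ^ 2) ∂m ≤ ENNReal.ofReal c := by
      calc ∫⁻ z, ENNReal.ofReal (‖z‖ ^ 2) ∂m
          ≤ ∫⁻ z, ∑ i, ENNReal.ofReal (T ^ 2) *
              ENNReal.ofReal (Real.exp ((z i) ^ 2 / T ^ 2)) ∂m := by
            refine lintegral_mono fun z => ?_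
            rw [EuclideanSpace.real_norm_sq_eq, ENNReal.ofReal_sum_of_nonneg fun i _ => sq_nonneg _]
            refine Finset.sum_le_sum fun i _ => ?_
            rw [← ENNReal.ofReal_mul (by positivity)]
            refine ENNReal.ofReal_le_ofReal ?_
            have := Real.add_one_le_exp ((z i) ^ 2 / T ^ 2)
            calc (z i) ^ 2 = T ^ 2 * ((z i) ^ 2 / T ^ 2) := by field_simp
              _ ≤ _ := by gcongr; linarith
        _ = ∑ i, ENNReal.ofReal (T ^ 2) *
              ∫⁻ z, ENNReal.ofReal (Real.exp ((z i) ^ 2 / T ^ 2)) ∂m := by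
            rw [lintegral_finsetSum _ fun i _ => by fun_prop]
            refine Finset.sum_congr rfl fun i _ => ?_
            rw [lintegral_const_mul _ (by fun_prop)]
        _ ≤ ∑ i : ι, ENNReal.ofReal (T ^ 2) * 2 := by
            gcongr with i
            exact h m hm i
        _ = ENNReal.ofReal c := by
            rw [Finset.sum_const, Finset.card_univ, nsmul_eq_mul, hc,
              ENNReal.ofReal_mul (by positivity), ENNReal.ofReal_mul (by positivity)]
            simp [mul_comm]
    have h2 := mul_meas_ge_le_lintegral (μ := m)
      (f := fun z => ENNReal.ofReal (‖z‖ ^ 2)) (by fun_prop) (ENNReal.ofReal (r ^ 2))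
    have hr2 : ENNReal.ofReal (r ^ 2) ≠ 0 := by simpa using hr.ne'
    have h3 : m {x | r < ‖x‖} ≤ m {x | ENNReal.ofReal (r ^ 2) ≤ ENNReal.ofReal (‖x‖ ^ 2)} := by
      refine measure_mono fun x hx => ENNReal.ofReal_le_ofReal ?_
      have : r < ‖x‖ := hx
      gcongr
    rw [ENNReal.ofReal_div_of_pos (by positivity), ENNReal.le_div_iff_mul_le (Or.inl hr2)
      (Or.inl ENNReal.ofReal_ne_top), mul_comm]
    exact (mul_le_mul_right h3 _).trans (h2.trans h1)
  have hlim : Tendsto (fun r : ℝ => ENNReal.ofReal (c / r ^ 2)) atTop (𝓝 0) := by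
    rw [← ENNReal.ofReal_zero]
    exact ENNReal.tendsto_ofReal (tendsto_const_nhds.div_atTop (tendsto_pow_atTop two_ne_zero))
  refine tendsto_of_tendsto_of_tendsto_of_le_of_le' tendsto_const_nhds hlim
    (Eventually.of_forall fun _ => zero_le) ?_
  filter_upwards [eventually_gt_atTop 0] with r hr using hbound r hr

/-- Two tight sequences of laws with asymptotically equal characteristic functions are
asymptotically equal. -/
lemma tendsto_integral_sub_of_charFun {V : Type*} [NormedAddCommGroup V] [InnerProductSpace ℝ V]
    [FiniteDimensional ℝ V] [MeasurableSpace V] [BorelSpace V] {m m' : ℕ → ProbabilityMeasure V}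
    (hm : IsTightMeasureSet (Set.range fun n => (m n : Measure V)))
    (hm' : IsTightMeasureSet (Set.range fun n => (m' n : Measure V)))
    (hchar : ∀ t : V, Tendsto (fun n => charFun (m n : Measure V) t - charFun (m' n : Measure V) t)
      atTop (𝓝 0))
    (F : BoundedContinuousFunction V ℝ) :
    Tendsto (fun n => ∫ z, F z ∂(m n : Measure V) - ∫ z, F z ∂(m' n : Measure V)) atTop (𝓝 0) := by
  have hcomp : ∀ {m : ℕ → ProbabilityMeasure V},
      IsTightMeasureSet (Set.range fun n => (m n : Measure V)) →
      IsCompact (closure (Set.range m)) := fun {m} h => by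
    refine isCompact_closure_of_isTightMeasureSet (h.subset ?_)
    rintro _ ⟨ρ, ⟨n, rfl⟩, rfl⟩
    exact ⟨n, rfl⟩
  -- By Prokhorov, any subsequence has a further one along which both laws converge; equality of the
  -- limiting characteristic functions identifies the two limits.
  refine tendsto_of_subseq_tendsto fun ns hns => ?_
  obtain ⟨a, -, φ, hφ, ha⟩ := (hcomp hm).isSeqCompact
    (x := fun n => m (ns n)) fun n => subset_closure ⟨ns n, rfl⟩
  obtain ⟨b, -, χ, hχ, hb⟩ := (hcomp hm').isSeqCompact
    (x := fun n => m' (ns (φ n))) fun n => subset_closure ⟨ns (φ n), rfl⟩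
  have ha' : Tendsto (fun n => m (ns (φ (χ n)))) atTop (𝓝 a) := ha.comp hχ.tendsto_atTop
  have hb' : Tendsto (fun n => m' (ns (φ (χ n)))) atTop (𝓝 b) := hb
  have hsub : Tendsto (fun n => ns (φ (χ n))) atTop atTop :=
    hns.comp (hφ.tendsto_atTop.comp hχ.tendsto_atTop)
  have hab : a = b := by
    refine Subtype.ext (Measure.ext_of_charFun (μ := (a : Measure V)) (ν := (b : Measure V))
      (funext fun t => ?_))
    have h1 := ProbabilityMeasure.tendsto_iff_tendsto_charFun.1 ha' t
    have h2 := ProbabilityMeasure.tendsto_iff_tendsto_charFun.1 hb' t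
    exact sub_eq_zero.1 (tendsto_nhds_unique (h1.sub h2) ((hchar t).comp hsub))
  refine ⟨fun n => φ (χ n), ?_⟩
  have h1 := ProbabilityMeasure.tendsto_iff_forall_integral_tendsto.1 ha' F
  have h2 := ProbabilityMeasure.tendsto_iff_forall_integral_tendsto.1 hb' F
  simpa [hab] using h1.sub h2

lemma abs_integral_sub_le_iSup {p : ℕ} {S : Set (EuclideanSpace ℝ (Fin p))}
    {μ μ' : Measure (EuclideanSpace ℝ (Fin p))} [IsProbabilityMeasure μ] [IsProbabilityMeasure μ']
    {φ : ℝ → ℝ} (hφ : BoundedLipschitz φ) {θ : EuclideanSpace ℝ (Fin p)} (hθ : θ ∈ S) :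
    |(∫ x, φ (inner ℝ θ x) ∂μ) - ∫ x, φ (inner ℝ θ x) ∂μ'| ≤
      ⨆ θ : S, |(∫ x, φ (inner ℝ (θ : EuclideanSpace ℝ (Fin p)) x) ∂μ) -
        ∫ x, φ (inner ℝ (θ : EuclideanSpace ℝ (Fin p)) x) ∂μ'| := by
  obtain ⟨⟨M, hM⟩, -⟩ := hφ
  have hb : ∀ (m : Measure (EuclideanSpace ℝ (Fin p))) [IsProbabilityMeasure m]
      (θ : EuclideanSpace ℝ (Fin p)), |∫ x, φ (inner ℝ θ x) ∂m| ≤ M := fun m _ θ => by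
    simpa using norm_integral_le_of_norm_le_const (μ := m) (f := fun x => φ (inner ℝ θ x))
      (C := M) (ae_of_all _ fun x => hM _)
  -- A real supremum dominates its terms only once the range is bounded above; `2M` serves.
  refine le_ciSup (f := fun θ : S => |(∫ x, φ (inner ℝ (θ : EuclideanSpace ℝ (Fin p)) x) ∂μ) -
        ∫ x, φ (inner ℝ (θ : EuclideanSpace ℝ (Fin p)) x) ∂μ'|) ⟨M + M, ?_⟩ ⟨θ, hθ⟩
  rintro _ ⟨θ, rfl⟩
  exact (abs_sub _ _).trans (add_le_add (hb μ θ) (hb μ' θ))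

lemma boundedLipschitz_cos (s : ℝ) : BoundedLipschitz fun t => Real.cos (s * t) :=
  ⟨⟨1, fun _ => Real.abs_cos_le_one _⟩, 1 * ‖s‖₊,
    Real.lipschitzWith_cos.comp (lipschitzWith_smul s)⟩

lemma boundedLipschitz_sin (s : ℝ) : BoundedLipschitz fun t => Real.sin (s * t) :=
  ⟨⟨1, fun _ => Real.abs_sin_le_one _⟩, 1 * ‖s‖₊,
    Real.lipschitzWith_sin.comp (lipschitzWith_smul s)⟩

/-- A convex combination with weights `|t i|` of the points `± θ i`, the missing mass being placed
at `0`. -/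
lemma sum_smul_mem_of_sum_abs_le_one {E ι : Type*} [AddCommGroup E] [Module ℝ E] [Fintype ι]
    {S : Set E} (hconv : Convex ℝ S) (hsymm : ∀ θ ∈ S, -θ ∈ S) (h0 : 0 ∈ S) {θ : ι → E}
    (hθ : ∀ i, θ i ∈ S) {t : ι → ℝ} (ht : ∑ i, |t i| ≤ 1) : ∑ i, t i • θ i ∈ S := by
  have h1 : ∀ i, (SignType.sign (t i) : ℝ) • θ i ∈ S := fun i => by
    rcases lt_trichotomy (t i) 0 with h | h | h
    · simpa [sign_neg h] using hsymm _ (hθ i)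
    · simpa [h] using h0
    · simpa [sign_pos h] using hθ i
  have h2 := hconv.sum_mem (t := (Finset.univ : Finset (Option ι)))
    (w := fun o => o.elim (1 - ∑ i, |t i|) fun i => |t i|)
    (z := fun o => o.elim 0 fun i => (SignType.sign (t i) : ℝ) • θ i) ?_ ?_ ?_
  · simpa [Fintype.sum_option, smul_smul, abs_mul_sign] using h2
  · rintro (_ | i) -
    · simpa using ht
    · simp
  · simp [Fintype.sum_option]
  · rintro (_ | i) -
    · simpa using h0
    · simpa using h1 i

/-- Reduces a characteristic function to real bounded Lipschitz test functions. The scale `s` goes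
into the test function so that the direction `θ` can stay in `S`. -/
lemma charFun_eq_integral_cos_add_sin {V : Type*} [NormedAddCommGroup V] [InnerProductSpace ℝ V]
    [MeasurableSpace V] [OpensMeasurableSpace V] [SecondCountableTopology V] (m : Measure V)
    [IsProbabilityMeasure m] (s : ℝ) (θ : V) :
    charFun m (s • θ) = ((∫ x, Real.cos (s * inner ℝ θ x) ∂m : ℝ) : ℂ) +
      ((∫ x, Real.sin (s * inner ℝ θ x) ∂m : ℝ) : ℂ) * Complex.I := by
  have hi : ∀ f : ℝ → ℝ, (∀ t, |f t| ≤ 1) → Continuous f →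
      Integrable (fun x => ((f (s * inner ℝ θ x) : ℝ) : ℂ)) m := fun f hf hc =>
    (Integrable.of_bound (C := 1) (by fun_prop) (ae_of_all _ fun x => hf _)).ofReal
  rw [charFun_apply, ← integral_complex_ofReal, ← integral_complex_ofReal, ← integral_mul_const,
    ← integral_add (hi _ Real.abs_cos_le_one Real.continuous_cos)
      ((hi _ Real.abs_sin_le_one Real.continuous_sin).mul_const _)]
  congr with x
  rw [real_inner_smul_right, real_inner_comm, Complex.exp_mul_I]
  push_cast
  rfl

/-- The vector `((⟨θ_i, x⟩)_i, e)` for `z = (x, e)`, with `e` stored at `none`. -/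
noncomputable def projWithNoise {p : ℕ} {ι : Type*} (θ : ι → EuclideanSpace ℝ (Fin p))
    (z : EuclideanSpace ℝ (Fin p) × ℝ) : EuclideanSpace ℝ (Option ι) :=
  WithLp.toLp 2 fun o => o.elim z.2 fun i => inner ℝ (θ i) z.1

lemma measurable_projWithNoise {p : ℕ} {ι : Type*} [Fintype ι]
    (θ : ι → EuclideanSpace ℝ (Fin p)) : Measurable (projWithNoise θ) := by
  unfold projWithNoise
  refine (WithLp.measurable_toLp 2 _).comp (measurable_pi_lambda _ ?_)
  rintro (_ | i) <;> simp <;> fun_prop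

lemma inner_projWithNoise {p : ℕ} {ι : Type*} [Fintype ι] (θ : ι → EuclideanSpace ℝ (Fin p))
    (z : EuclideanSpace ℝ (Fin p) × ℝ) (t : EuclideanSpace ℝ (Option ι)) :
    inner ℝ (projWithNoise θ z) t =
      inner ℝ z.1 (∑ i, t (some i) • θ i) + z.2 * t none := by
  have h : ∀ i, inner ℝ z.1 (t (some i) • θ i) = t (some i) * inner ℝ (θ i) z.1 := fun i => by
    rw [real_inner_smul_right, real_inner_comm]
  rw [PiLp.inner_apply, Fintype.sum_option, inner_sum, Finset.sum_congr rfl fun i _ => h i,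
    add_comm]
  simp only [projWithNoise, Option.elim, RCLike.inner_apply, conj_trivial]
  rw [mul_comm z.2]

/-- Independence of features and noise factors the characteristic function; the noise factor is
common to the two models. -/
lemma charFun_map_projWithNoise {p : ℕ} {ι : Type*} [Fintype ι]
    (θ : ι → EuclideanSpace ℝ (Fin p)) (μ : Measure (EuclideanSpace ℝ (Fin p))) (ν : Measure ℝ)
    [IsProbabilityMeasure μ] [IsProbabilityMeasure ν] (t : EuclideanSpace ℝ (Option ι)) :
    charFun ((μ.prod ν).map (projWithNoise θ)) t =
      charFun μ (∑ i, t (some i) • θ i) * charFun ν (t none) := by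
  rw [charFun_apply, integral_map (measurable_projWithNoise θ).aemeasurable (by fun_prop),
    charFun_apply, charFun_apply, ← integral_prod_mul]
  congr with z
  rw [inner_projWithNoise, ← Complex.exp_add]
  congr 1
  push_cast
  simp
  ring

/-- The joint laws of the noise and of finitely many projections of the features along `S n` are
asymptotically the same in the two models, uniformly over the directions. -/
theorem eventually_abs_integral_projWithNoise_sub_le {p : ℕ → ℕ}
    {S : ∀ n, Set (EuclideanSpace ℝ (Fin (p n)))} (hconv : ∀ n, Convex ℝ (S n))
    (hsymm : ∀ n, ∀ θ ∈ S n, -θ ∈ S n) (h0 : ∀ n, 0 ∈ S n)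
    {μ : ∀ n, Measure (EuclideanSpace ℝ (Fin (p n)))}
    {Cov : ∀ n, Matrix (Fin (p n)) (Fin (p n)) ℝ} {ν : ℕ → Measure ℝ}
    (hμ : ∀ n, 0 < n → IsProbabilityMeasure (μ n)) (hν : ∀ n, 0 < n → IsProbabilityMeasure (ν n))
    {T : ℝ} (hT : 0 < T)
    (hsub : ∀ n, ∀ θ ∈ S n, ExpSqLe T (fun x => inner ℝ θ x) (μ n))
    (hsubG : ∀ n, ∀ θ ∈ S n, ExpSqLe T (fun x => inner ℝ θ x) (multivariateGaussian 0 (Cov n)))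
    (hnoise : ∀ n, ExpSqLe T (fun e => e) (ν n))
    (hgauss : AsymptoticallyGaussianAlong S μ Cov) {ι : Type*} [Fintype ι]
    (F : BoundedContinuousFunction (EuclideanSpace ℝ (Option ι)) ℝ) {δ : ℝ} (hδ : 0 < δ) :
    ∀ᶠ n in atTop, ∀ θ : ι → EuclideanSpace ℝ (Fin (p n)), (∀ i, θ i ∈ S n) →
      |(∫ z, F (projWithNoise θ z) ∂((μ n).prod (ν n))) -
        ∫ z, F (projWithNoise θ z) ∂((multivariateGaussian 0 (Cov n)).prod (ν n))| ≤ δ := by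
  -- Uniformity in the directions comes by contradiction: offending directions along a subsequence
  -- reduce the claim to convergence along one sequence of tuples.
  by_contra hcon
  have hfreq := (not_eventually.1 hcon).and_eventually (eventually_gt_atTop 0)
  obtain ⟨φ, hφ, hprop⟩ := extraction_of_frequently_atTop hfreq
  have hpos := fun n => (hprop n).2
  have hbad := fun n => (hprop n).1
  push Not at hbad
  choose θ hθ hlt using hbad
  have _ := fun n => hμ (φ n) (hpos n)
  have _ := fun n => hν (φ n) (hpos n)
  have hmap : ∀ n (ρ : Measure (EuclideanSpace ℝ (Fin (p (φ n))))) [IsProbabilityMeasure ρ],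
      IsProbabilityMeasure ((ρ.prod (ν (φ n))).map (projWithNoise (θ n))) := fun n ρ _ =>
    Measure.isProbabilityMeasure_map (measurable_projWithNoise _).aemeasurable
  have htight : ∀ ρ : ∀ n, Measure (EuclideanSpace ℝ (Fin (p n))),
      (∀ n, IsProbabilityMeasure (ρ (φ n))) →
      (∀ n, ∀ θ ∈ S n, ExpSqLe T (fun x => inner ℝ θ x) (ρ n)) →
      IsTightMeasureSet (Set.range fun n =>
        ((ρ (φ n)).prod (ν (φ n))).map (projWithNoise (θ n))) := by
    intro ρ hρ hsubρ
    refine isTightMeasureSet_of_expSqLe hT ?_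
    rintro _ ⟨n, rfl⟩ o
    refine expSqLe_map (by fun_prop) (measurable_projWithNoise _) ?_
    have _ := hρ n
    rcases o with _ | i
    · exact (hnoise (φ n)).comp (f := Prod.snd) measurable_id
        ⟨by fun_prop, by simp⟩
    · exact (hsubρ (φ n) _ (hθ n i)).comp (f := Prod.fst) (by fun_prop)
        ⟨by fun_prop, by simp⟩
  have hchar : ∀ t : EuclideanSpace ℝ (Option ι), Tendsto (fun n =>
      charFun (((μ (φ n)).prod (ν (φ n))).map (projWithNoise (θ n))) t -
      charFun (((multivariateGaussian 0 (Cov (φ n))).prod (ν (φ n))).map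
        (projWithNoise (θ n))) t) atTop (𝓝 0) := by
    intro t
    -- Cramér–Wold inside `S`: dividing by `s` puts the combination `u` into `S`. The summand `1`
    -- keeps `s` positive even for `t = 0`.
    set s : ℝ := ∑ i, |t (some i)| + 1 with hs
    have hs0 : 0 < s := by positivity
    have hcos := (hgauss _ (boundedLipschitz_cos s)).comp hφ.tendsto_atTop
    have hsin := (hgauss _ (boundedLipschitz_sin s)).comp hφ.tendsto_atTop
    have hsum := hcos.add hsin
    rw [add_zero] at hsum
    refine squeeze_zero_norm (fun n => ?_) hsum
    set u : EuclideanSpace ℝ (Fin (p (φ n))) := ∑ i, (t (some i) / s) • θ n i with hu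
    have huS : u ∈ S (φ n) := by
      refine sum_smul_mem_of_sum_abs_le_one (hconv _) (hsymm _) (h0 _) (hθ n) ?_
      simp_rw [abs_div, ← Finset.sum_div]
      rw [abs_of_pos hs0, div_le_one hs0]
      linarith
    have hsu : ∑ i, t (some i) • θ n i = s • u := by
      rw [hu, Finset.smul_sum]
      refine Finset.sum_congr rfl fun i _ => ?_
      rw [smul_smul, mul_div_cancel₀ _ hs0.ne']
    rw [charFun_map_projWithNoise, charFun_map_projWithNoise, hsu, ← sub_mul, norm_mul]
    refine (mul_le_of_le_one_right (norm_nonneg _) (norm_charFun_le_one _)).trans ?_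
    rw [charFun_eq_integral_cos_add_sin, charFun_eq_integral_cos_add_sin, add_sub_add_comm,
      ← sub_mul, ← Complex.ofReal_sub, ← Complex.ofReal_sub]
    refine (norm_add_le _ _).trans ?_
    rw [norm_mul, Complex.norm_I, mul_one, Complex.norm_real, Complex.norm_real]
    exact add_le_add (abs_integral_sub_le_iSup (boundedLipschitz_cos s) huS)
      (abs_integral_sub_le_iSup (boundedLipschitz_sin s) huS)
  have hlim := tendsto_integral_sub_of_charFun
    (m := fun n => ⟨((μ (φ n)).prod (ν (φ n))).map (projWithNoise (θ n)), hmap n _⟩)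
    (m' := fun n => ⟨((multivariateGaussian 0 (Cov (φ n))).prod (ν (φ n))).map
      (projWithNoise (θ n)), hmap n _⟩)
    (htight μ inferInstance hsub)
    (htight (fun n => multivariateGaussian 0 (Cov n)) inferInstance hsubG) hchar F
  obtain ⟨n, hn⟩ := ((tendsto_order.1 hlim.abs).2 δ (by simpa using hδ)).exists
  simp only [ProbabilityMeasure.coe_mk] at hn
  rw [integral_map (measurable_projWithNoise _).aemeasurable (by fun_prop),
    integral_map (measurable_projWithNoise _).aemeasurable (by fun_prop)] at hn
  exact absurd hn (hlt n).not_gt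

/-! ### Free energies -/

/-- The free energy `-(1/β) log ∑ j, q_j exp (-β u_j)`, a soft minimum of the values `u_j`. -/
noncomputable def softMin {J : Type*} [Fintype J] (β : ℝ) (q u : J → ℝ) : ℝ :=
  -(1 / β) * Real.log (∑ j, q j * Real.exp (-β * u j))

section SoftMin

variable {J : Type*} [Fintype J] {β : ℝ} {q u : J → ℝ}

lemma sum_mul_exp_pos [Nonempty J] (hq : ∀ j, 0 < q j) :
    0 < ∑ j, q j * Real.exp (-β * u j) :=
  Finset.sum_pos (fun j _ => mul_pos (hq j) (Real.exp_pos _)) Finset.univ_nonempty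

lemma sum_mul_exp_pos_of_mem_stdSimplex (hq : q ∈ stdSimplex ℝ J) :
    0 < ∑ j, q j * Real.exp (-β * u j) := by
  refine Finset.sum_pos' (fun j _ => mul_nonneg (hq.1 j) (Real.exp_pos _).le) ?_
  by_contra! hcon
  have : ∑ j, q j ≤ 0 := Finset.sum_nonpos fun j hj => by
    have h := hcon j hj
    have h2 := Real.exp_pos (-β * u j)
    by_contra! hc
    exact absurd (mul_pos hc h2) h.not_gt
  rw [hq.2] at this
  linarith

lemma sum_mul_exp_le_one (hβ : 0 < β) (hq : q ∈ stdSimplex ℝ J) (hu : ∀ j, 0 ≤ u j) :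
    ∑ j, q j * Real.exp (-β * u j) ≤ 1 := by
  rw [← hq.2]
  refine Finset.sum_le_sum fun j _ => mul_le_of_le_one_right (hq.1 j) ?_
  rw [Real.exp_le_one_iff]
  nlinarith [mul_nonneg hβ.le (hu j)]

lemma softMin_nonneg (hβ : 0 < β) (hq : q ∈ stdSimplex ℝ J) (hu : ∀ j, 0 ≤ u j) :
    0 ≤ softMin β q u := by
  have h1 := Real.log_nonpos (sum_mul_exp_pos_of_mem_stdSimplex (β := β) (u := u) hq).le
    (sum_mul_exp_le_one hβ hq hu)
  have h2 : 0 < 1 / β := by positivity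
  unfold softMin
  nlinarith

/-- Jensen's inequality for the exponential. -/
lemma softMin_le_sum (hβ : 0 < β) (hq : q ∈ stdSimplex ℝ J) :
    softMin β q u ≤ ∑ j, q j * u j := by
  have h := convexOn_exp.map_sum_le (t := Finset.univ) (w := q) (p := fun j => -β * u j)
    (fun i _ => hq.1 i) hq.2 fun i _ => Set.mem_univ _
  simp only [smul_eq_mul] at h
  have h1 := Real.log_le_log (Real.exp_pos _) h
  rw [Real.log_exp] at h1
  have h2 : ∑ j, q j * (-β * u j) = -β * ∑ j, q j * u j := by
    rw [Finset.mul_sum]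
    exact Finset.sum_congr rfl fun j _ => by ring
  rw [h2] at h1
  unfold softMin
  have h3 : 0 < 1 / β := by positivity
  calc -(1 / β) * Real.log (∑ j, q j * Real.exp (-β * u j))
      ≤ -(1 / β) * (-β * ∑ j, q j * u j) := by
        rw [neg_mul, neg_mul, neg_le_neg_iff]
        exact mul_le_mul_of_nonneg_left h1 h3.le
    _ = ∑ j, q j * u j := by field_simp

/-- Averages against `q` keep the second moment bounds independent of the number of parameters,
which is exponentially large in `p`. -/
lemma sq_softMin_le (hβ : 0 < β) (hq : q ∈ stdSimplex ℝ J) (hu : ∀ j, 0 ≤ u j) :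
    softMin β q u ^ 2 ≤ ∑ j, q j * u j ^ 2 :=
  (pow_le_pow_left₀ (softMin_nonneg hβ hq hu) (softMin_le_sum hβ hq) 2).trans
    (Real.pow_arith_mean_le_arith_mean_pow _ _ _ (fun i _ => hq.1 i) hq.2 (fun i _ => hu i) 2)

/-- An extra energy is absorbed into the weights. This is what lets the samples other than the
exchanged one be frozen. -/
lemma softMin_add (w u u' : J → ℝ) :
    softMin β w (fun j => u j + u' j) = softMin β (fun j => w j * Real.exp (-β * u j)) u' := by
  unfold softMin
  simp_rw [mul_add, Real.exp_add, mul_assoc]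

lemma softMin_smul [Nonempty J] {w : J → ℝ} (hw : ∀ j, 0 < w j) {c : ℝ} (hc : 0 < c) :
    softMin β (fun j => c * w j) u = -(1 / β) * Real.log c + softMin β w u := by
  unfold softMin
  simp_rw [mul_assoc, ← Finset.mul_sum]
  rw [Real.log_mul hc.ne' (sum_mul_exp_pos hw).ne', mul_add]

/-- Normalising the weights costs an additive constant that does not depend on `u`. -/
lemma exists_softMin_eq_add [Nonempty J] {w : J → ℝ} (hw : ∀ j, 0 < w j) :
    ∃ a, ∃ q ∈ stdSimplex ℝ J, ∀ u, softMin β w u = a + softMin β q u := by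
  have hc : 0 < ∑ j, w j := Finset.sum_pos (fun j _ => hw j) Finset.univ_nonempty
  refine ⟨-(1 / β) * Real.log (∑ j, w j), fun j => w j / ∑ j, w j,
    ⟨fun j => (div_pos (hw j) hc).le, ?_⟩, fun u => ?_⟩
  · rw [← Finset.sum_div, div_self hc.ne']
  · rw [← softMin_smul (fun j => div_pos (hw j) hc) hc]
    congr with j
    field_simp

lemma softMin_le [Nonempty J] (hβ : 0 < β) {w : J → ℝ} (hw : ∀ j, 0 < w j) (j : J) :
    softMin β w u ≤ u j - (1 / β) * Real.log (w j) := by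
  have h : w j * Real.exp (-β * u j) ≤ ∑ j, w j * Real.exp (-β * u j) :=
    Finset.single_le_sum (f := fun j => w j * Real.exp (-β * u j))
      (fun i _ => (mul_pos (hw i) (Real.exp_pos _)).le) (Finset.mem_univ j)
  have h1 := Real.log_le_log (mul_pos (hw j) (Real.exp_pos _)) h
  rw [Real.log_mul (hw j).ne' (Real.exp_ne_zero _), Real.log_exp] at h1
  unfold softMin
  have h3 : 0 < 1 / β := by positivity
  have h4 := mul_le_mul_of_nonneg_left h1 h3.le
  have h5 : 1 / β * (Real.log (w j) + -β * u j) = 1 / β * Real.log (w j) - u j := by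
    field_simp; ring
  linarith

lemma measurable_softMin {E : Type*} [MeasurableSpace E] {L : J → E → ℝ}
    (hL : ∀ j, Measurable (L j)) : Measurable fun e => softMin β q fun j => L j e := by
  unfold softMin
  fun_prop

end SoftMin

lemma integrable_softMin {J E : Type*} [Fintype J] [MeasurableSpace E] {β : ℝ} (hβ : 0 < β)
    {q : J → ℝ} (hq : q ∈ stdSimplex ℝ J) {L : J → E → ℝ} (hL : ∀ j, Measurable (L j))
    (hL0 : ∀ j e, 0 ≤ L j e) {π : Measure E} [IsProbabilityMeasure π]
    (hint : ∀ j, Integrable (fun e => L j e ^ 2) π) {M : ℝ}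
    (hM : ∀ j, ∫ e, L j e ^ 2 ∂π ≤ M) :
    Integrable (fun e => softMin β q fun j => L j e) π ∧
      Integrable (fun e => (softMin β q fun j => L j e) ^ 2) π ∧
      ∫ e, (softMin β q fun j => L j e) ^ 2 ∂π ≤ M := by
  have hm := measurable_softMin (β := β) (q := q) hL
  have hint' : Integrable (fun e => ∑ j, q j * L j e ^ 2) π :=
    integrable_finsetSum _ fun j _ => (hint j).const_mul _
  have hsq : Integrable (fun e => (softMin β q fun j => L j e) ^ 2) π := by
    refine hint'.mono' (hm.pow_const 2).aestronglyMeasurable (ae_of_all _ fun e => ?_)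
    rw [Real.norm_of_nonneg (sq_nonneg _)]
    exact sq_softMin_le hβ hq fun j => hL0 j e
  refine ⟨?_, hsq, ?_⟩
  · exact ((memLp_two_iff_integrable_sq hm.aestronglyMeasurable).2 hsq).integrable (by norm_num)
  · calc ∫ e, (softMin β q fun j => L j e) ^ 2 ∂π ≤ ∫ e, ∑ j, q j * L j e ^ 2 ∂π :=
          integral_mono hsq hint' fun e => sq_softMin_le hβ hq fun j => hL0 j e
      _ = ∑ j, q j * ∫ e, L j e ^ 2 ∂π := by
          rw [integral_finsetSum _ fun j _ => (hint j).const_mul _]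
          simp_rw [integral_const_mul]
      _ ≤ ∑ j, q j * M := by
          gcongr with j
          · exact hq.1 j
          · exact hM j
      _ = M := by rw [← Finset.sum_mul, hq.2, one_mul]

lemma integrable_of_abs_le {E : Type*} [MeasurableSpace E] {π : Measure E} [IsFiniteMeasure π]
    {f : E → ℝ} (hf : Measurable f) {C : ℝ} (h : ∀ e, |f e| ≤ C) : Integrable f π :=
  Integrable.of_bound hf.aestronglyMeasurable C (ae_of_all _ h)

lemma abs_integral_sub_integral_le {E : Type*} [MeasurableSpace E] {π : Measure E}
    [IsProbabilityMeasure π] {f g : E → ℝ} (hf : Integrable f π) (hg : Integrable g π) {C : ℝ}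
    (h : ∀ e, |f e - g e| ≤ C) : |∫ e, f e ∂π - ∫ e, g e ∂π| ≤ C := by
  rw [← integral_sub hf hg]
  simpa using norm_integral_le_of_norm_le_const (μ := π) (f := fun e => f e - g e)
    (ae_of_all _ fun e => h e)

/-! ### Exchange of the samples one at a time -/

section Lindeberg

variable {ψ : ℝ → ℝ} {d : ℝ → ℝ} {A D B : ℝ}

lemma abs_integral_taylor_sub_le {E : Type*} [MeasurableSpace E] (hψc : Continuous ψ)
    (hψA : ∀ t, |ψ t| ≤ A) (htaylor : ∀ a s, |ψ (a + s) - ψ a - d a * s| ≤ B * s ^ 2)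
    {π : Measure E} [IsProbabilityMeasure π] {h : E → ℝ} (hm : Measurable h)
    (hi : Integrable h π) (hi2 : Integrable (fun e => h e ^ 2) π) (a : ℝ) :
    |∫ e, ψ (a + h e) ∂π - (ψ a + d a * ∫ e, h e ∂π)| ≤ B * ∫ e, h e ^ 2 ∂π := by
  have h1 : Integrable (fun e => ψ (a + h e)) π :=
    integrable_of_abs_le (by fun_prop) fun e => hψA _
  have h2 : ψ a + d a * ∫ e, h e ∂π = ∫ e, (ψ a + d a * h e) ∂π := by
    rw [integral_add (integrable_const _) (hi.const_mul _), integral_const_mul]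
    simp
  have h3 : Integrable (fun e => ψ a + d a * h e) π := (integrable_const _).add (hi.const_mul _)
  rw [h2, ← integral_sub h1 h3, ← integral_const_mul]
  refine abs_integral_le_integral_abs.trans
    (integral_mono_of_nonneg (ae_of_all _ fun e => abs_nonneg _) (hi2.const_mul _)
      (ae_of_all _ fun e => ?_))
  simp only [← sub_sub]
  exact htaylor a (h e)

variable {J E : Type*} [Fintype J] [Nonempty J] [MeasurableSpace E] {β : ℝ} {L : J → E → ℝ}
  {π π' : Measure E} [IsProbabilityMeasure π] [IsProbabilityMeasure π'] {M δ s : ℝ}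

/-- After normalising the weights, the only random part is `s` times a soft minimum with probability
weights. Its linear contribution is compared by `hδ`, which is uniform in `q` because the frozen
weights are arbitrary; each of the two quadratic remainders is at most `B s² M`. -/
lemma abs_integral_swap_one_le (hψc : Continuous ψ)
    (hψA : ∀ t, |ψ t| ≤ A) (hd : ∀ a, |d a| ≤ D) (hB : 0 ≤ B)
    (htaylor : ∀ a s, |ψ (a + s) - ψ a - d a * s| ≤ B * s ^ 2) (hβ : 0 < β)
    (hL : ∀ j, Measurable (L j)) (hL0 : ∀ j e, 0 ≤ L j e)
    (hint : ∀ j, Integrable (fun e => L j e ^ 2) π)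
    (hint' : ∀ j, Integrable (fun e => L j e ^ 2) π')
    (hM : ∀ j, ∫ e, L j e ^ 2 ∂π ≤ M) (hM' : ∀ j, ∫ e, L j e ^ 2 ∂π' ≤ M)
    (hδ : ∀ q ∈ stdSimplex ℝ J, |∫ e, softMin β q (fun j => L j e) ∂π -
      ∫ e, softMin β q (fun j => L j e) ∂π'| ≤ δ) (hs : 0 ≤ s)
    {w : J → ℝ} (hw : ∀ j, 0 < w j) :
    |∫ e, ψ (s * softMin β w fun j => L j e) ∂π - ∫ e, ψ (s * softMin β w fun j => L j e) ∂π'| ≤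
      D * (s * δ) + 2 * (B * (s ^ 2 * M)) := by
  obtain ⟨a, q, hq, haq⟩ := exists_softMin_eq_add (β := β) hw
  simp_rw [haq, mul_add]
  set h : E → ℝ := fun e => softMin β q fun j => L j e with hh
  have hm : Measurable h := measurable_softMin hL
  obtain ⟨i1, i2, i3⟩ := integrable_softMin hβ hq hL hL0 hint hM
  obtain ⟨i1', i2', i3'⟩ := integrable_softMin hβ hq hL hL0 hint' hM'
  have key : ∀ (ρ : Measure E) [IsProbabilityMeasure ρ], Integrable h ρ →
      Integrable (fun e => h e ^ 2) ρ → ∫ e, h e ^ 2 ∂ρ ≤ M →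
      |∫ e, ψ (s * a + s * h e) ∂ρ - (ψ (s * a) + d (s * a) * (s * ∫ e, h e ∂ρ))| ≤
        B * (s ^ 2 * M) := by
    intro ρ _ j1 j2 j3
    have := abs_integral_taylor_sub_le hψc hψA htaylor (h := fun e => s * h e)
      (by fun_prop) (j1.const_mul s) (by simpa only [mul_pow] using j2.const_mul (s ^ 2)) (s * a)
    simp only [mul_pow, integral_const_mul] at this
    refine this.trans ?_
    gcongr
  have k1 := key π i1 i2 i3
  have k2 := key π' i1' i2' i3'
  have k3 : |d (s * a) * (s * ∫ e, h e ∂π) - d (s * a) * (s * ∫ e, h e ∂π')| ≤ D * (s * δ) := by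
    rw [← mul_sub, ← mul_sub, abs_mul, abs_mul, abs_of_nonneg hs]
    have := hδ q hq
    have hD := (abs_nonneg _).trans (hd 0)
    gcongr
    exact hd _
  rw [abs_le] at *
  constructor <;> linarith

/-- Lindeberg's exchange argument for soft minima of sums of independent losses. -/
theorem abs_integral_pi_softMin_sub_le (hψc : Continuous ψ)
    (hψA : ∀ t, |ψ t| ≤ A) (hd : ∀ a, |d a| ≤ D) (hB : 0 ≤ B)
    (htaylor : ∀ a s, |ψ (a + s) - ψ a - d a * s| ≤ B * s ^ 2) (hβ : 0 < β)
    (hL : ∀ j, Measurable (L j)) (hL0 : ∀ j e, 0 ≤ L j e)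
    (hint : ∀ j, Integrable (fun e => L j e ^ 2) π)
    (hint' : ∀ j, Integrable (fun e => L j e ^ 2) π')
    (hM : ∀ j, ∫ e, L j e ^ 2 ∂π ≤ M) (hM' : ∀ j, ∫ e, L j e ^ 2 ∂π' ≤ M)
    (hδ : ∀ q ∈ stdSimplex ℝ J, |∫ e, softMin β q (fun j => L j e) ∂π -
      ∫ e, softMin β q (fun j => L j e) ∂π'| ≤ δ) (hs : 0 ≤ s) (m : ℕ) :
    ∀ {w : J → ℝ}, (∀ j, 0 < w j) →
    |∫ e, ψ (s * softMin β w fun j => ∑ i : Fin m, L j (e i)) ∂(Measure.pi fun _ => π) -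
      ∫ e, ψ (s * softMin β w fun j => ∑ i : Fin m, L j (e i)) ∂(Measure.pi fun _ => π')| ≤
      m * (D * (s * δ) + 2 * (B * (s ^ 2 * M))) := by
  set Δ := D * (s * δ) + 2 * (B * (s ^ 2 * M)) with hΔ
  -- The weights stay quantified in the induction: freezing a sample replaces `w` by other positive
  -- weights.
  induction m with
  | zero =>
    intro w hw
    simp
  | succ m ih =>
    intro w hw
    set f : E → (Fin m → E) → ℝ := fun e₀ e =>
      ψ (s * softMin β w fun j => L j e₀ + ∑ i : Fin m, L j (e i)) with hf
    have hfm : Measurable (Function.uncurry f) := by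
      have : Measurable fun z : E × (Fin m → E) =>
          softMin β w fun j => L j z.1 + ∑ i : Fin m, L j (z.2 i) :=
        measurable_softMin (L := fun j (z : E × (Fin m → E)) => L j z.1 + ∑ i : Fin m, L j (z.2 i))
          fun j => by fun_prop
      exact hψc.measurable.comp (this.const_mul s)
    have hfA : ∀ e₀ e, |f e₀ e| ≤ A := fun e₀ e => hψA _
    have hsplit : ∀ (ρ : Measure E) [IsProbabilityMeasure ρ],
        ∫ e, ψ (s * softMin β w fun j => ∑ i : Fin (m + 1), L j (e i)) ∂(Measure.pi fun _ => ρ) =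
        ∫ z, Function.uncurry f z ∂(ρ.prod (Measure.pi fun _ : Fin m => ρ)) := by
      intro ρ _
      rw [← (measurePreserving_piFinSuccAbove (fun _ : Fin (m + 1) => ρ) 0).integral_comp'
        (Function.uncurry f)]
      congr with e
      simp [hf, Fin.sum_univ_succ, MeasurableEquiv.piFinSuccAbove, Fin.insertNthEquiv, Fin.tail]
    have hfi : ∀ (ρ ρ' : Measure E) [IsProbabilityMeasure ρ] [IsProbabilityMeasure ρ'],
        Integrable (Function.uncurry f) (ρ.prod (Measure.pi fun _ : Fin m => ρ')) :=
      fun ρ ρ' _ _ => integrable_of_abs_le hfm fun z => hfA _ _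
    rw [hsplit π, hsplit π']
    -- Passage through the hybrid law `π ⊗ π'^m`: here the last `m` samples are exchanged with the
    -- first one fixed, next the first one with the others fixed.
    have h1 : |∫ z, Function.uncurry f z ∂(π.prod (Measure.pi fun _ : Fin m => π)) -
        ∫ z, Function.uncurry f z ∂(π.prod (Measure.pi fun _ : Fin m => π'))| ≤ m * Δ := by
      rw [integral_prod _ (hfi π π), integral_prod _ (hfi π π')]
      refine abs_integral_sub_integral_le (hfi π π).integral_prod_left
        (hfi π π').integral_prod_left fun e₀ => ?_
      simp only [Function.uncurry, hf, softMin_add]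
      exact ih fun j => mul_pos (hw j) (Real.exp_pos _)
    have h2 : |∫ z, Function.uncurry f z ∂(π.prod (Measure.pi fun _ : Fin m => π')) -
        ∫ z, Function.uncurry f z ∂(π'.prod (Measure.pi fun _ : Fin m => π'))| ≤ Δ := by
      rw [integral_prod_symm _ (hfi π π'), integral_prod_symm _ (hfi π' π')]
      refine abs_integral_sub_integral_le (hfi π π').integral_prod_right
        (hfi π' π').integral_prod_right fun e => ?_
      simp only [Function.uncurry, hf, add_comm (L _ _), softMin_add]
      exact abs_integral_swap_one_le hψc hψA hd hB htaylor hβ hL hL0 hint hint' hM hM' hδ hs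
        fun j => mul_pos (hw j) (Real.exp_pos _)
    calc _ ≤ m * Δ + Δ := (abs_sub_le _ _ _).trans (add_le_add h1 h2)
      _ = ((m + 1 : ℕ) : ℝ) * Δ := by push_cast; ring

end Lindeberg

/-! ### Replicas and polynomial approximation of the logarithm -/

/-- The `m`-th power expands over `m`-tuples of indices (replicas). The weights `∏ i, q (a i)` sum
to one, so the error `δ` is averaged and does not accumulate over the tuples. -/
lemma abs_integral_pow_sub_le {J E : Type*} [Fintype J] [MeasurableSpace E] {β : ℝ} (hβ : 0 < β)
    {q : J → ℝ} (hq : q ∈ stdSimplex ℝ J) {L : J → E → ℝ} (hL : ∀ j, Measurable (L j))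
    (hL0 : ∀ j e, 0 ≤ L j e) {π π' : Measure E} [IsProbabilityMeasure π] [IsProbabilityMeasure π']
    {m : ℕ} {δ : ℝ}
    (h : ∀ a : Fin m → J, |∫ e, Real.exp (-β * ∑ i, L (a i) e) ∂π -
      ∫ e, Real.exp (-β * ∑ i, L (a i) e) ∂π'| ≤ δ) :
    |∫ e, (∑ j, q j * Real.exp (-β * L j e)) ^ m ∂π -
      ∫ e, (∑ j, q j * Real.exp (-β * L j e)) ^ m ∂π'| ≤ δ := by
  have hexp : ∀ e, (∑ j, q j * Real.exp (-β * L j e)) ^ m =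
      ∑ a : Fin m → J, (∏ i, q (a i)) * Real.exp (-β * ∑ i, L (a i) e) := fun e => by
    rw [Fintype.sum_pow]
    refine Finset.sum_congr rfl fun a _ => ?_
    rw [Finset.prod_mul_distrib, ← Real.exp_sum, Finset.mul_sum]
  have hint : ∀ (ρ : Measure E) [IsProbabilityMeasure ρ] (a : Fin m → J),
      Integrable (fun e => Real.exp (-β * ∑ i, L (a i) e)) ρ := fun ρ _ a => by
    refine integrable_of_abs_le (C := 1) (by fun_prop) fun e => ?_
    rw [abs_of_pos (Real.exp_pos _), Real.exp_le_one_iff]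
    have := Finset.sum_nonneg fun i (_ : i ∈ Finset.univ) => hL0 (a i) e
    nlinarith
  have hI : ∀ (ρ : Measure E) [IsProbabilityMeasure ρ],
      ∫ e, (∑ j, q j * Real.exp (-β * L j e)) ^ m ∂ρ =
        ∑ a : Fin m → J, (∏ i, q (a i)) * ∫ e, Real.exp (-β * ∑ i, L (a i) e) ∂ρ := fun ρ _ => by
    simp_rw [hexp]
    rw [integral_finsetSum _ fun a _ => (hint ρ a).const_mul _]
    simp_rw [integral_const_mul]
  rw [hI π, hI π', ← Finset.sum_sub_distrib]
  have hq1 : ∑ a : Fin m → J, ∏ i, q (a i) = 1 := by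
    rw [← Fintype.sum_pow, hq.2, one_pow]
  calc |∑ a : Fin m → J, ((∏ i, q (a i)) * ∫ e, Real.exp (-β * ∑ i, L (a i) e) ∂π -
        (∏ i, q (a i)) * ∫ e, Real.exp (-β * ∑ i, L (a i) e) ∂π')|
      ≤ ∑ a : Fin m → J, (∏ i, q (a i)) * δ := by
        refine (Finset.abs_sum_le_sum_abs _ _).trans (Finset.sum_le_sum fun a _ => ?_)
        have hp : 0 ≤ ∏ i, q (a i) := Finset.prod_nonneg fun i _ => hq.1 _
        rw [← mul_sub, abs_mul, abs_of_nonneg hp]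
        exact mul_le_mul_of_nonneg_left (h a) hp
    _ = δ := by rw [← Finset.sum_mul, hq1, one_mul]

/-- The expectation of a soft minimum is determined, up to a small error, by finitely many
replicated exponential moments. -/
theorem exists_abs_integral_softMin_sub_le {β : ℝ} (hβ : 0 < β) {M ε : ℝ} (hM0 : 0 ≤ M)
    (hε : 0 < ε) : ∃ δ > 0, ∃ N : ℕ, ∀ {J E : Type} [Fintype J] [MeasurableSpace E] {L : J → E → ℝ}
      {π π' : Measure E} [IsProbabilityMeasure π] [IsProbabilityMeasure π'],
      (∀ j, Measurable (L j)) → (∀ j e, 0 ≤ L j e) →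
      (∀ j, Integrable (fun e => L j e ^ 2) π) → (∀ j, Integrable (fun e => L j e ^ 2) π') →
      (∀ j, ∫ e, L j e ^ 2 ∂π ≤ M) → (∀ j, ∫ e, L j e ^ 2 ∂π' ≤ M) →
      (∀ m ≤ N, ∀ a : Fin m → J, |∫ e, Real.exp (-β * ∑ i, L (a i) e) ∂π -
        ∫ e, Real.exp (-β * ∑ i, L (a i) e) ∂π'| ≤ δ) →
      ∀ q ∈ stdSimplex ℝ J, |∫ e, softMin β q (fun j => L j e) ∂π -
        ∫ e, softMin β q (fun j => L j e) ∂π'| ≤ ε := by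
  -- The final budget is `2ε₁` for each of the two laws plus `ε₁` for the polynomial, which is below
  -- `8ε₁ = βε`.
  set ε₁ : ℝ := β * ε / 8 with hε₁
  have hε₁0 : 0 < ε₁ := by positivity
  -- The level at which `-log Z` is truncated; the excess over `A` is at most `(log Z)² / A`, whose
  -- mean is at most `β² M / A ≤ ε₁`.
  set A : ℝ := (β ^ 2 * M + 1) / ε₁ with hA
  have hA0 : 0 < A := by positivity
  have hβM : β ^ 2 * M / A ≤ ε₁ := by
    rw [div_le_iff₀ hA0, hA, mul_div_cancel₀ _ hε₁0.ne']
    linarith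
  have hcont : ContinuousOn (fun z : ℝ => -Real.log (max z (Real.exp (-A)))) (Set.Icc 0 1) := by
    refine (ContinuousOn.log (by fun_prop) fun z _ => ?_).neg
    exact (lt_max_of_lt_right (Real.exp_pos _)).ne'
  obtain ⟨Q, hQ⟩ := exists_polynomial_near_of_continuousOn 0 1 _ hcont ε₁ hε₁0
  set c : ℝ := ∑ i ∈ Finset.range (Q.natDegree + 1), |Q.coeff i| + 1 with hc
  have hc0 : 0 < c := by positivity
  -- `δ` and `N` come from the Weierstrass polynomial alone, hence depend only on `β`, `M`, `ε` and
  -- not on the index set or the laws.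
  refine ⟨ε₁ / c, by positivity, Q.natDegree, ?_⟩
  intro J E _ _ L π π' _ _ hL hL0 hint hint' hM hM' hδ q hq
  set Z : E → ℝ := fun e => ∑ j, q j * Real.exp (-β * L j e) with hZ
  have hZ0 : ∀ e, 0 < Z e := fun e => sum_mul_exp_pos_of_mem_stdSimplex hq
  have hZ1 : ∀ e, Z e ≤ 1 := fun e => sum_mul_exp_le_one hβ hq fun j => hL0 j e
  have hZm : Measurable Z := by fun_prop
  have hsoft : ∀ e, softMin β q (fun j => L j e) = 1 / β * -Real.log (Z e) := fun e => by
    rw [softMin]; ring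
  have hpt : ∀ e, |-Real.log (Z e) - Q.eval (Z e)| ≤
      (β ^ 2 * softMin β q (fun j => L j e) ^ 2) / A + ε₁ := fun e => by
    have h1 := hQ (Z e) ⟨(hZ0 e).le, hZ1 e⟩
    have h2 : |-Real.log (Z e) - -Real.log (max (Z e) (Real.exp (-A)))| ≤
        (β ^ 2 * softMin β q (fun j => L j e) ^ 2) / A := by
      rw [hsoft, ← mul_pow, ← mul_assoc, mul_one_div_cancel hβ.ne', one_mul]
      rcases le_total (Real.exp (-A)) (Z e) with h | h
      · rw [max_eq_left h, sub_self, abs_zero]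
        positivity
      · have hlog : A ≤ -Real.log (Z e) := by
          have := Real.log_le_log (hZ0 e) h
          rw [Real.log_exp] at this
          linarith
        rw [max_eq_right h, Real.log_exp, neg_neg, abs_of_nonneg (by linarith),
          le_div_iff₀ hA0]
        nlinarith
    rw [abs_sub_comm] at h1
    calc _ ≤ _ := abs_sub_le _ (-Real.log (max (Z e) (Real.exp (-A)))) _
      _ ≤ _ := add_le_add h2 h1.le
  have happrox : ∀ (ρ : Measure E) [IsProbabilityMeasure ρ],
      (∀ j, Integrable (fun e => L j e ^ 2) ρ) → (∀ j, ∫ e, L j e ^ 2 ∂ρ ≤ M) →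
      |β * ∫ e, softMin β q (fun j => L j e) ∂ρ - ∫ e, Q.eval (Z e) ∂ρ| ≤ 2 * ε₁ := by
    intro ρ _ hi hMρ
    obtain ⟨i1, i2, i3⟩ := integrable_softMin hβ hq hL hL0 hi hMρ
    have hb : Integrable (fun e => (β ^ 2 * softMin β q (fun j => L j e) ^ 2) / A + ε₁) ρ :=
      ((i2.const_mul _).div_const _).add (integrable_const _)
    have hlogi : Integrable (fun e => -Real.log (Z e)) ρ := by
      refine (i1.const_mul β).congr (ae_of_all _ fun e => ?_)
      simp only [hsoft]
      field_simp
    have hQm : Measurable fun e => Q.eval (Z e) := Q.continuous.measurable.comp hZm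
    have hQi : Integrable (fun e => Q.eval (Z e)) ρ := by
      have : Integrable (fun e => -Real.log (Z e) - Q.eval (Z e)) ρ :=
        hb.mono' (by fun_prop) (ae_of_all _ hpt)
      refine (hlogi.sub this).congr (ae_of_all _ fun e => ?_)
      simp
    have h1 : β * ∫ e, softMin β q (fun j => L j e) ∂ρ = ∫ e, -Real.log (Z e) ∂ρ := by
      rw [← integral_const_mul]
      congr with e
      rw [hsoft]
      field_simp
    rw [h1, ← integral_sub hlogi hQi]
    calc |∫ e, (-Real.log (Z e) - Q.eval (Z e)) ∂ρ|
        ≤ ∫ e, |-Real.log (Z e) - Q.eval (Z e)| ∂ρ := abs_integral_le_integral_abs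
      _ ≤ ∫ e, ((β ^ 2 * softMin β q (fun j => L j e) ^ 2) / A + ε₁) ∂ρ :=
          integral_mono_of_nonneg (ae_of_all _ fun e => abs_nonneg _) hb (ae_of_all _ hpt)
      _ = (β ^ 2 * ∫ e, softMin β q (fun j => L j e) ^ 2 ∂ρ) / A + ε₁ := by
          rw [integral_add ((i2.const_mul _).div_const _) (integrable_const _),
            integral_div, integral_const_mul]
          simp
      _ ≤ β ^ 2 * M / A + ε₁ := by gcongr
      _ ≤ 2 * ε₁ := by linarith
  have hpoly : |∫ e, Q.eval (Z e) ∂π - ∫ e, Q.eval (Z e) ∂π'| ≤ ε₁ := by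
    have hZi : ∀ (ρ : Measure E) [IsProbabilityMeasure ρ] (m : ℕ),
        Integrable (fun e => Z e ^ m) ρ := fun ρ _ m => by
      refine integrable_of_abs_le (C := 1) (by fun_prop) fun e => ?_
      rw [abs_of_nonneg (pow_nonneg (hZ0 e).le _)]
      exact pow_le_one₀ (hZ0 e).le (hZ1 e)
    simp_rw [Polynomial.eval_eq_sum_range]
    rw [integral_finsetSum _ fun i _ => (hZi π i).const_mul _,
      integral_finsetSum _ fun i _ => (hZi π' i).const_mul _, ← Finset.sum_sub_distrib]
    simp_rw [integral_const_mul, ← mul_sub]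
    calc _ ≤ ∑ i ∈ Finset.range (Q.natDegree + 1), |Q.coeff i| * (ε₁ / c) := by
          refine (Finset.abs_sum_le_sum_abs _ _).trans (Finset.sum_le_sum fun i hi => ?_)
          rw [abs_mul]
          refine mul_le_mul_of_nonneg_left ?_ (abs_nonneg _)
          exact abs_integral_pow_sub_le hβ hq hL hL0
            (hδ i (Nat.lt_succ_iff.1 (Finset.mem_range.1 hi)))
      _ = (c - 1) * (ε₁ / c) := by rw [← Finset.sum_mul, hc]; ring
      _ ≤ c * (ε₁ / c) := by gcongr; linarith
      _ = ε₁ := mul_div_cancel₀ _ hc0.ne'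
  have a1 := happrox π hint hM
  have a2 := happrox π' hint' hM'
  have hfin : β * |∫ e, softMin β q (fun j => L j e) ∂π -
      ∫ e, softMin β q (fun j => L j e) ∂π'| ≤ β * ε := by
    rw [← abs_of_pos hβ, ← abs_mul, abs_of_pos hβ, mul_sub]
    rw [abs_le] at *
    constructor <;> linarith
  exact le_of_mul_le_mul_left hfin hβ

/-! ### Nets in the gauge of a symmetric convex set -/

section Nets

open scoped Pointwise Function

variable {E : Type*} [NormedAddCommGroup E] [NormedSpace ℝ E] [FiniteDimensional ℝ E]

/-- Volumetric bound for the cardinality of a family of points of a symmetric convex set that is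
separated in the gauge of this set. -/
lemma card_le_of_gauge_separated_of_interior_nonempty {S : Set E} (hconv : Convex ℝ S)
    (hsymm : ∀ θ ∈ S, -θ ∈ S) (hbdd : Bornology.IsBounded S) (hint : (interior S).Nonempty)
    {α : ℝ} (hα : 0 < α) {F : Finset E} (hF : ↑F ⊆ S)
    (hsep : ∀ θ ∈ F, ∀ θ' ∈ F, θ ≠ θ' → θ - θ' ∉ α • S) :
    (F.card : ℝ) ≤ (1 + 2 / α) ^ Module.finrank ℝ E := by
  borelize E
  set μ : Measure E := Measure.addHaar
  have hμ0 : μ S ≠ 0 := (Measure.measure_pos_of_nonempty_interior μ hint).ne'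
  have hμt : μ S ≠ ∞ := hbdd.measure_lt_top.ne
  set d := Module.finrank ℝ E
  have hvol : ∀ r : ℝ, 0 < r → μ (r • S) = ENNReal.ofReal (r ^ d) * μ S := fun r hr => by
    rw [Measure.addHaar_smul, abs_of_pos (pow_pos hr _)]
  -- The translates of `(α/2) S` by the points of `F` are disjoint and lie in `(1 + α/2) S`. A
  -- common point would write `θ - θ'` as `α` times the midpoint of `s'` and `-s`, which is in `S`.
  have hdisj : Set.Pairwise (F : Set E) (AEDisjoint μ on fun θ => θ +ᵥ ((α / 2) • S)) := by
    intro θ hθ θ' hθ' hne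
    refine Disjoint.aedisjoint (Set.disjoint_left.2 ?_)
    rintro x ⟨_, ⟨s, hs, rfl⟩, rfl⟩ ⟨_, ⟨s', hs', rfl⟩, h⟩
    refine hsep θ hθ θ' hθ' hne ⟨(1 / 2 : ℝ) • s' + (1 / 2 : ℝ) • (-s),
      hconv hs' (hsymm _ hs) (by norm_num) (by norm_num) (by norm_num), ?_⟩
    simp only [vadd_eq_add] at h
    have : θ - θ' = (α / 2) • s' - (α / 2) • s := by
      rw [sub_eq_sub_iff_add_eq_add, add_comm _ θ', h]
    simp only [this]
    module
  have hmeas : ∀ θ ∈ F, NullMeasurableSet (θ +ᵥ ((α / 2) • S)) μ := fun θ _ =>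
    ((hconv.smul _).vadd _).nullMeasurableSet μ
  have hsub : ⋃ θ ∈ F, (θ +ᵥ ((α / 2) • S)) ⊆ (1 + α / 2) • S := by
    refine Set.iUnion₂_subset fun θ hθ => ?_
    rintro _ ⟨_, ⟨s, hs, rfl⟩, rfl⟩
    rw [hconv.add_smul zero_le_one (by positivity)]
    exact ⟨θ, by simpa using hF hθ, _, ⟨s, hs, rfl⟩, rfl⟩
  have h1 : (F.card : ℝ≥0∞) * (ENNReal.ofReal ((α / 2) ^ d) * μ S) ≤
      ENNReal.ofReal ((1 + α / 2) ^ d) * μ S := by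
    have := (measure_biUnion_finset₀ hdisj hmeas).symm.trans_le (measure_mono hsub)
    simp only [measure_vadd, hvol _ (half_pos hα), hvol (1 + α / 2) (by positivity),
      Finset.sum_const, nsmul_eq_mul] at this
    exact this
  rw [← mul_assoc, ENNReal.mul_le_mul_iff_left hμ0 hμt, ← ENNReal.ofReal_natCast,
    ← ENNReal.ofReal_mul (by positivity), ENNReal.ofReal_le_ofReal_iff (by positivity)] at h1
  calc (F.card : ℝ) ≤ (1 + α / 2) ^ d / (α / 2) ^ d := by
        rwa [le_div_iff₀ (by positivity)]
    _ = (1 + 2 / α) ^ d := by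
        rw [← div_pow]
        congr 1
        field_simp
        ring

/-- `S` may have empty interior. Inside its linear span it has interior points, since `0 ∈ S` makes
the affine span everything, and the dimension only drops. -/
lemma card_le_of_gauge_separated {S : Set E} (hconv : Convex ℝ S)
    (hsymm : ∀ θ ∈ S, -θ ∈ S) (h0 : 0 ∈ S) (hbdd : Bornology.IsBounded S)
    {α : ℝ} (hα : 0 < α) {F : Finset E} (hF : ↑F ⊆ S)
    (hsep : ∀ θ ∈ F, ∀ θ' ∈ F, θ ≠ θ' → θ - θ' ∉ α • S) :
    (F.card : ℝ) ≤ (1 + 2 / α) ^ Module.finrank ℝ E := by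
  classical
  set W := Submodule.span ℝ S
  set S' : Set W := (↑) ⁻¹' S with hS'
  have hS'span : affineSpan ℝ S' = ⊤ := by
    rw [AffineSubspace.affineSpan_eq_top_iff_vectorSpan_eq_top_of_nonempty ℝ W W ⟨0, h0⟩,
      vectorSpan_eq_span_vsub_set_right ℝ (show (0 : W) ∈ S' from h0)]
    have h := Submodule.span_span_coe_preimage (R := ℝ) (s := S)
    simp only [vsub_eq_sub, sub_zero, Set.image_id']
    exact h
  have hconv' : Convex ℝ S' := hconv.linear_preimage W.subtype
  have hbdd' : Bornology.IsBounded S' := by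
    obtain ⟨r, hr⟩ := hbdd.subset_closedBall 0
    refine Metric.isBounded_closedBall.subset (s := S') (t := Metric.closedBall (0 : W) r) ?_
    intro w hw
    simpa using hr hw
  set F' : Finset W := F.subtype (· ∈ W) with hF'
  have hcard : F'.card = F.card := by
    rw [hF', Finset.card_subtype, Finset.filter_true_of_mem]
    exact fun θ hθ => Submodule.subset_span (hF hθ)
  have key := card_le_of_gauge_separated_of_interior_nonempty hconv'
    (fun θ hθ => by simpa [hS'] using hsymm _ hθ) hbdd'
    (hconv'.interior_nonempty_iff_affineSpan_eq_top.2 hS'span) hα (F := F')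
    (fun θ hθ => hF (by simpa [hF'] using hθ)) ?_
  · rw [hcard] at key
    refine key.trans (pow_le_pow_right₀ ?_ (Submodule.finrank_le W))
    have : 0 < 2 / α := by positivity
    linarith
  · rintro θ hθ θ' hθ' hne ⟨s, hs, h⟩
    exact hsep θ (by simpa [hF'] using hθ) θ' (by simpa [hF'] using hθ')
      (fun h => hne (Subtype.ext h)) ⟨s, hs, by simpa using congrArg Subtype.val h⟩

/-- A subset of a bounded symmetric convex set `S` in dimension `d` has a net of cardinality at most
`(1 + 2 / α) ^ d` at scale `α`, measured in the gauge of `S`. -/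
theorem exists_gauge_net {S : Set E} (hconv : Convex ℝ S)
    (hsymm : ∀ θ ∈ S, -θ ∈ S) (h0 : 0 ∈ S) (hbdd : Bornology.IsBounded S)
    {α : ℝ} (hα : 0 < α) {C : Set E} (hC : C ⊆ S) :
    ∃ N : Finset E, ↑N ⊆ C ∧ (∀ θ ∈ C, ∃ θ₀ ∈ N, θ - θ₀ ∈ α • S) ∧
      (N.card : ℝ) ≤ (1 + 2 / α) ^ Module.finrank ℝ E := by
  classical
  set P : Finset E → Prop := fun F => ↑F ⊆ C ∧ ∀ θ ∈ F, ∀ θ' ∈ F, θ ≠ θ' → θ - θ' ∉ α • S with hP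
  have hcard : ∀ F, P F → (F.card : ℝ) ≤ (1 + 2 / α) ^ Module.finrank ℝ E := fun F hF =>
    card_le_of_gauge_separated hconv hsymm h0 hbdd hα (hF.1.trans hC) hF.2
  have hfin : {k | ∃ F, P F ∧ F.card = k}.Finite := by
    refine (Set.finite_Iic ⌊(1 + 2 / α) ^ Module.finrank ℝ E⌋₊).subset ?_
    rintro _ ⟨F, hF, rfl⟩
    exact Nat.le_floor (hcard F hF)
  -- Separated families have bounded cardinality, so a largest one exists; an uncovered point could
  -- be added to it.
  obtain ⟨_, ⟨N, hN, rfl⟩, hmax⟩ := hfin.exists_maximal ⟨0, ∅, by simp [hP], rfl⟩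
  refine ⟨N, hN.1, fun θ hθ => ?_, hcard N hN⟩
  by_contra! hcon
  have h0' : (0 : E) ∈ α • S := ⟨0, h0, smul_zero _⟩
  have hθN : θ ∉ N := fun h => hcon θ h (by simpa using h0')
  have hneg : ∀ x : E, x ∈ α • S → -x ∈ α • S := by
    rintro _ ⟨s, hs, rfl⟩
    exact ⟨-s, hsymm s hs, smul_neg _ _⟩
  have hins : P (insert θ N) := by
    refine ⟨by simpa [Set.insert_subset_iff] using ⟨hθ, hN.1⟩, ?_⟩
    intro a ha b hb hab
    rcases Finset.mem_insert.1 ha with rfl | ha' <;>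
      rcases Finset.mem_insert.1 hb with rfl | hb'
    · exact absurd rfl hab
    · exact hcon b hb'
    · exact fun h => hcon a ha' (by simpa using hneg _ h)
    · exact hN.2 a ha' b hb' hab
  have := hmax ⟨_, hins, rfl⟩ (Finset.card_le_card (Finset.subset_insert _ _))
  rw [Finset.card_insert_of_notMem hθN] at this
  omega

omit [FiniteDimensional ℝ E] in
-- The usual half-net argument with `S` in place of the unit ball: writing `θ = θ₀ + s/2` gives `b ≤
-- a + b/2` for the supremum `b` over `S`, which boundedness makes finite.
lemma norm_apply_le_of_net {F : Type*} [NormedAddCommGroup F] [NormedSpace ℝ F] {S : Set E}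
    (hbdd : Bornology.IsBounded S) {N : Finset E}
    (hcover : ∀ θ ∈ S, ∃ θ₀ ∈ N, θ - θ₀ ∈ (1 / 2 : ℝ) • S) (A : E →L[ℝ] F) {a : ℝ}
    (hA : ∀ θ ∈ N, ‖A θ‖ ≤ a) {θ : E} (hθ : θ ∈ S) : ‖A θ‖ ≤ 2 * a := by
  obtain ⟨r, hr⟩ := hbdd.exists_norm_le
  have hB : BddAbove ((fun θ => ‖A θ‖) '' S) := by
    refine ⟨‖A‖ * r, ?_⟩
    rintro _ ⟨θ, hθ, rfl⟩
    exact (A.le_opNorm θ).trans (by gcongr; exact hr θ hθ)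
  set b := sSup ((fun θ => ‖A θ‖) '' S) with hb
  have hle : ∀ θ ∈ S, ‖A θ‖ ≤ b := fun θ hθ => le_csSup hB ⟨θ, hθ, rfl⟩
  have : b ≤ a + b / 2 := by
    refine csSup_le ⟨_, θ, hθ, rfl⟩ ?_
    rintro _ ⟨θ, hθ, rfl⟩
    obtain ⟨θ₀, hθ₀, s, hs, h⟩ := hcover θ hθ
    have e : θ = θ₀ + (1 / 2 : ℝ) • s := by
      have h' : (1 / 2 : ℝ) • s = θ - θ₀ := h
      rw [h']; abel
    calc ‖A θ‖ = ‖A θ₀ + (1 / 2 : ℝ) • A s‖ := by rw [e, map_add, map_smul]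
      _ ≤ ‖A θ₀‖ + 1 / 2 * ‖A s‖ := by
          refine (norm_add_le _ _).trans ?_
          rw [norm_smul]; norm_num
      _ ≤ a + b / 2 := by linarith [hA θ₀ hθ₀, hle s hs]
  linarith [hle θ hθ]

end Nets

/-! ### Empirical second moments -/

/-- Chernoff's bound: by independence the exponential of the sum has mean at most `2 ^ n`. -/
lemma measureReal_pi_sum_sq_ge_le {α : Type*} [MeasurableSpace α] {π : Measure α}
    [IsProbabilityMeasure π] {X : α → ℝ} (hX : Measurable X) {T : ℝ} (hT : 0 < T)
    (h : ExpSqLe T X π) (n : ℕ) (a : ℝ) :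
    (Measure.pi fun _ : Fin n => π).real {z | a * T ^ 2 ≤ ∑ i, X (z i) ^ 2} ≤
      2 ^ n * Real.exp (-a) := by
  have hint := Integrable.fintype_prod (μ := fun _ : Fin n => π)
    (f := fun _ x => Real.exp (X x ^ 2 / T ^ 2)) fun _ => h.integrable_exp hX.aemeasurable
  have hmarkov := mul_meas_ge_le_integral_of_nonneg
    (ae_of_all _ fun z => Finset.prod_nonneg fun i _ => (Real.exp_pos _).le) hint (Real.exp a)
  rw [integral_fintype_prod_eq_prod (𝕜 := ℝ) (μ := fun _ : Fin n => π)
    (fun _ x => Real.exp (X x ^ 2 / T ^ 2)), Finset.prod_const, Finset.card_univ,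
    Fintype.card_fin] at hmarkov
  have h2 := pow_le_pow_left₀ (integral_nonneg fun x => (Real.exp_pos _).le)
    (h.integral_exp_le hX.aemeasurable) n
  have hset : {z : Fin n → α | a * T ^ 2 ≤ ∑ i, X (z i) ^ 2} =
      {z | Real.exp a ≤ ∏ i, Real.exp (X (z i) ^ 2 / T ^ 2)} := by
    ext z
    simp only [Set.mem_ofPred_eq]
    rw [← Real.exp_sum, Real.exp_le_exp, ← Finset.sum_div, le_div_iff₀ (by positivity)]
  rw [hset, Real.exp_neg, ← div_eq_mul_inv, le_div_iff₀ (Real.exp_pos _), mul_comm]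
  exact hmarkov.trans h2

/-- Uniform control of the empirical second moments along `S`. -/
theorem measureReal_pi_exists_sum_sq_gt_le {p : ℕ} {S : Set (EuclideanSpace ℝ (Fin p))}
    (hconv : Convex ℝ S) (hsymm : ∀ θ ∈ S, -θ ∈ S) (h0 : 0 ∈ S) (hbdd : Bornology.IsBounded S)
    {α : Type*} [MeasurableSpace α] {π : Measure α} [IsProbabilityMeasure π]
    {ξ : α → EuclideanSpace ℝ (Fin p)} (hξ : Measurable ξ) {T : ℝ} (hT : 0 < T)
    (h : ∀ θ ∈ S, ExpSqLe T (fun x => inner ℝ θ (ξ x)) π) (n : ℕ) {a : ℝ} (ha : 0 ≤ a) :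
    (Measure.pi fun _ : Fin n => π).real
      {z | ∃ θ ∈ S, 4 * a * T ^ 2 < ∑ i, (inner ℝ θ (ξ (z i))) ^ 2} ≤
      5 ^ p * (2 ^ n * Real.exp (-a)) := by
  -- Scale `1/2` gives at most `5 ^ p` points and loses a factor `2` on norms, hence the `4` on
  -- squares.
  obtain ⟨N, hNS, hcover, hcard⟩ := exists_gauge_net hconv hsymm h0 hbdd (α := 1 / 2)
    (by norm_num) subset_rfl
  rw [finrank_euclideanSpace, Fintype.card_fin, show (1 + 2 / (1 / 2) : ℝ) = 5 by norm_num]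
    at hcard
  have hsub : {z : Fin n → α |
      ∃ θ ∈ S, 4 * a * T ^ 2 < ∑ i, (inner ℝ θ (ξ (z i))) ^ 2} ⊆
      ⋃ θ ∈ N, {z | a * T ^ 2 ≤ ∑ i, (inner ℝ θ (ξ (z i))) ^ 2} := by
    rintro z ⟨θ, hθ, hlt⟩
    by_contra hcon
    simp only [Set.mem_iUnion, Set.mem_ofPred_eq, not_exists, not_le] at hcon
    set A : EuclideanSpace ℝ (Fin p) →L[ℝ] EuclideanSpace ℝ (Fin n) :=
      LinearMap.toContinuousLinearMap
        { toFun := fun θ => WithLp.toLp 2 fun i => inner ℝ θ (ξ (z i))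
          map_add' := fun x y => by ext i; simp [inner_add_left]
          map_smul' := fun c x => by ext i; simp [real_inner_smul_left] } with hA
    have hAn : ∀ θ, ‖A θ‖ = √(∑ i, (inner ℝ θ (ξ (z i))) ^ 2) := fun θ => by
      rw [EuclideanSpace.norm_eq]
      simp [hA]
    have hle := norm_apply_le_of_net hbdd hcover A (a := √(a * T ^ 2)) (fun θ hθ => by
      rw [hAn]
      exact Real.sqrt_le_sqrt (hcon θ hθ).le) hθ
    rw [hAn, Real.sqrt_le_left (by positivity), mul_pow, Real.sq_sqrt (by positivity)] at hle
    linarith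
  refine (measureReal_mono hsub (measure_ne_top _ _)).trans ((measureReal_biUnion_finset_le _ _).trans ?_)
  calc _ ≤ ∑ _θ ∈ N, 2 ^ n * Real.exp (-a) := Finset.sum_le_sum fun θ hθ =>
        measureReal_pi_sum_sq_ge_le (by fun_prop) hT (h θ (hNS hθ)) n a
    _ = N.card * (2 ^ n * Real.exp (-a)) := by rw [Finset.sum_const, nsmul_eq_mul]
    _ ≤ _ := by gcongr

/-! ### Growth and moments of the loss -/

/-- Continuous functions with a Lipschitz constant of at most linear growth. -/
structure QuadLipschitz {V : Type*} [NormedAddCommGroup V] (c : ℝ) (f : V → ℝ) : Prop where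
  continuous : Continuous f
  lipschitz : ∀ w w', |f w - f w'| ≤ c * (1 + ‖w‖ + ‖w'‖) * ‖w - w'‖
  growth : ∀ w, |f w| ≤ c * (1 + ‖w‖ ^ 2)

section Growth

variable {V : Type*} [NormedAddCommGroup V]

/-- Comparison with the value at `0` yields quadratic growth. All larger constants are allowed so
that `ℓ` and `η` can share one. -/
lemma exists_quadLipschitz_of_lipschitz_bound {f : V → ℝ} {c : ℝ} (hc : 0 ≤ c)
    (hcont : Continuous f) (h : ∀ w w', |f w - f w'| ≤ c * (1 + ‖w‖ + ‖w'‖) * ‖w - w'‖) :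
    ∃ c₀, ∀ c' ≥ c₀, QuadLipschitz c' f := by
  refine ⟨2 * c + |f 0|, fun c' hc' => ⟨hcont, fun w w' => (h w w').trans ?_, fun w => ?_⟩⟩
  · gcongr
    linarith [abs_nonneg (f 0)]
  · have h1 := h w 0
    simp only [norm_zero, add_zero, sub_zero] at h1
    have h2 : |f w| ≤ |f 0| + |f w - f 0| := by
      have := abs_add_le (f 0) (f w - f 0)
      simpa using this
    calc |f w| ≤ |f 0| + c * (1 + ‖w‖) * ‖w‖ := by linarith
      _ ≤ (2 * c + |f 0|) * (1 + ‖w‖ ^ 2) := by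
        nlinarith [mul_nonneg hc (sq_nonneg (‖w‖ - 1)), mul_nonneg hc (sq_nonneg ‖w‖),
          mul_nonneg (abs_nonneg (f 0)) (sq_nonneg ‖w‖)]
      _ ≤ c' * (1 + ‖w‖ ^ 2) := by gcongr

lemma exists_quadLipschitz_of_lipschitzWith {f : V → ℝ} {K : ℝ≥0} (h : LipschitzWith K f) :
    ∃ c₀, ∀ c' ≥ c₀, QuadLipschitz c' f := by
  refine exists_quadLipschitz_of_lipschitz_bound K.coe_nonneg h.continuous fun w w' => ?_
  have := h.dist_le_mul w w'
  rw [Real.dist_eq, dist_eq_norm] at this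
  refine this.trans ?_
  have h1 : (0 : ℝ) ≤ K * ‖w - w'‖ := by positivity
  nlinarith [mul_nonneg h1 (norm_nonneg w), mul_nonneg h1 (norm_nonneg w')]

/-- A Lipschitz gradient grows at most linearly, and the mean value inequality is applied on the
ball of radius `max ‖w‖ ‖w'‖`. -/
lemma exists_quadLipschitz_of_lipschitzWith_gradient {V : Type*} [NormedAddCommGroup V]
    [InnerProductSpace ℝ V] [CompleteSpace V] {f : V → ℝ} {K : ℝ≥0} (hf : Differentiable ℝ f)
    (h : LipschitzWith K (gradient f)) : ∃ c₀, ∀ c' ≥ c₀, QuadLipschitz c' f := by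
  have hgrad : ∀ w, ‖fderiv ℝ f w‖ ≤ ‖gradient f 0‖ + K * ‖w‖ := fun w => by
    have h1 : ‖gradient f w‖ = ‖fderiv ℝ f w‖ := by
      rw [gradient, LinearIsometryEquiv.norm_map]
    have h2 := h.dist_le_mul w 0
    rw [dist_eq_norm, dist_zero_right] at h2
    rw [← h1]
    linarith [norm_le_norm_add_norm_sub (gradient f 0) (gradient f w),
      norm_sub_rev (gradient f 0) (gradient f w)]
  refine exists_quadLipschitz_of_lipschitz_bound
    (c := ‖gradient f 0‖ + K) (by positivity) hf.continuous fun w w' => ?_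
  have := (convex_closedBall (0 : V) (max ‖w‖ ‖w'‖)).norm_image_sub_le_of_norm_fderiv_le
    (f := f) (𝕜 := ℝ) (C := (‖gradient f 0‖ + K) * (1 + ‖w‖ + ‖w'‖))
    (x := w') (y := w) (fun x _ => hf x) (fun x hx => (hgrad x).trans ?_) (by simp) (by simp)
  · simpa using this
  · have hx' : ‖x‖ ≤ ‖w‖ + ‖w'‖ := by
      have : ‖x‖ ≤ max ‖w‖ ‖w'‖ := by simpa using hx
      exact this.trans (max_le_add_of_nonneg (norm_nonneg _) (norm_nonneg _))
    have hK := K.coe_nonneg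
    nlinarith [norm_nonneg (gradient f 0), norm_nonneg w, norm_nonneg w',
      mul_nonneg (norm_nonneg (gradient f 0)) (add_nonneg (norm_nonneg w) (norm_nonneg w')),
      mul_le_mul_of_nonneg_left hx' hK]

end Growth

/-- What the two alternatives have in common; it suffices for the moment bounds and for the net
argument. -/
lemma exists_quadLipschitz {k kstar : ℕ} {R K : ℝ≥0} {ℓ : EuclideanSpace ℝ (Fin (k + 1)) → ℝ}
    {η : EuclideanSpace ℝ (Fin (kstar + 1)) → ℝ}
    (h : LipschitzLossLabel K ℓ η ∨ SmoothLossLabel R K ℓ η) :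
    (∀ v, 0 ≤ ℓ v) ∧ ∃ c > 0, QuadLipschitz c ℓ ∧ QuadLipschitz c η := by
  have key : ∀ {a b : ℝ}, (∀ c' ≥ a, QuadLipschitz c' ℓ) → (∀ c' ≥ b, QuadLipschitz c' η) →
      ∃ c > 0, QuadLipschitz c ℓ ∧ QuadLipschitz c η := fun {a b} ha hb =>
    ⟨max 1 (max a b), by positivity, ha _ (by simp), hb _ (by simp)⟩
  rcases h with ⟨h0, h1, h2⟩ | ⟨h0, h1, h2, h3, h4, -⟩
  · obtain ⟨a, ha⟩ := exists_quadLipschitz_of_lipschitzWith h1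
    obtain ⟨b, hb⟩ := exists_quadLipschitz_of_lipschitzWith h2
    exact ⟨h0, key ha hb⟩
  · obtain ⟨a, ha⟩ := exists_quadLipschitz_of_lipschitzWith_gradient h1 h2
    obtain ⟨b, hb⟩ := exists_quadLipschitz_of_lipschitzWith_gradient h3 h4
    exact ⟨h0, key ha hb⟩

section Append

variable {d p k : ℕ}

lemma sq_norm_append (v : EuclideanSpace ℝ (Fin d)) (t : ℝ) : ‖append v t‖ ^ 2 = ‖v‖ ^ 2 + t ^ 2 := by
  simp [EuclideanSpace.real_norm_sq_eq, append, Fin.sum_univ_castSucc]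

lemma append_sub_append (v v' : EuclideanSpace ℝ (Fin d)) (t t' : ℝ) :
    append v t - append v' t' = append (v - v') (t - t') := by
  ext i
  refine Fin.lastCases ?_ (fun i => ?_) i <;> simp [append]

lemma norm_append_le (v : EuclideanSpace ℝ (Fin d)) (t : ℝ) : ‖append v t‖ ≤ ‖v‖ + |t| := by
  refine le_of_sq_le_sq ?_ (by positivity)
  rw [sq_norm_append, ← sq_abs t]
  nlinarith [mul_nonneg (norm_nonneg v) (abs_nonneg t)]

lemma continuous_append : Continuous fun z : EuclideanSpace ℝ (Fin d) × ℝ => append z.1 z.2 := by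
  refine (PiLp.continuous_toLp 2 _).comp (continuous_pi fun i => ?_)
  refine Fin.lastCases ?_ (fun i => ?_) i
  · simpa using continuous_snd
  · simp only [Fin.snoc_castSucc]
    fun_prop

lemma sq_norm_proj (Θ : Params p k) (x : EuclideanSpace ℝ (Fin p)) :
    ‖proj Θ x‖ ^ 2 = ∑ j, (inner ℝ (Θ j) x) ^ 2 := by
  simp [EuclideanSpace.real_norm_sq_eq, proj]

lemma proj_sub (Θ Θ' : Params p k) (x : EuclideanSpace ℝ (Fin p)) :
    proj Θ x - proj Θ' x = proj (Θ - Θ') x := by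
  ext j
  simp [proj, inner_sub_left]

lemma continuous_proj :
    Continuous fun z : Params p k × EuclideanSpace ℝ (Fin p) => proj z.1 z.2 := by
  refine (PiLp.continuous_toLp 2 _).comp (continuous_pi fun j => ?_)
  exact Continuous.inner (by fun_prop) continuous_snd

end Append

section SampleLoss

variable {p k kstar : ℕ} {ℓ : EuclideanSpace ℝ (Fin (k + 1)) → ℝ}
  {η : EuclideanSpace ℝ (Fin (kstar + 1)) → ℝ} {c T : ℝ}

lemma continuous_response (hη : Continuous η) (Θstar : Params p kstar) :
    Continuous fun z : EuclideanSpace ℝ (Fin p) × ℝ => response η Θstar z.1 z.2 := by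
  have h1 : Continuous fun z : EuclideanSpace ℝ (Fin p) × ℝ => proj Θstar z.1 :=
    continuous_proj.comp (continuous_const.prodMk continuous_fst)
  exact hη.comp (continuous_append.comp (h1.prodMk continuous_snd))

/-- The loss of the parameters `Θ` at the sample point `z = (x, ε)`. -/
noncomputable def sampleLoss (ℓ : EuclideanSpace ℝ (Fin (k + 1)) → ℝ)
    (η : EuclideanSpace ℝ (Fin (kstar + 1)) → ℝ) (Θstar : Params p kstar) (Θ : Params p k)
    (z : EuclideanSpace ℝ (Fin p) × ℝ) : ℝ :=
  ℓ (append (proj Θ z.1) (response η Θstar z.1 z.2))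

lemma continuous_sampleLoss (hℓ : Continuous ℓ) (hη : Continuous η) (Θstar : Params p kstar) :
    Continuous fun q : Params p k × (EuclideanSpace ℝ (Fin p) × ℝ) =>
      sampleLoss ℓ η Θstar q.1 q.2 := by
  have h1 : Continuous fun q : Params p k × (EuclideanSpace ℝ (Fin p) × ℝ) => proj q.1 q.2.1 :=
    continuous_proj.comp (continuous_fst.prodMk (continuous_fst.comp continuous_snd))
  have h2 : Continuous fun q : Params p k × (EuclideanSpace ℝ (Fin p) × ℝ) =>
      response η Θstar q.2.1 q.2.2 := (continuous_response hη Θstar).comp continuous_snd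
  exact hℓ.comp (continuous_append.comp (h1.prodMk h2))

lemma abs_response_le (hη : QuadLipschitz c η) (Θstar : Params p kstar)
    (z : EuclideanSpace ℝ (Fin p) × ℝ) :
    |response η Θstar z.1 z.2| ≤ c * (1 + (‖proj Θstar z.1‖ ^ 2 + z.2 ^ 2)) := by
  rw [← sq_norm_append]
  exact hη.growth _

lemma pow_four_add_sum_le {d : ℕ} (t : Fin d → ℝ) (e : ℝ) :
    (∑ j, t j ^ 2 + e ^ 2) ^ 4 ≤ (d + 1) ^ 3 * (∑ j, t j ^ 8 + e ^ 8) := by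
  have h := pow_sum_div_card_le_sum_pow (s := (Finset.univ : Finset (Fin (d + 1))))
    (f := fun i => (Fin.snoc (α := fun _ => ℝ) t e i) ^ 2) (fun i _ => sq_nonneg _) 3
  simp only [Fin.sum_univ_castSucc, Fin.snoc_castSucc, Fin.snoc_last, Finset.card_univ,
    Fintype.card_fin, ← pow_mul] at h
  rw [div_le_iff₀ (by positivity)] at h
  push_cast at h
  linarith

lemma integrable_pow_four_proj {π : Measure (EuclideanSpace ℝ (Fin p) × ℝ)}
    [IsProbabilityMeasure π] (hT : 0 < T) {d : ℕ} {Θ : Params p d}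
    (hΘ : ∀ j, ExpSqLe T (fun z => inner ℝ (Θ j) z.1) π) (hnoise : ExpSqLe T (fun z => z.2) π) :
    Integrable (fun z => (‖proj Θ z.1‖ ^ 2 + z.2 ^ 2) ^ 4) π ∧
      ∫ z, (‖proj Θ z.1‖ ^ 2 + z.2 ^ 2) ^ 4 ∂π ≤ (d + 1) ^ 4 * (48 * T ^ 8) := by
  have hb : ∀ z : EuclideanSpace ℝ (Fin p) × ℝ, (‖proj Θ z.1‖ ^ 2 + z.2 ^ 2) ^ 4 ≤
      (d + 1) ^ 3 * (∑ j, (inner ℝ (Θ j) z.1) ^ 8 + z.2 ^ 8) := fun z => by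
    rw [sq_norm_proj]
    exact pow_four_add_sum_le _ _
  have hj : ∀ j, Integrable (fun z => (inner ℝ (Θ j) z.1) ^ 8) π := fun j =>
    (hΘ j).integrable_pow_eight (by fun_prop) hT
  have he : Integrable (fun z => z.2 ^ 8) π := hnoise.integrable_pow_eight (by fun_prop) hT
  have hsum : Integrable (fun z => ∑ j, (inner ℝ (Θ j) z.1) ^ 8) π :=
    integrable_finsetSum _ fun j _ => hj j
  have hbi : Integrable (fun z => ((d : ℝ) + 1) ^ 3 *
      (∑ j, (inner ℝ (Θ j) z.1) ^ 8 + z.2 ^ 8)) π := (hsum.add he).const_mul _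
  have hmeas : Continuous fun z : EuclideanSpace ℝ (Fin p) × ℝ =>
      (‖proj Θ z.1‖ ^ 2 + z.2 ^ 2) ^ 4 := by
    have : Continuous fun z : EuclideanSpace ℝ (Fin p) × ℝ => proj Θ z.1 :=
      continuous_proj.comp (continuous_const.prodMk continuous_fst)
    fun_prop
  have hint : Integrable (fun z => (‖proj Θ z.1‖ ^ 2 + z.2 ^ 2) ^ 4) π :=
    hbi.mono' hmeas.measurable.aestronglyMeasurable (ae_of_all _ fun z => by
      rw [Real.norm_of_nonneg (by positivity)]
      exact hb z)
  refine ⟨hint, (integral_mono hint hbi hb).trans ?_⟩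
  rw [integral_const_mul, integral_add hsum he, integral_finsetSum _ fun j _ => hj j]
  calc _ ≤ ((d : ℝ) + 1) ^ 3 * (∑ _j : Fin d, 48 * T ^ 8 + 48 * T ^ 8) := by
        gcongr with j
        · exact (hΘ j).integral_pow_eight_le (by fun_prop) hT
        · exact hnoise.integral_pow_eight_le (by fun_prop) hT
    _ = _ := by
        rw [Finset.sum_const, Finset.card_univ, Fintype.card_fin, nsmul_eq_mul]
        ring

lemma sq_response_le (hη : QuadLipschitz c η) (Θstar : Params p kstar)
    (z : EuclideanSpace ℝ (Fin p) × ℝ) :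
    response η Θstar z.1 z.2 ^ 2 ≤
      c ^ 2 * (3 + 2 * (‖proj Θstar z.1‖ ^ 2 + z.2 ^ 2) ^ 4) := by
  have h := pow_le_pow_left₀ (abs_nonneg _) (abs_response_le hη Θstar z) 2
  rw [sq_abs, mul_pow] at h
  set b := ‖proj Θstar z.1‖ ^ 2 + z.2 ^ 2
  refine h.trans (mul_le_mul_of_nonneg_left ?_ (sq_nonneg c))
  nlinarith [sq_nonneg (b - 1), sq_nonneg (b ^ 2 - 1), sq_nonneg (b ^ 2)]

/-- Degree count: `ℓ²` is of degree four in its arguments, and the fourth power of the response is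
of degree eight in the projections and the noise. -/
lemma sq_sampleLoss_le (hℓ : QuadLipschitz c ℓ) (hη : QuadLipschitz c η)
    (Θstar : Params p kstar) (Θ : Params p k) (z : EuclideanSpace ℝ (Fin p) × ℝ) :
    sampleLoss ℓ η Θstar Θ z ^ 2 ≤ 3 * c ^ 2 * (2 + (‖proj Θ z.1‖ ^ 2 + z.2 ^ 2) ^ 4 +
      8 * c ^ 4 * (1 + (‖proj Θstar z.1‖ ^ 2 + z.2 ^ 2) ^ 4)) := by
  have h := pow_le_pow_left₀ (abs_nonneg _)
    (hℓ.growth (append (proj Θ z.1) (response η Θstar z.1 z.2))) 2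
  have hy := pow_le_pow_left₀ (abs_nonneg _) (abs_response_le hη Θstar z) 4
  rw [sq_norm_append, sq_abs, mul_pow] at h
  rw [mul_pow] at hy
  refine h.trans ?_
  set b := ‖proj Θstar z.1‖ ^ 2 + z.2 ^ 2 with hb
  set y := response η Θstar z.1 z.2
  set a := ‖proj Θ z.1‖ ^ 2
  have ha : 0 ≤ a := by positivity
  have hb0 : 0 ≤ b := by positivity
  have hy' : y ^ 4 ≤ c ^ 4 * (8 * (1 + b ^ 4)) := by
    have e : y ^ 4 = |y| ^ 4 := by rw [← abs_pow, abs_of_nonneg (by positivity)]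
    rw [e]
    refine hy.trans (mul_le_mul_of_nonneg_left ?_ (by positivity))
    have h1 : (1 + b) ^ 2 ≤ 2 * (1 + b ^ 2) := by nlinarith [sq_nonneg (b - 1)]
    calc (1 + b) ^ 4 = ((1 + b) ^ 2) ^ 2 := by ring
      _ ≤ (2 * (1 + b ^ 2)) ^ 2 := pow_le_pow_left₀ (by positivity) h1 2
      _ ≤ 8 * (1 + b ^ 4) := by nlinarith [sq_nonneg (b ^ 2 - 1)]
  have ha' : a ^ 2 ≤ 1 + (a + z.2 ^ 2) ^ 4 := by
    have h1 : a ^ 4 ≤ (a + z.2 ^ 2) ^ 4 := pow_le_pow_left₀ ha (by nlinarith [sq_nonneg z.2]) 4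
    nlinarith [sq_nonneg (a ^ 2 - 1), sq_nonneg (a ^ 2)]
  have h3 : (1 + (a + y ^ 2)) ^ 2 ≤ 3 * (1 + a ^ 2 + y ^ 4) := by
    nlinarith [sq_nonneg (1 - a), sq_nonneg (1 - y ^ 2), sq_nonneg (a - y ^ 2)]
  calc c ^ 2 * (1 + (a + y ^ 2)) ^ 2 ≤ c ^ 2 * (3 * (1 + a ^ 2 + y ^ 4)) := by gcongr
    _ ≤ c ^ 2 * (3 * (1 + (1 + (a + z.2 ^ 2) ^ 4) + c ^ 4 * (8 * (1 + b ^ 4)))) := by gcongr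
    _ = _ := by ring

/-- Second moments of the losses and of the responses, bounded uniformly over the directions. -/
theorem exists_moment_bound (hT : 0 < T) (hℓ : QuadLipschitz c ℓ)
    (hη : QuadLipschitz c η) : ∃ M ≥ 0, ∀ {p : ℕ} {π : Measure (EuclideanSpace ℝ (Fin p) × ℝ)}
      [IsProbabilityMeasure π] {Θstar : Params p kstar},
      (∀ j, ExpSqLe T (fun z => inner ℝ (Θstar j) z.1) π) → ExpSqLe T (fun z => z.2) π →
      (Integrable (fun z => response η Θstar z.1 z.2 ^ 2) π ∧
        ∫ z, response η Θstar z.1 z.2 ^ 2 ∂π ≤ M) ∧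
      ∀ {Θ : Params p k}, (∀ j, ExpSqLe T (fun z => inner ℝ (Θ j) z.1) π) →
        Integrable (fun z => sampleLoss ℓ η Θstar Θ z ^ 2) π ∧
        ∫ z, sampleLoss ℓ η Θstar Θ z ^ 2 ∂π ≤ M := by
  -- The constants involve `k`, `kstar`, `c` and `T` only, so `M` is uniform in `p`.
  set m₁ : ℝ := (k + 1) ^ 4 * (48 * T ^ 8)
  set m₂ : ℝ := (kstar + 1) ^ 4 * (48 * T ^ 8)
  have hm₁ : 0 ≤ m₁ := by positivity
  have hm₂ : 0 ≤ m₂ := by positivity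
  refine ⟨max (c ^ 2 * (3 + 2 * m₂)) (3 * c ^ 2 * (2 + m₁ + 8 * c ^ 4 * (1 + m₂))),
    le_max_of_le_left (by positivity), ?_⟩
  intro p π _ Θstar hstar hnoise
  obtain ⟨i₂, b₂⟩ := integrable_pow_four_proj hT hstar hnoise
  refine ⟨?_, fun {Θ} hΘ => ?_⟩
  · have hbi : Integrable (fun z => c ^ 2 * (3 + 2 * (‖proj Θstar z.1‖ ^ 2 + z.2 ^ 2) ^ 4)) π :=
      ((integrable_const _).add (i₂.const_mul _)).const_mul _
    have hint : Integrable (fun z => response η Θstar z.1 z.2 ^ 2) π := by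
      refine hbi.mono' ((continuous_response hη.continuous Θstar).pow 2).aestronglyMeasurable
        (ae_of_all _ fun z => ?_)
      rw [Real.norm_of_nonneg (sq_nonneg _)]
      exact sq_response_le hη Θstar z
    refine ⟨hint, le_max_of_le_left
      ((integral_mono hint hbi fun z => sq_response_le hη Θstar z).trans ?_)⟩
    rw [integral_const_mul, integral_add (integrable_const _) (i₂.const_mul _),
      integral_const_mul]
    simp only [integral_const, probReal_univ, one_smul]
    gcongr
  · obtain ⟨i₁, b₁⟩ := integrable_pow_four_proj hT hΘ hnoise
    have hi₁ : Integrable (fun z => 2 + (‖proj Θ z.1‖ ^ 2 + z.2 ^ 2) ^ 4) π :=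
      (integrable_const _).add i₁
    have hi₂ : Integrable (fun z => 8 * c ^ 4 * (1 + (‖proj Θstar z.1‖ ^ 2 + z.2 ^ 2) ^ 4)) π :=
      ((integrable_const _).add i₂).const_mul _
    have hbi := (hi₁.add hi₂).const_mul (3 * c ^ 2)
    simp only [Pi.add_apply] at hbi
    have hint : Integrable (fun z => sampleLoss ℓ η Θstar Θ z ^ 2) π := by
      refine hbi.mono' (Continuous.aestronglyMeasurable ?_) (ae_of_all _ fun z => ?_)
      · exact ((continuous_sampleLoss hℓ.continuous hη.continuous Θstar).comp
          (continuous_const.prodMk continuous_id)).pow 2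
      · rw [Real.norm_of_nonneg (sq_nonneg _)]
        exact sq_sampleLoss_le hℓ hη Θstar Θ z
    refine ⟨hint, le_max_of_le_right
      ((integral_mono hint hbi fun z => sq_sampleLoss_le hℓ hη Θstar Θ z).trans ?_)⟩
    rw [integral_const_mul, integral_add hi₁ hi₂, integral_add (integrable_const _) i₁,
      integral_const_mul, integral_add (integrable_const _) i₂]
    simp only [integral_const, probReal_univ, one_smul]
    gcongr

end SampleLoss

/-! ### From the minimal risk to a soft minimum over a net -/

/-- Each term of the partition function is at most `exp (-β a)`, so passing below the minimum costs
at most the entropy `log |J| / β`. With `softMin_le` this sandwiches the minimum. -/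
lemma le_softMin {J : Type*} [Fintype J] [Nonempty J] {β : ℝ} (hβ : 0 < β) {w u : J → ℝ}
    (hw : ∀ j, 0 < w j) {a : ℝ} (h : ∀ j, a ≤ u j - (1 / β) * Real.log (w j)) :
    a - (1 / β) * Real.log (Fintype.card J) ≤ softMin β w u := by
  have h1 : ∑ j, w j * Real.exp (-β * u j) ≤ Fintype.card J * Real.exp (-β * a) := by
    rw [← nsmul_eq_mul, ← Finset.card_univ]
    refine Finset.sum_le_card_nsmul _ _ _ fun j _ => ?_
    have e : w j = Real.exp (Real.log (w j)) := (Real.exp_log (hw j)).symm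
    rw [e, ← Real.exp_add, Real.exp_le_exp]
    have h2 := mul_le_mul_of_nonneg_left (h j) hβ.le
    have h3 : β * (u j - 1 / β * Real.log (w j)) = β * u j - Real.log (w j) := by
      field_simp
    linarith
  have hcard : (0 : ℝ) < Fintype.card J := by exact_mod_cast Fintype.card_pos
  have h2 := Real.log_le_log (sum_mul_exp_pos (β := β) (u := u) hw) h1
  rw [Real.log_mul hcard.ne' (Real.exp_ne_zero _), Real.log_exp] at h2
  have h3 := mul_le_mul_of_nonneg_left h2 (by positivity : 0 ≤ 1 / β)
  have h4 : 1 / β * (Real.log (Fintype.card J) + -β * a) =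
      1 / β * Real.log (Fintype.card J) - a := by field_simp; ring
  unfold softMin
  linarith

section Net

variable {n p k kstar : ℕ} {ℓ : EuclideanSpace ℝ (Fin (k + 1)) → ℝ}
  {η : EuclideanSpace ℝ (Fin (kstar + 1)) → ℝ} {c α A Y : ℝ} {Θstar : Params p kstar}
  {r : Params p k → ℝ} {C S : Set (EuclideanSpace ℝ (Fin p))} {Kr : ℝ → ℝ}

/-- The product of the Lipschitz factor and the increment is split by `s δ ≤ (α/2) s² + δ²/(2α)`.
Since `δ²` will sum to `O(α² n)`, both terms then contribute `O(α n)`. -/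
lemma abs_sampleLoss_sub_le (hc : 0 < c) (hα : 0 < α) (hℓ : QuadLipschitz c ℓ)
    (Θ Θ₀ : Params p k) (z : EuclideanSpace ℝ (Fin p) × ℝ) :
    |sampleLoss ℓ η Θstar Θ z - sampleLoss ℓ η Θstar Θ₀ z| ≤
      c * (2 * α * (1 + ‖proj Θ z.1‖ ^ 2 + ‖proj Θ₀ z.1‖ ^ 2 +
        4 * response η Θstar z.1 z.2 ^ 2) + ‖proj (Θ - Θ₀) z.1‖ ^ 2 / (2 * α)) := by
  set y := response η Θstar z.1 z.2
  have h := hℓ.lipschitz (append (proj Θ z.1) y) (append (proj Θ₀ z.1) y)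
  have hδ : ‖append (proj Θ z.1) y - append (proj Θ₀ z.1) y‖ ≤ ‖proj (Θ - Θ₀) z.1‖ := by
    rw [append_sub_append, proj_sub, sub_self]
    simpa using norm_append_le (proj (Θ - Θ₀) z.1) 0
  refine h.trans ?_
  have h1 := norm_append_le (proj Θ z.1) y
  have h2 := norm_append_le (proj Θ₀ z.1) y
  set a := ‖proj Θ z.1‖
  set b := ‖proj Θ₀ z.1‖
  set δ := ‖proj (Θ - Θ₀) z.1‖
  rw [mul_assoc]
  refine mul_le_mul_of_nonneg_left ?_ hc.le
  set s := 1 + a + b + 2 * |y| with hs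
  have hle : (1 + ‖append (proj Θ z.1) y‖ + ‖append (proj Θ₀ z.1) y‖) *
      ‖append (proj Θ z.1) y - append (proj Θ₀ z.1) y‖ ≤ s * δ := by
    gcongr
    linarith
  refine hle.trans ?_
  have hs2 : s ^ 2 ≤ 4 * (1 + a ^ 2 + b ^ 2 + 4 * y ^ 2) := by
    rw [← sq_abs y, hs]
    nlinarith [sq_nonneg (1 - a), sq_nonneg (1 - b), sq_nonneg (1 - 2 * |y|), sq_nonneg (a - b),
      sq_nonneg (a - 2 * |y|), sq_nonneg (b - 2 * |y|)]
  have hamgm : s * δ ≤ α / 2 * s ^ 2 + δ ^ 2 / (2 * α) := by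
    have : α / 2 * s ^ 2 + δ ^ 2 / (2 * α) - s * δ = (α * s - δ) ^ 2 / (2 * α) := by
      field_simp; ring
    have h0 : 0 ≤ (α * s - δ) ^ 2 / (2 * α) := by positivity
    linarith
  calc s * δ ≤ α / 2 * s ^ 2 + δ ^ 2 / (2 * α) := hamgm
    _ ≤ α / 2 * (4 * (1 + a ^ 2 + b ^ 2 + 4 * y ^ 2)) + δ ^ 2 / (2 * α) := by gcongr
    _ = _ := by ring

lemma sum_sq_norm_proj_le {Θ : Params p k} {x : Fin n → EuclideanSpace ℝ (Fin p)} {B : ℝ}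
    (h : ∀ j, ∑ i, (inner ℝ (Θ j) (x i)) ^ 2 ≤ B) : ∑ i, ‖proj Θ (x i)‖ ^ 2 ≤ k * B := by
  simp_rw [sq_norm_proj]
  rw [Finset.sum_comm]
  calc _ ≤ ∑ _j : Fin k, B := Finset.sum_le_sum fun j _ => h j
    _ = k * B := by simp

open scoped Pointwise in
-- Here the gauge of `S` pays off: a column difference `α s` with `s ∈ S` inherits the bound `hA`
-- with a factor `α²`, so no control outside the directions of `S` is required.
lemma abs_sum_sampleLoss_sub_le (hc : 0 < c) (hα : 0 < α) (hℓ : QuadLipschitz c ℓ)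
    {Θ Θ₀ : Params p k} (hΘ : ∀ j, Θ j ∈ S) (hΘ₀ : ∀ j, Θ₀ j ∈ S)
    (hdiff : ∀ j, Θ j - Θ₀ j ∈ α • S) {z : Fin n → EuclideanSpace ℝ (Fin p) × ℝ}
    (hA : ∀ θ ∈ S, ∑ i, (inner ℝ θ (z i).1) ^ 2 ≤ n * A)
    (hY : ∑ i, response η Θstar (z i).1 (z i).2 ^ 2 ≤ n * Y) :
    |∑ i, sampleLoss ℓ η Θstar Θ (z i) - ∑ i, sampleLoss ℓ η Θstar Θ₀ (z i)| ≤
      n * (α * (c * (2 + 5 * k * A + 8 * Y))) := by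
  have h1 := sum_sq_norm_proj_le (x := fun i => (z i).1) fun j => hA _ (hΘ j)
  have h2 := sum_sq_norm_proj_le (x := fun i => (z i).1) fun j => hA _ (hΘ₀ j)
  have h3 : ∑ i, ‖proj (Θ - Θ₀) (z i).1‖ ^ 2 ≤ k * (α ^ 2 * (n * A)) := by
    refine sum_sq_norm_proj_le (x := fun i => (z i).1) fun j => ?_
    obtain ⟨s, hs, hsj⟩ := hdiff j
    have e : (Θ - Θ₀) j = α • s := hsj.symm
    simp only [e, real_inner_smul_left, mul_pow, ← Finset.mul_sum]
    exact mul_le_mul_of_nonneg_left (hA s hs) (sq_nonneg α)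
  rw [← Finset.sum_sub_distrib]
  refine (Finset.abs_sum_le_sum_abs _ _).trans
    ((Finset.sum_le_sum fun i _ => abs_sampleLoss_sub_le hc hα hℓ Θ Θ₀ (z i)).trans ?_)
  simp only [← Finset.mul_sum, Finset.sum_add_distrib, ← Finset.sum_div, Finset.sum_const,
    Finset.card_univ, Fintype.card_fin, nsmul_eq_mul, mul_one]
  calc _ ≤ c * (2 * α * (n + k * (n * A) + k * (n * A) + 4 * (n * Y)) +
        k * (α ^ 2 * (n * A)) / (2 * α)) := by gcongr
    _ = n * (α * (c * (2 + 9 / 2 * k * A + 8 * Y))) := by field_simp; ring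
    _ ≤ _ := by
        rcases Nat.eq_zero_or_pos n with rfl | hn
        · simp
        have hn' : (0 : ℝ) < n := by exact_mod_cast hn
        have hkA : 0 ≤ (k : ℝ) * A := by
          have : 0 ≤ k * (n * A) := le_trans (Finset.sum_nonneg fun i _ => sq_nonneg _) h1
          have e : (k : ℝ) * (n * A) = n * (k * A) := by ring
          rw [e] at this
          exact nonneg_of_mul_nonneg_right this hn'
        have hle : 2 + 9 / 2 * k * A + 8 * Y ≤ 2 + 5 * k * A + 8 * Y := by nlinarith
        exact mul_le_mul_of_nonneg_left (mul_le_mul_of_nonneg_left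
          (mul_le_mul_of_nonneg_left hle hc.le) hα.le) hn'.le

lemma norm_le_of_forall_norm_le {Θ : Params p k} {a : ℝ} (ha : 0 ≤ a) (h : ∀ j, ‖Θ j‖ ≤ a) :
    ‖Θ‖ ≤ k * a := by
  refine le_of_sq_le_sq ?_ (by positivity)
  rw [PiLp.norm_sq_eq_of_L2]
  calc ∑ j, ‖Θ j‖ ^ 2 ≤ ∑ _j : Fin k, a ^ 2 := Finset.sum_le_sum fun j _ =>
        pow_le_pow_left₀ (norm_nonneg _) (h j) 2
    _ = k * a ^ 2 := by simp
    _ ≤ (k * a) ^ 2 := by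
        rw [mul_pow]
        refine mul_le_mul_of_nonneg_right ?_ (sq_nonneg a)
        exact_mod_cast Nat.le_self_pow two_ne_zero k

lemma LocallyLipschitzReg.continuous (hr : LocallyLipschitzReg Kr r) : Continuous r := by
  rw [continuous_iff_continuousAt]
  intro Θ
  have hpos : 0 < ‖Θ‖ + 1 := by positivity
  have hlip : LipschitzOnWith (Kr (‖Θ‖ + 1)).toNNReal r (Metric.closedBall 0 (‖Θ‖ + 1)) := by
    refine LipschitzOnWith.of_dist_le_mul fun x hx y hy => ?_
    rw [Real.dist_eq, dist_eq_norm]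
    refine (hr _ hpos x y (by simpa using hx) (by simpa using hy)).trans ?_
    gcongr
    exact Real.le_coe_toNNReal _
  refine hlip.continuousOn.continuousAt ?_
  refine Filter.mem_of_superset (Metric.ball_mem_nhds Θ one_pos) fun x hx => ?_
  rw [mem_ball_iff_norm] at hx
  rw [mem_closedBall_zero_iff]
  linarith [norm_le_norm_add_norm_sub' x Θ]

lemma isCompact_setOf_forall_mem (hC : IsCompact C) : IsCompact {Θ : Params p k | ∀ j, Θ j ∈ C} := by
  have h := (isCompact_univ_pi fun _ : Fin k => hC).image
    (PiLp.continuous_toLp 2 fun _ : Fin k => EuclideanSpace ℝ (Fin p))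
  convert h using 1
  ext Θ
  constructor
  · exact fun h => ⟨WithLp.ofLp Θ, fun j _ => h j, rfl⟩
  · rintro ⟨a, ha, rfl⟩ j
    exact ha j (Set.mem_univ j)

/-- The minimal risk of the sample `z = ((x_i, ε_i))_i`. -/
noncomputable def sampleMinRisk (ℓ : EuclideanSpace ℝ (Fin (k + 1)) → ℝ)
    (η : EuclideanSpace ℝ (Fin (kstar + 1)) → ℝ) (Θstar : Params p kstar) (r : Params p k → ℝ)
    (C : Set (EuclideanSpace ℝ (Fin p))) (z : Fin n → EuclideanSpace ℝ (Fin p) × ℝ) : ℝ :=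
  minRisk ℓ r C (fun i => (z i).1) (fun i => response η Θstar (z i).1 (z i).2)

lemma continuous_uncurry_risk (hℓ : Continuous ℓ) (hη : Continuous η) (hr : Continuous r) :
    Continuous (Function.uncurry fun (z : Fin n → EuclideanSpace ℝ (Fin p) × ℝ) (Θ : Params p k) =>
      risk ℓ r (fun i => (z i).1) (fun i => response η Θstar (z i).1 (z i).2) Θ) := by
  have h : ∀ i, Continuous fun q : (Fin n → EuclideanSpace ℝ (Fin p) × ℝ) × Params p k =>
      sampleLoss ℓ η Θstar q.2 (q.1 i) := fun i =>
    (continuous_sampleLoss hℓ hη Θstar).comp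
      (continuous_snd.prodMk ((continuous_apply i).comp continuous_fst))
  exact (continuous_const.mul (continuous_finsetSum _ fun i _ => h i)).add
    (hr.comp continuous_snd)

/-- Compactness of `C` makes the infimum continuous in the sample; this supplies measurability. -/
lemma continuous_sampleMinRisk (hℓ : Continuous ℓ) (hη : Continuous η) (hr : Continuous r)
    (hC : IsCompact C) :
    Continuous fun z : Fin n → EuclideanSpace ℝ (Fin p) × ℝ => sampleMinRisk ℓ η Θstar r C z :=
  (isCompact_setOf_forall_mem hC).continuous_sInf (continuous_uncurry_risk hℓ hη hr)

lemma sampleMinRisk_le (hℓ : Continuous ℓ) (hη : Continuous η) (hr : Continuous r)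
    (hC : IsCompact C) (z : Fin n → EuclideanSpace ℝ (Fin p) × ℝ) {Θ : Params p k}
    (hΘ : ∀ j, Θ j ∈ C) :
    sampleMinRisk ℓ η Θstar r C z ≤ 1 / n * ∑ i, sampleLoss ℓ η Θstar Θ (z i) + r Θ := by
  have hcont : Continuous fun Θ : Params p k =>
      risk ℓ r (fun i => (z i).1) (fun i => response η Θstar (z i).1 (z i).2) Θ :=
    Continuous.uncurry_left z (continuous_uncurry_risk (Θstar := Θstar) hℓ hη hr)
  have e : 1 / n * ∑ i, sampleLoss ℓ η Θstar Θ (z i) + r Θ =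
      risk ℓ r (fun i => (z i).1) (fun i => response η Θstar (z i).1 (z i).2) Θ := rfl
  rw [e]
  exact csInf_le ((isCompact_setOf_forall_mem hC).bddBelow_image hcont.continuousOn)
    (Set.mem_image_of_mem _ hΘ)

lemma le_sampleMinRisk (hC : C.Nonempty) (z : Fin n → EuclideanSpace ℝ (Fin p) × ℝ) {a : ℝ}
    (h : ∀ Θ : Params p k, (∀ j, Θ j ∈ C) →
      a ≤ 1 / n * ∑ i, sampleLoss ℓ η Θstar Θ (z i) + r Θ) :
    a ≤ sampleMinRisk ℓ η Θstar r C z := by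
  obtain ⟨θ, hθ⟩ := hC
  refine le_csInf ⟨_, WithLp.toLp 2 fun _ => θ, fun _ => hθ, rfl⟩ ?_
  rintro _ ⟨Θ, hΘ, rfl⟩
  exact h Θ hΘ

/-- On typical samples the minimal risk is approximated by a soft minimum over a finite family of
parameters. -/
theorem exists_softMin_approx (hn : 0 < n) (hk : 0 < k) (hc : 0 < c) (hα : 0 < α)
    (hℓ : QuadLipschitz c ℓ) (hη : QuadLipschitz c η) {R : ℝ} (hR : 0 < R)
    (hconv : Convex ℝ S) (hsymm : ∀ θ ∈ S, -θ ∈ S) (h0 : 0 ∈ S)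
    (hbdd : S ⊆ Metric.closedBall 0 R) (hC : IsCompact C) (hCne : C.Nonempty) (hCS : C ⊆ S)
    (hr : LocallyLipschitzReg Kr r) (hKr : ∀ B, 0 ≤ B → 0 < Kr B) :
    ∃ (J : Type) (_ : Fintype J) (_ : Nonempty J) (Θ : J → Params p k), (∀ a j, Θ a j ∈ C) ∧
      ∀ {β : ℝ}, 0 < β → ∃ w : J → ℝ, (∀ a, 0 < w a) ∧
        ∀ {z : Fin n → EuclideanSpace ℝ (Fin p) × ℝ},
          (∀ θ ∈ S, ∑ i, (inner ℝ θ (z i).1) ^ 2 ≤ n * A) →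
          ∑ i, response η Θstar (z i).1 (z i).2 ^ 2 ≤ n * Y →
          |sampleMinRisk ℓ η Θstar r C z -
            1 / n * softMin β w fun a => ∑ i, sampleLoss ℓ η Θstar (Θ a) (z i)| ≤
          α * (c * (2 + 5 * k * A + 8 * Y) + Kr (k * R) * (k * R)) +
            (p / n : ℝ) * (k * Real.log (1 + 2 / α)) / β := by
  have hSb : Bornology.IsBounded S := Metric.isBounded_closedBall.subset hbdd
  obtain ⟨N, hNC, hcover, hcard⟩ := exists_gauge_net hconv hsymm h0 hSb hα hCS
  rw [finrank_euclideanSpace, Fintype.card_fin] at hcard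
  have hn' : (0 : ℝ) < n := by exact_mod_cast hn
  have hk' : (0 : ℝ) < k := by exact_mod_cast hk
  have hNne : Nonempty N := by
    obtain ⟨θ, hθ⟩ := hCne
    obtain ⟨θ₀, hθ₀, -⟩ := hcover θ hθ
    exact ⟨⟨θ₀, hθ₀⟩⟩
  set Θ : (Fin k → N) → Params p k := fun a => WithLp.toLp 2 fun j => (a j : EuclideanSpace ℝ (Fin p))
  have hΘC : ∀ a j, Θ a j ∈ C := fun a j => hNC (a j).2
  refine ⟨Fin k → N, inferInstance, inferInstance, Θ, hΘC, ?_⟩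
  intro β hβ
  -- The regularizer is encoded in the weights: `-(1/β) log (w a)` is `n * r (Θ a)`, which turns the
  -- loss sum into `n` times the risk.
  refine ⟨fun a => Real.exp (-β * (n * r (Θ a))), fun a => Real.exp_pos _, ?_⟩
  intro z hA hY
  set w : (Fin k → N) → ℝ := fun a => Real.exp (-β * (n * r (Θ a))) with hw
  set u : (Fin k → N) → ℝ := fun a => ∑ i, sampleLoss ℓ η Θstar (Θ a) (z i) with hu
  have hw0 : ∀ a, 0 < w a := fun a => Real.exp_pos _
  have hrisk : ∀ a, 1 / n * (u a - 1 / β * Real.log (w a)) =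
      1 / n * ∑ i, sampleLoss ℓ η Θstar (Θ a) (z i) + r (Θ a) := fun a => by
    simp only [hw, hu, Real.log_exp]
    field_simp
    ring
  have hupper : ∀ a, 1 / n * softMin β w u ≤
      1 / n * ∑ i, sampleLoss ℓ η Θstar (Θ a) (z i) + r (Θ a) := fun a => by
    rw [← hrisk]
    exact mul_le_mul_of_nonneg_left (softMin_le hβ hw0 a) (by positivity)
  -- The net lies in `C`, so its risks are at least the minimum, and only the entropy of the net is
  -- lost.
  have hlower : sampleMinRisk ℓ η Θstar r C z - (p / n : ℝ) * (k * Real.log (1 + 2 / α)) / β ≤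
      1 / n * softMin β w u := by
    have h1 := le_softMin hβ hw0 (u := u) (a := n * sampleMinRisk ℓ η Θstar r C z) fun a => by
      have h2 := sampleMinRisk_le (Θstar := Θstar) hℓ.continuous hη.continuous hr.continuous hC z
        (hΘC a)
      rw [← hrisk] at h2
      rwa [one_div, le_inv_mul_iff₀ hn'] at h2
    have hlog : Real.log (Fintype.card (Fin k → N)) ≤ p * (k * Real.log (1 + 2 / α)) := by
      rw [Fintype.card_fun, Fintype.card_coe, Fintype.card_fin]
      push_cast
      rw [Real.log_pow]
      have hNpos : (0 : ℝ) < N.card := by exact_mod_cast Finset.card_pos.2 (Finset.nonempty_coe_sort.1 hNne)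
      have h3 := Real.log_le_log hNpos hcard
      rw [Real.log_pow] at h3
      nlinarith
    have h4 : n * sampleMinRisk ℓ η Θstar r C z - 1 / β * (p * (k * Real.log (1 + 2 / α))) ≤
        softMin β w u := by
      refine le_trans ?_ h1
      gcongr
    have h5 := mul_le_mul_of_nonneg_left h4 (by positivity : (0 : ℝ) ≤ 1 / n)
    refine le_trans (le_of_eq ?_) h5
    field_simp
  -- Every admissible parameter is compared columnwise with a net point, for the loss and for the
  -- regularizer.
  have hupper' : 1 / n * softMin β w u -
      α * (c * (2 + 5 * k * A + 8 * Y) + Kr (k * R) * (k * R)) ≤ sampleMinRisk ℓ η Θstar r C z := by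
    refine le_sampleMinRisk hCne z fun Θ' hΘ' => ?_
    choose θ₀ hθ₀ hdiff using fun j => hcover _ (hΘ' j)
    set a : Fin k → N := fun j => ⟨θ₀ j, hθ₀ j⟩
    have hloss := abs_sum_sampleLoss_sub_le (Θ := Θ') (Θ₀ := Θ a) hc hα hℓ (fun j => hCS (hΘ' j))
      (fun j => hCS (hΘC a j)) hdiff hA hY
    have hnorm : ∀ Θ'' : Params p k, (∀ j, Θ'' j ∈ C) → ‖Θ''‖ ≤ k * R := fun Θ'' h =>
      norm_le_of_forall_norm_le hR.le fun j => by simpa using hbdd (hCS (h j))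
    have hdn : ‖Θ' - Θ a‖ ≤ k * (α * R) := by
      refine norm_le_of_forall_norm_le (by positivity) fun j => ?_
      obtain ⟨s, hs, hsj⟩ := hdiff j
      have e : (Θ' - Θ a) j = α • s := hsj.symm
      have hsR : ‖s‖ ≤ R := by simpa using hbdd hs
      rw [e, norm_smul, Real.norm_of_nonneg hα.le]
      gcongr
    have hreg := hr (k * R) (by positivity) Θ' (Θ a) (hnorm _ hΘ') (hnorm _ (hΘC a))
    have hreg' : |r Θ' - r (Θ a)| ≤ α * (Kr (k * R) * (k * R)) := by
      refine hreg.trans ((mul_le_mul_of_nonneg_left hdn (hKr _ (by positivity)).le).trans ?_)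
      exact le_of_eq (by ring)
    have h1 := hupper a
    have h2 : 1 / n * (∑ i, sampleLoss ℓ η Θstar (Θ a) (z i) -
        ∑ i, sampleLoss ℓ η Θstar Θ' (z i)) ≤ α * (c * (2 + 5 * k * A + 8 * Y)) := by
      rw [one_div, inv_mul_le_iff₀ hn']
      linarith [(abs_le.1 hloss).1]
    rw [mul_sub] at h2
    linarith [(abs_le.1 hreg').1]
  rw [abs_le]
  have hp0 : 0 ≤ (p / n : ℝ) * (k * Real.log (1 + 2 / α)) / β := by
    have : 0 ≤ Real.log (1 + 2 / α) := Real.log_nonneg (by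
      have : 0 < 2 / α := by positivity
      linarith)
    positivity
  have hκ : 0 ≤ α * (c * (2 + 5 * k * A + 8 * Y) + Kr (k * R) * (k * R)) := by
    have hA0 : 0 ≤ n * A := le_trans (Finset.sum_nonneg fun i _ => sq_nonneg _) (hA 0 h0)
    have hY0 : 0 ≤ n * Y := le_trans (Finset.sum_nonneg fun i _ => sq_nonneg _) hY
    have hA1 : 0 ≤ A := nonneg_of_mul_nonneg_right hA0 hn'
    have hY1 : 0 ≤ Y := nonneg_of_mul_nonneg_right hY0 hn'
    have := hKr (k * R) (by positivity)
    positivity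
  constructor <;> linarith

end Net

/-! ### Product laws, smoothing of test functions, exceptional events -/

/-- The pairs `(x_i, ε_i)` are i.i.d. of law `μ ⊗ ν`, so each model is a product law, whatever the
coupling between the two models. -/
lemma IsSample.hasLaw {Ω : Type*} [MeasurableSpace Ω] {P : Measure Ω} [IsProbabilityMeasure P]
    {n p : ℕ} {μ : Measure (EuclideanSpace ℝ (Fin p))} {ν : Measure ℝ} [IsProbabilityMeasure μ]
    [IsProbabilityMeasure ν] {x : Fin n → Ω → EuclideanSpace ℝ (Fin p)} {ε : Fin n → Ω → ℝ}
    (h : IsSample P μ ν x ε) :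
    HasLaw (fun ω i => (x i ω, ε i ω)) (Measure.pi fun _ => μ.prod ν) P := by
  have hx : AEMeasurable (fun ω i => x i ω) P :=
    aemeasurable_pi_lambda _ fun i => (h.law_x i).aemeasurable
  have hε : AEMeasurable (fun ω i => ε i ω) P :=
    aemeasurable_pi_lambda _ fun i => (h.law_noise i).aemeasurable
  have hmx := (iIndepFun_iff_map_fun_eq_pi_map fun i => (h.law_x i).aemeasurable).1 h.indep_x
  have hmε := (iIndepFun_iff_map_fun_eq_pi_map fun i => (h.law_noise i).aemeasurable).1
    h.indep_noise
  simp only [(h.law_x _).map_eq] at hmx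
  simp only [(h.law_noise _).map_eq] at hmε
  have hpair := (indepFun_iff_map_prod_eq_prod_map_map hx hε).1 h.indep
  rw [hmx, hmε] at hpair
  refine ⟨aemeasurable_pi_lambda _ fun i =>
    (h.law_x i).aemeasurable.prodMk (h.law_noise i).aemeasurable, ?_⟩
  have hmp := (measurePreserving_arrowProdEquivProdArrow (EuclideanSpace ℝ (Fin p)) ℝ (Fin n)
    (fun _ => μ) (fun _ => ν)).symm
  rw [← hmp.map_eq, ← hpair, AEMeasurable.map_map_of_aemeasurable
    (MeasurableEquiv.measurable _).aemeasurable (hx.prodMk hε)]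
  rfl

/-- An empty sample carries no information on its laws, hence the restriction to `n > 0`. -/
lemma IsSample.isProbabilityMeasure {Ω : Type*} [MeasurableSpace Ω] {P : Measure Ω}
    [IsProbabilityMeasure P] {n p : ℕ} (hn : 0 < n) {μ : Measure (EuclideanSpace ℝ (Fin p))}
    {ν : Measure ℝ} {x : Fin n → Ω → EuclideanSpace ℝ (Fin p)} {ε : Fin n → Ω → ℝ}
    (h : IsSample P μ ν x ε) : IsProbabilityMeasure μ ∧ IsProbabilityMeasure ν := by
  have hx := h.law_x ⟨0, hn⟩
  have hε := h.law_noise ⟨0, hn⟩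
  rw [← hx.map_eq, ← hε.map_eq]
  exact ⟨Measure.isProbabilityMeasure_map hx.aemeasurable,
    Measure.isProbabilityMeasure_map hε.aemeasurable⟩

lemma abs_intervalIntegral_sub_le {ψ : ℝ → ℝ} {L : ℝ≥0} (hψ : LipschitzWith L ψ) (a s : ℝ) :
    |(∫ t in a..(a + s), ψ t) - ψ a * s| ≤ L * s ^ 2 := by
  have h1 : ψ a * s = ∫ _t in a..(a + s), ψ a := by simp [mul_comm]
  rw [h1, ← intervalIntegral.integral_sub (hψ.continuous.intervalIntegrable _ _) (by simp)]
  have := intervalIntegral.norm_integral_le_of_norm_le_const (a := a) (b := a + s)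
    (f := fun t => ψ t - ψ a) (C := L * |s|) fun t ht => by
      have h2 := hψ.dist_le_mul t a
      rw [Real.dist_eq, Real.dist_eq] at h2
      refine h2.trans (mul_le_mul_of_nonneg_left ?_ L.coe_nonneg)
      have h3 := Set.abs_sub_left_of_mem_uIcc (Set.uIoc_subset_uIcc ht)
      simpa [abs_sub_comm] using h3
  refine this.trans (le_of_eq ?_)
  rw [add_sub_cancel_left, mul_assoc, ← abs_mul, ← sq, abs_of_nonneg (sq_nonneg s)]

/-- Bounded Lipschitz functions are uniform limits of bounded functions with bounded and Lipschitz
derivative. -/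
lemma BoundedLipschitz.exists_smooth_approx {ψ : ℝ → ℝ} (hψ : BoundedLipschitz ψ) {ε : ℝ}
    (hε : 0 < ε) : ∃ (φ d : ℝ → ℝ) (A D B : ℝ), Continuous φ ∧ (∀ t, |φ t| ≤ A) ∧
      (∀ a, |d a| ≤ D) ∧ 0 ≤ B ∧ (∀ a s, |φ (a + s) - φ a - d a * s| ≤ B * s ^ 2) ∧
      ∀ t, |φ t - ψ t| ≤ ε := by
  obtain ⟨⟨M, hM⟩, L, hL⟩ := hψ
  set h : ℝ := ε / (L + 1) with hh
  have hh0 : 0 < h := by positivity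
  have hLh : L * h ≤ ε := by
    rw [hh, ← mul_div_assoc, div_le_iff₀ (by positivity)]
    nlinarith [L.coe_nonneg]
  have hii : ∀ a b, IntervalIntegrable ψ volume a b := fun a b =>
    hL.continuous.intervalIntegrable _ _
  -- The moving average over a window of length `h = ε/(L+1)` is within `L h ≤ ε` of `ψ`; its
  -- derivative `(ψ (t + h) - ψ t) / h` is bounded and Lipschitz.
  set φ : ℝ → ℝ := fun t => 1 / h * ∫ u in t..(t + h), ψ u with hφ
  have hclose : ∀ t, |φ t - ψ t| ≤ ε := fun t => by
    have h1 := abs_intervalIntegral_sub_le hL t h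
    have h2 : φ t - ψ t = 1 / h * ((∫ u in t..(t + h), ψ u) - ψ t * h) := by
      simp only [hφ]; field_simp
    rw [h2, abs_mul, abs_of_pos (by positivity), one_div, inv_mul_le_iff₀ hh0]
    refine h1.trans ?_
    nlinarith
  refine ⟨φ, fun t => (ψ (t + h) - ψ t) / h, ε + M, (M + M) / h, 2 * L / h, ?_, fun t => ?_,
    fun a => ?_, by positivity, fun a s => ?_, hclose⟩
  · have hF := intervalIntegral.continuous_primitive hii 0
    have : φ = fun t => 1 / h * ((∫ u in (0 : ℝ)..(t + h), ψ u) - ∫ u in (0 : ℝ)..t, ψ u) := by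
      ext t
      rw [intervalIntegral.integral_interval_sub_left (hii _ _) (hii _ _)]
    rw [this]
    exact continuous_const.mul ((hF.comp (by fun_prop : Continuous fun t => t + h)).sub hF)
  · have := abs_add_le (φ t - ψ t) (ψ t)
    rw [sub_add_cancel] at this
    linarith [hclose t, hM t]
  · rw [abs_div, abs_of_pos hh0]
    gcongr
    exact (abs_sub _ _).trans (add_le_add (hM _) (hM _))
  · have h1 := abs_intervalIntegral_sub_le hL (a + h) s
    have h2 := abs_intervalIntegral_sub_le hL a s
    have h3 : (∫ u in (a + s)..(a + s + h), ψ u) - ∫ u in a..(a + h), ψ u =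
        (∫ u in (a + h)..(a + h + s), ψ u) - ∫ u in a..(a + s), ψ u := by
      rw [show a + s + h = a + h + s by ring]
      have e1 := intervalIntegral.integral_add_adjacent_intervals (hii a (a + h))
        (hii (a + h) (a + h + s))
      have e2 := intervalIntegral.integral_add_adjacent_intervals (hii a (a + s))
        (hii (a + s) (a + h + s))
      linarith
    have h4 : φ (a + s) - φ a - (ψ (a + h) - ψ a) / h * s =
        1 / h * (((∫ u in (a + h)..(a + h + s), ψ u) - ψ (a + h) * s) -
          ((∫ u in a..(a + s), ψ u) - ψ a * s)) := by
      simp only [hφ]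
      rw [← mul_sub, h3]
      field_simp
      ring
    rw [h4, abs_mul, abs_of_pos (by positivity), one_div, inv_mul_le_iff₀ hh0]
    refine (abs_sub _ _).trans ((add_le_add h1 h2).trans (le_of_eq ?_))
    field_simp
    ring

lemma abs_integral_comp_sub_le {α : Type*} [MeasurableSpace α] {Q : Measure α}
    [IsProbabilityMeasure Q] {ψ : ℝ → ℝ} {M τ ζ : ℝ} {L : ℝ≥0} (hM : ∀ t, |ψ t| ≤ M)
    (hL : LipschitzWith L ψ) {V f : α → ℝ} (hV : Measurable V) (hf : Measurable f) (hτ : 0 ≤ τ)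
    (h : Q.real {a | τ < |V a - f a|} ≤ ζ) :
    |∫ a, ψ (V a) ∂Q - ∫ a, ψ (f a) ∂Q| ≤ L * τ + 2 * M * ζ := by
  have hψ := hL.continuous.measurable
  have hM0 : 0 ≤ M := (abs_nonneg _).trans (hM 0)
  have i1 : Integrable (fun a => ψ (V a)) Q := integrable_of_abs_le (hψ.comp hV) fun a => hM _
  have i2 : Integrable (fun a => ψ (f a)) Q := integrable_of_abs_le (hψ.comp hf) fun a => hM _
  set B : Set α := {a | τ < |V a - f a|} with hB
  have hBm : MeasurableSet B := measurableSet_lt measurable_const (hV.sub hf).abs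
  have i3 : Integrable (B.indicator fun _ => 2 * M) Q :=
    (integrable_const _).indicator hBm
  rw [← integral_sub i1 i2]
  calc |∫ a, (ψ (V a) - ψ (f a)) ∂Q| ≤ ∫ a, |ψ (V a) - ψ (f a)| ∂Q := abs_integral_le_integral_abs
    _ ≤ ∫ a, (L * τ + B.indicator (fun _ => 2 * M) a) ∂Q := by
        refine integral_mono_of_nonneg (ae_of_all _ fun a => abs_nonneg _)
          ((integrable_const _).add i3) (ae_of_all _ fun a => ?_)
        by_cases ha : a ∈ B
        · simp only [Set.indicator_of_mem ha]
          have h0 : (0 : ℝ) ≤ L * τ := mul_nonneg L.coe_nonneg hτ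
          linarith [abs_sub (ψ (V a)) (ψ (f a)), hM (V a), hM (f a)]
        · simp only [Set.indicator_of_notMem ha, add_zero]
          have h1 := hL.dist_le_mul (V a) (f a)
          rw [Real.dist_eq, Real.dist_eq] at h1
          exact h1.trans (mul_le_mul_of_nonneg_left (not_lt.1 ha) L.coe_nonneg)
    _ = L * τ + 2 * M * Q.real B := by
        rw [integral_add (integrable_const _) i3, integral_indicator_const _ hBm]
        simp [mul_comm]
    _ ≤ _ := by gcongr

/-- Markov's inequality. The bound does not vanish with `n`, but `Y` may be taken large once and for
all. -/
lemma measureReal_pi_sum_gt_le {α : Type*} [MeasurableSpace α] {π : Measure α}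
    [IsProbabilityMeasure π] {f : α → ℝ} (hf0 : ∀ a, 0 ≤ f a) (hf : Integrable f π) {M : ℝ}
    (hM : ∫ a, f a ∂π ≤ M) {n : ℕ} (hn : 0 < n) {Y : ℝ} (hY : 0 < Y) :
    (Measure.pi fun _ : Fin n => π).real {z | n * Y < ∑ i, f (z i)} ≤ M / Y := by
  have hn' : (0 : ℝ) < n := by exact_mod_cast hn
  have hi : ∀ i, Integrable (fun z : Fin n → α => f (z i)) (Measure.pi fun _ : Fin n => π) :=
    fun i => (measurePreserving_eval (fun _ : Fin n => π) i).integrable_comp_of_integrable hf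
  have hmarkov := mul_meas_ge_le_integral_of_nonneg (μ := Measure.pi fun _ : Fin n => π)
    (f := fun z => ∑ i, f (z i)) (ae_of_all _ fun z => Finset.sum_nonneg fun i _ => hf0 (z i))
    (integrable_finsetSum _ fun i _ => hi i) (n * Y)
  rw [integral_finsetSum _ fun i _ => hi i] at hmarkov
  have he : ∀ i, ∫ z : Fin n → α, f (z i) ∂(Measure.pi fun _ : Fin n => π) = ∫ a, f a ∂π :=
    fun i => by
      have hmp := measurePreserving_eval (fun _ : Fin n => π) i
      have := integral_map (μ := Measure.pi fun _ : Fin n => π) (φ := Function.eval i) (f := f)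
        hmp.measurable.aemeasurable (by rw [hmp.map_eq]; exact hf.aestronglyMeasurable)
      rw [hmp.map_eq] at this
      exact this.symm
  simp only [he, Finset.sum_const, Finset.card_univ, Fintype.card_fin, nsmul_eq_mul] at hmarkov
  have hmono : (Measure.pi fun _ : Fin n => π).real {z | n * Y < ∑ i, f (z i)} ≤
      (Measure.pi fun _ : Fin n => π).real {z | n * Y ≤ ∑ i, f (z i)} :=
    measureReal_mono (Set.ofPred_subset_ofPred.2 fun z hz => le_of_lt hz) (measure_ne_top _ _)
  rw [le_div_iff₀ hY]
  have h1 : n * ((Measure.pi fun _ : Fin n => π).real {z | n * Y < ∑ i, f (z i)} * Y) ≤ n * M := by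
    calc _ = n * Y * (Measure.pi fun _ : Fin n => π).real {z | n * Y < ∑ i, f (z i)} := by ring
      _ ≤ n * Y * (Measure.pi fun _ : Fin n => π).real {z | n * Y ≤ ∑ i, f (z i)} := by gcongr
      _ ≤ n * ∫ a, f a ∂π := hmarkov
      _ ≤ n * M := by gcongr
  exact le_of_mul_le_mul_left h1 hn'

/-! ### Comparison of the two models -/

section Replicas

variable {k kstar : ℕ} {ℓ : EuclideanSpace ℝ (Fin (k + 1)) → ℝ}
  {η : EuclideanSpace ℝ (Fin (kstar + 1)) → ℝ}

/-- `exp (-β ∑ i, ℓ (v_i, η (v⋆, e)))` as a bounded continuous function of `((v_i)_i, v⋆, e)`. -/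
noncomputable def replicaWeight {β : ℝ} (hβ : 0 < β) (hℓ : Continuous ℓ) (hη : Continuous η)
    (hℓ0 : ∀ v, 0 ≤ ℓ v) (m : ℕ) :
    BoundedContinuousFunction (EuclideanSpace ℝ (Option ((Fin m × Fin k) ⊕ Fin kstar))) ℝ :=
  BoundedContinuousFunction.ofNormedAddCommGroup
    (fun y => Real.exp (-β * ∑ i : Fin m,
      ℓ (append (WithLp.toLp 2 fun j => y (some (Sum.inl (i, j))))
        (η (append (WithLp.toLp 2 fun j => y (some (Sum.inr j))) (y none))))))
    (by
      have h1 : Continuous fun y : EuclideanSpace ℝ (Option ((Fin m × Fin k) ⊕ Fin kstar)) =>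
          η (append (WithLp.toLp 2 fun j => y (some (Sum.inr j))) (y none)) :=
        hη.comp (continuous_append.comp (Continuous.prodMk (by fun_prop) (by fun_prop)))
      have h2 : ∀ i : Fin m, Continuous
          fun y : EuclideanSpace ℝ (Option ((Fin m × Fin k) ⊕ Fin kstar)) =>
          ℓ (append (WithLp.toLp 2 fun j => y (some (Sum.inl (i, j))))
            (η (append (WithLp.toLp 2 fun j => y (some (Sum.inr j))) (y none)))) := fun i =>
        hℓ.comp (continuous_append.comp (Continuous.prodMk (by fun_prop) h1))
      exact Real.continuous_exp.comp
        (continuous_const.mul (continuous_finsetSum _ fun i _ => h2 i)))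
    1 (fun y => by
      rw [Real.norm_of_nonneg (Real.exp_pos _).le, Real.exp_le_one_iff, neg_mul,
        neg_nonpos]
      exact mul_nonneg hβ.le (Finset.sum_nonneg fun i _ => hℓ0 _))

/-- A replicated moment is a fixed function of the noise and of `m k + kstar` projections, so the
comparison of joint laws applies to it. -/
lemma replicaWeight_projWithNoise {β : ℝ} (hβ : 0 < β) (hℓ : Continuous ℓ) (hη : Continuous η)
    (hℓ0 : ∀ v, 0 ≤ ℓ v) {m p : ℕ} (Θ : Fin m → Params p k) (Θstar : Params p kstar)
    (z : EuclideanSpace ℝ (Fin p) × ℝ) :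
    replicaWeight hβ hℓ hη hℓ0 m
      (projWithNoise (Sum.elim (fun q : Fin m × Fin k => Θ q.1 q.2) fun j => Θstar j) z) =
      Real.exp (-β * ∑ i, sampleLoss ℓ η Θstar (Θ i) z) := rfl

end Replicas

section Comparison

variable {k kstar : ℕ} {ℓ : EuclideanSpace ℝ (Fin (k + 1)) → ℝ}
  {η : EuclideanSpace ℝ (Fin (kstar + 1)) → ℝ} {c T R : ℝ} {Kr : ℝ → ℝ}

/-- The approximation can fail only if the second moments along `S` or the squared responses are too
large; the union bound adds the two estimates. -/
lemma measureReal_bad_sample_le {n p : ℕ} (hn : 0 < n) {S : Set (EuclideanSpace ℝ (Fin p))}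
    (hconv : Convex ℝ S) (hsymm : ∀ θ ∈ S, -θ ∈ S) (h0 : 0 ∈ S) (hbdd : Bornology.IsBounded S)
    {π : Measure (EuclideanSpace ℝ (Fin p) × ℝ)} [IsProbabilityMeasure π] (hT : 0 < T)
    (hsub : ∀ θ ∈ S, ExpSqLe T (fun z => inner ℝ θ z.1) π) {y : EuclideanSpace ℝ (Fin p) × ℝ → ℝ} {M : ℝ}
    (hint : Integrable (fun z => y z ^ 2) π)
    (hM : ∫ z, y z ^ 2 ∂π ≤ M) {a Y : ℝ} (ha : 0 ≤ a) (hY : 0 < Y)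
    {V f : (Fin n → EuclideanSpace ℝ (Fin p) × ℝ) → ℝ} {τ : ℝ}
    (happrox : ∀ {z : Fin n → EuclideanSpace ℝ (Fin p) × ℝ},
      (∀ θ ∈ S, ∑ i, (inner ℝ θ (z i).1) ^ 2 ≤ n * (4 * a * T ^ 2)) →
      ∑ i, y (z i) ^ 2 ≤ n * Y → |V z - f z| ≤ τ) :
    (Measure.pi fun _ : Fin n => π).real {z | τ < |V z - f z|} ≤
      5 ^ p * (2 ^ n * Real.exp (-(n * a))) + M / Y := by
  set Q := Measure.pi fun _ : Fin n => π
  set B₁ : Set (Fin n → EuclideanSpace ℝ (Fin p) × ℝ) :=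
    {z | ∃ θ ∈ S, 4 * (n * a) * T ^ 2 < ∑ i, (inner ℝ θ (z i).1) ^ 2} with hB₁
  set B₂ : Set (Fin n → EuclideanSpace ℝ (Fin p) × ℝ) :=
    {z | n * Y < ∑ i, y (z i) ^ 2} with hB₂
  have h1 : Q.real B₁ ≤ 5 ^ p * (2 ^ n * Real.exp (-(n * a))) :=
    measureReal_pi_exists_sum_sq_gt_le (ξ := Prod.fst) hconv hsymm h0 hbdd measurable_fst hT hsub n
      (a := n * a) (by positivity)
  have h2 : Q.real B₂ ≤ M / Y :=
    measureReal_pi_sum_gt_le (f := fun z => y z ^ 2) (fun z => sq_nonneg _)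
      hint hM hn hY
  have hsubset : {z | τ < |V z - f z|} ⊆ B₁ ∪ B₂ := by
    intro z hz
    by_contra hcon
    rw [Set.mem_union, not_or] at hcon
    have hz1 : ∀ θ ∈ S, ∑ i, (inner ℝ θ (z i).1) ^ 2 ≤ n * (4 * a * T ^ 2) := fun θ hθ => by
      by_contra! hlt
      exact hcon.1 ⟨θ, hθ, lt_of_eq_of_lt (by ring) hlt⟩
    exact absurd (happrox hz1 (not_lt.1 hcon.2)) (not_le.2 hz)
  calc Q.real {z | τ < |V z - f z|} ≤ Q.real (B₁ ∪ B₂) :=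
        measureReal_mono hsubset (measure_ne_top _ _)
    _ ≤ Q.real B₁ + Q.real B₂ := measureReal_union_le _ _
    _ ≤ _ := add_le_add h1 h2

/-- Universality for product laws: the laws of the minimal risks of the two models are
asymptotically the same. -/
theorem eventually_abs_integral_sampleMinRisk_sub_le {γ : ℝ} (hγ : 0 < γ) (hk : 0 < k)
    {p : ℕ → ℕ} (hp : Tendsto (fun n => (p n : ℝ) / (n : ℝ)) atTop (𝓝 γ)) (hc : 0 < c)
    (hℓ : QuadLipschitz c ℓ) (hη : QuadLipschitz c η) (hℓ0 : ∀ v, 0 ≤ ℓ v) (hR : 0 < R)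
    {S : ∀ n, Set (EuclideanSpace ℝ (Fin (p n)))} (hconv : ∀ n, Convex ℝ (S n))
    (hsymm : ∀ n, ∀ θ ∈ S n, -θ ∈ S n) (h0 : ∀ n, 0 ∈ S n)
    (hbdd : ∀ n, S n ⊆ Metric.closedBall 0 R)
    {C : ∀ n, Set (EuclideanSpace ℝ (Fin (p n)))} (hC : ∀ n, IsCompact (C n))
    (hCne : ∀ n, (C n).Nonempty) (hCS : ∀ n, C n ⊆ S n)
    {Θstar : ∀ n, Params (p n) kstar} (hΘstar : ∀ n j, Θstar n j ∈ S n)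
    {r : ∀ n, Params (p n) k → ℝ} (hr : ∀ n, LocallyLipschitzReg Kr (r n))
    (hKr : ∀ B, 0 ≤ B → 0 < Kr B)
    {μ : ∀ n, Measure (EuclideanSpace ℝ (Fin (p n)))}
    {Cov : ∀ n, Matrix (Fin (p n)) (Fin (p n)) ℝ} {ν : ℕ → Measure ℝ}
    (hμ : ∀ n, 0 < n → IsProbabilityMeasure (μ n)) (hν : ∀ n, 0 < n → IsProbabilityMeasure (ν n))
    (hT : 0 < T)
    (hsub : ∀ n, ∀ θ ∈ S n, ExpSqLe T (fun x => inner ℝ θ x) (μ n))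
    (hsubG : ∀ n, ∀ θ ∈ S n, ExpSqLe T (fun x => inner ℝ θ x) (multivariateGaussian 0 (Cov n)))
    (hnoise : ∀ n, ExpSqLe T (fun e => e) (ν n))
    (hgauss : AsymptoticallyGaussianAlong S μ Cov) {ψ : ℝ → ℝ} (hψ : BoundedLipschitz ψ)
    {ε : ℝ} (hε : 0 < ε) :
    ∀ᶠ n in atTop,
      |∫ z, ψ (sampleMinRisk ℓ η (Θstar n) (r n) (C n) z)
          ∂(Measure.pi fun _ : Fin n => (μ n).prod (ν n)) -
        ∫ z, ψ (sampleMinRisk ℓ η (Θstar n) (r n) (C n) z)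
          ∂(Measure.pi fun _ : Fin n => (multivariateGaussian 0 (Cov n)).prod (ν n))| ≤
      16 * ε := by
  obtain ⟨M, hM0, hmom⟩ := exists_moment_bound hT hℓ hη
  obtain ⟨φ, d, A', D, B, hφc, hφA, hd, hB, htaylor, hφψ⟩ := hψ.exists_smooth_approx hε
  obtain ⟨⟨Mψ, hMψ⟩, L, hL⟩ := hψ
  have hMψ0 : 0 ≤ Mψ := (abs_nonneg _).trans (hMψ 0)
  have hD : 0 ≤ D := (abs_nonneg _).trans (hd 0)
  have hk' : (0 : ℝ) < k := by exact_mod_cast hk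
  -- Chosen so that `exp (-n a)` beats the net factor `5 ^ p`, with `p ≤ (γ + 1) n`, and `2 ^ n`,
  -- leaving `exp (-n)`.
  set a : ℝ := (γ + 1) * Real.log 5 + Real.log 2 + 1 with ha
  have ha0 : 0 ≤ a := by
    have h5 : 0 ≤ Real.log 5 := Real.log_nonneg (by norm_num)
    have h2 : 0 ≤ Real.log 2 := Real.log_nonneg (by norm_num)
    positivity
  set Y : ℝ := (M + 1) * (Mψ + 1) / ε with hY
  have hY0 : 0 < Y := by positivity
  have hMY : Mψ * (M / Y) ≤ ε := by
    have e : Mψ * (M / Y) = ε * ((Mψ / (Mψ + 1)) * (M / (M + 1))) := by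
      rw [hY]; field_simp
    rw [e]
    refine mul_le_of_le_one_right hε.le (mul_le_one₀ ?_ (by positivity) ?_) <;>
      rw [div_le_one (by positivity)] <;> linarith
  set A : ℝ := 4 * a * T ^ 2 with hA
  set κ : ℝ := c * (2 + 5 * k * A + 8 * Y) + Kr (k * R) * (k * R) with hκ
  have hκ0 : 0 < κ := by
    have := hKr (k * R) (by positivity)
    positivity
  -- Order of choice: `Y` and `κ`, then `α` for the net error, then `β` for the entropy at this `α`,
  -- then `δ` and `N` at this `β`. None depends on `n`.
  set α : ℝ := ε / ((L + 1) * κ) with hα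
  have hα0 : 0 < α := by positivity
  have hLα : L * (α * κ) ≤ ε := by
    have e : L * (α * κ) = ε * (L / (L + 1)) := by
      rw [hα]; field_simp
    rw [e]
    refine mul_le_of_le_one_right hε.le ?_
    rw [div_le_one (by positivity)]
    linarith
  have hlog : 0 ≤ Real.log (1 + 2 / α) := Real.log_nonneg (by
    have : 0 < 2 / α := by positivity
    linarith)
  set E₀ : ℝ := k * Real.log (1 + 2 / α) with hE₀
  have hE₀0 : 0 ≤ E₀ := by positivity
  set β : ℝ := L * ((γ + 1) * E₀) / ε + 1 with hβ
  have hβ0 : 0 < β := by positivity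
  have hLβ : L * ((γ + 1) * E₀ / β) ≤ ε := by
    rw [← mul_div_assoc, div_le_iff₀ hβ0, hβ, mul_add, mul_div_cancel₀ _ hε.ne']
    linarith
  have hD1 : 0 < D + 1 := by linarith
  obtain ⟨δ, hδ0, N, hsoft⟩ := exists_abs_integral_softMin_sub_le hβ0 hM0
    (show 0 < ε / (D + 1) by positivity)
  have hrep : ∀ᶠ n in atTop, ∀ m ∈ Finset.range (N + 1), ∀ Θ : Fin m → Params (p n) k,
      (∀ i j, Θ i j ∈ S n) →
      |∫ z, Real.exp (-β * ∑ i, sampleLoss ℓ η (Θstar n) (Θ i) z) ∂((μ n).prod (ν n)) -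
        ∫ z, Real.exp (-β * ∑ i, sampleLoss ℓ η (Θstar n) (Θ i) z)
          ∂((multivariateGaussian 0 (Cov n)).prod (ν n))| ≤ δ := by
    rw [Finset.eventually_all]
    intro m _
    filter_upwards [eventually_abs_integral_projWithNoise_sub_le hconv hsymm h0 hμ hν hT hsub hsubG
      hnoise hgauss (replicaWeight hβ0 hℓ.continuous hη.continuous hℓ0 m) hδ0] with n hn Θ hΘ
    simpa only [replicaWeight_projWithNoise] using
      hn (Sum.elim (fun q : Fin m × Fin k => Θ q.1 q.2) fun j => Θstar n j) (by
        rintro (q | j)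
        · exact hΘ q.1 q.2
        · exact hΘstar n j)
  have hpn : ∀ᶠ n in atTop, (p n : ℝ) / (n : ℝ) ≤ γ + 1 :=
    hp.eventually_le_const (by linarith)
  have hexp : ∀ᶠ n : ℕ in atTop, Mψ * Real.exp (-n) ≤ ε := by
    have h1 : Tendsto (fun n : ℕ => Mψ * Real.exp (-(n : ℝ))) atTop (𝓝 (Mψ * 0)) :=
      (Real.tendsto_exp_neg_atTop_nhds_zero.comp tendsto_natCast_atTop_atTop).const_mul _
    rw [mul_zero] at h1
    exact h1.eventually_le_const hε
  have hBM : ∀ᶠ n : ℕ in atTop, 2 * (B * M) / n ≤ ε :=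
    (tendsto_const_div_atTop_nhds_zero_nat (2 * (B * M))).eventually_le_const hε
  filter_upwards [hrep, hpn, hexp, hBM, eventually_gt_atTop 0] with n hrep hpn hexp hBM hn
  have _ := hμ n hn
  have _ := hν n hn
  have hn' : (0 : ℝ) < n := by exact_mod_cast hn
  obtain ⟨J, _, _, Θ, hΘC, happrox⟩ := exists_softMin_approx (A := A) (Y := Y)
    (Θstar := Θstar n) hn hk hc hα0 hℓ hη hR
    (hconv n) (hsymm n) (h0 n) (hbdd n) (hC n) (hCne n) (hCS n) (hr n) hKr
  obtain ⟨w, hw0, happrox⟩ := happrox hβ0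
  set V : (Fin n → EuclideanSpace ℝ (Fin (p n)) × ℝ) → ℝ :=
    fun z => sampleMinRisk ℓ η (Θstar n) (r n) (C n) z with hV
  set f : (Fin n → EuclideanSpace ℝ (Fin (p n)) × ℝ) → ℝ := fun z =>
    1 / n * softMin β w fun b => ∑ i, sampleLoss ℓ η (Θstar n) (Θ b) (z i) with hf
  set τ : ℝ := α * κ + (p n / n : ℝ) * E₀ / β with hτ
  have hΘS : ∀ b j, Θ b j ∈ S n := fun b j => hCS n (hΘC b j)
  have hLm : ∀ b, Measurable (sampleLoss ℓ η (Θstar n) (Θ b)) := fun b =>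
    ((continuous_sampleLoss hℓ.continuous hη.continuous (Θstar n)).comp
      (continuous_const.prodMk continuous_id)).measurable
  have hVm : Measurable V :=
    (continuous_sampleMinRisk hℓ.continuous hη.continuous (hr n).continuous (hC n)).measurable
  have hfm : Measurable f := by
    have : Measurable fun z : Fin n → EuclideanSpace ℝ (Fin (p n)) × ℝ =>
        softMin β w fun b => ∑ i, sampleLoss ℓ η (Θstar n) (Θ b) (z i) :=
      measurable_softMin (L := fun b (z : Fin n → EuclideanSpace ℝ (Fin (p n)) × ℝ) =>
        ∑ i, sampleLoss ℓ η (Θstar n) (Θ b) (z i)) fun b =>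
        Finset.measurable_sum _ fun i _ => (hLm b).comp (measurable_pi_apply i)
    exact this.const_mul _
  have hτ0 : 0 ≤ τ := by positivity
  have hLτ : L * τ ≤ 2 * ε := by
    have h1 : L * ((p n / n : ℝ) * E₀ / β) ≤ L * ((γ + 1) * E₀ / β) := by gcongr
    rw [hτ, mul_add]
    linarith
  have hprob : (5 : ℝ) ^ p n * (2 ^ n * Real.exp (-(n * a))) ≤ Real.exp (-n) := by
    have e5 : (5 : ℝ) ^ p n = Real.exp (p n * Real.log 5) := by
      rw [mul_comm, Real.exp_mul, Real.exp_log (by norm_num), Real.rpow_natCast]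
    have e2 : (2 : ℝ) ^ n = Real.exp (n * Real.log 2) := by
      rw [mul_comm, Real.exp_mul, Real.exp_log (by norm_num), Real.rpow_natCast]
    rw [e5, e2, ← Real.exp_add, ← Real.exp_add, Real.exp_le_exp]
    have h5 : 0 ≤ Real.log 5 := Real.log_nonneg (by norm_num)
    have hp' : (p n : ℝ) ≤ (γ + 1) * n := by rwa [div_le_iff₀ hn'] at hpn
    have := mul_le_mul_of_nonneg_right hp' h5
    rw [ha]
    linarith
  -- For each model the error `7ε` is `L τ ≤ 2ε` on typical samples, at most `4ε` from the two
  -- exceptional events, and `ε` for smoothing `ψ`.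
  have key : ∀ ρ : Measure (EuclideanSpace ℝ (Fin (p n))), IsProbabilityMeasure ρ →
      (∀ θ ∈ S n, ExpSqLe T (fun x => inner ℝ θ x) ρ) →
      (∀ b, Integrable (fun z => sampleLoss ℓ η (Θstar n) (Θ b) z ^ 2) (ρ.prod (ν n)) ∧
        ∫ z, sampleLoss ℓ η (Θstar n) (Θ b) z ^ 2 ∂(ρ.prod (ν n)) ≤ M) ∧
      |∫ z, ψ (V z) ∂(Measure.pi fun _ => ρ.prod (ν n)) -
        ∫ z, φ (f z) ∂(Measure.pi fun _ => ρ.prod (ν n))| ≤ 7 * ε := by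
    intro ρ _ hρ
    have hfst : HasLaw (Prod.fst : EuclideanSpace ℝ (Fin (p n)) × ℝ → _) ρ (ρ.prod (ν n)) :=
      ⟨by fun_prop, by simp⟩
    have hsnd : HasLaw (Prod.snd : EuclideanSpace ℝ (Fin (p n)) × ℝ → _) (ν n) (ρ.prod (ν n)) :=
      ⟨by fun_prop, by simp⟩
    have hsub' : ∀ θ ∈ S n, ExpSqLe T (fun z => inner ℝ θ z.1) (ρ.prod (ν n)) := fun θ hθ =>
      (hρ θ hθ).comp (by fun_prop) hfst
    obtain ⟨⟨hy, hyM⟩, hloss⟩ := hmom (Θstar := Θstar n) (fun j => hsub' _ (hΘstar n j))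
      ((hnoise n).comp measurable_id hsnd)
    refine ⟨fun b => hloss fun j => hsub' _ (hΘS b j), ?_⟩
    have hbad := measureReal_bad_sample_le hn (hconv n) (hsymm n) (h0 n)
      (Metric.isBounded_closedBall.subset (hbdd n)) hT hsub'
      (y := fun z => response η (Θstar n) z.1 z.2) hy hyM ha0 hY0
      (V := V) (f := f) (τ := τ) happrox
    have h1 := abs_integral_comp_sub_le hMψ hL hVm hfm hτ0 hbad
    have h2 : |∫ z, ψ (f z) ∂(Measure.pi fun _ : Fin n => ρ.prod (ν n)) -
        ∫ z, φ (f z) ∂(Measure.pi fun _ : Fin n => ρ.prod (ν n))| ≤ ε := by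
      refine abs_integral_sub_integral_le
        (integrable_of_abs_le (hL.continuous.measurable.comp hfm) fun z => hMψ _)
        (integrable_of_abs_le (hφc.measurable.comp hfm) fun z => hφA _) fun z => ?_
      rw [abs_sub_comm]
      exact hφψ _
    have h3 := mul_le_mul_of_nonneg_left hprob hMψ0
    calc _ ≤ _ := abs_sub_le _ (∫ z, ψ (f z) ∂(Measure.pi fun _ : Fin n => ρ.prod (ν n))) _
      _ ≤ _ := add_le_add h1 h2
      _ ≤ 7 * ε := by linarith
  obtain ⟨m₁, k₁⟩ := key (μ n) inferInstance (hsub n)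
  obtain ⟨m₂, k₂⟩ := key (multivariateGaussian 0 (Cov n)) inferInstance (hsubG n)
  have hδ : ∀ q ∈ stdSimplex ℝ J,
      |∫ z, softMin β q (fun b => sampleLoss ℓ η (Θstar n) (Θ b) z) ∂((μ n).prod (ν n)) -
        ∫ z, softMin β q (fun b => sampleLoss ℓ η (Θstar n) (Θ b) z)
          ∂((multivariateGaussian 0 (Cov n)).prod (ν n))| ≤ ε / (D + 1) :=
    hsoft hLm (fun b z => hℓ0 _) (fun b => (m₁ b).1) (fun b => (m₂ b).1) (fun b => (m₁ b).2)
      (fun b => (m₂ b).2) fun m hm b => hrep m (Finset.mem_range.2 (Nat.lt_succ_of_le hm))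
        (fun i => Θ (b i)) fun i j => hΘS (b i) j
  have hlind := abs_integral_pi_softMin_sub_le (s := 1 / (n : ℝ)) hφc hφA hd hB htaylor hβ0 hLm
    (fun b z => hℓ0 _)
    (fun b => (m₁ b).1) (fun b => (m₂ b).1) (fun b => (m₁ b).2) (fun b => (m₂ b).2) hδ
    (by positivity) n hw0
  -- The `n` swaps cost `2ε`; with `7ε` for each model the total is `16ε`.
  have hlind' : n * (D * (1 / n * (ε / (D + 1))) + 2 * (B * ((1 / (n : ℝ)) ^ 2 * M))) ≤ 2 * ε := by
    have e : n * (D * (1 / n * (ε / (D + 1))) + 2 * (B * ((1 / (n : ℝ)) ^ 2 * M))) =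
        ε * (D / (D + 1)) + 2 * (B * M) / n := by
      field_simp
    have h1 : ε * (D / (D + 1)) ≤ ε := mul_le_of_le_one_right hε.le (by
      rw [div_le_one hD1]
      linarith)
    rw [e]
    linarith
  have hlind2 := hlind.trans hlind'
  change |∫ z, φ (f z) ∂(Measure.pi fun _ => (μ n).prod (ν n)) -
    ∫ z, φ (f z) ∂(Measure.pi fun _ => (multivariateGaussian 0 (Cov n)).prod (ν n))| ≤ 2 * ε
    at hlind2
  rw [abs_le] at *
  constructor <;> linarith

end Comparison

/-! ### From test functions to probabilities -/

section Consequences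

variable {Ω : Type*} [MeasurableSpace Ω] {P : Measure Ω} [IsProbabilityMeasure P]

lemma boundedLipschitz_ramp (ρ : ℝ) {δ : ℝ} (hδ : 0 < δ) :
    BoundedLipschitz fun t => max 0 (min 1 ((t - ρ) / δ)) := by
  refine ⟨⟨1, fun t => ?_⟩, Real.toNNReal (1 / δ), ?_⟩
  · rw [abs_of_nonneg (le_max_left _ _)]
    exact max_le zero_le_one (min_le_left _ _)
  · have h : LipschitzWith (Real.toNNReal (1 / δ)) fun t : ℝ => (t - ρ) / δ := by
      refine LipschitzWith.of_dist_le_mul fun a b => ?_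
      rw [Real.coe_toNNReal _ (by positivity), Real.dist_eq, Real.dist_eq, ← sub_div,
        sub_sub_sub_cancel_right, abs_div, abs_of_pos hδ, one_div, inv_mul_eq_div]
    exact (h.const_min 1).const_max 0

/-- The ramp rising from `0` at `ρ` to `1` at `ρ + δ` lies between the indicators of `[ρ + δ, ∞)`
and `[ρ, ∞)`. -/
lemma measure_ge_add_le {X Y : Ω → ℝ} (hX : AEMeasurable X P) (hY : AEMeasurable Y P) (ρ : ℝ)
    {δ : ℝ} (hδ : 0 < δ) :
    P {ω | ρ + δ ≤ X ω} ≤ P {ω | ρ ≤ Y ω} +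
      ENNReal.ofReal |∫ ω, max 0 (min 1 ((X ω - ρ) / δ)) ∂P -
        ∫ ω, max 0 (min 1 ((Y ω - ρ) / δ)) ∂P| := by
  obtain ⟨⟨M, hM⟩, L, hL⟩ := boundedLipschitz_ramp ρ hδ
  have hi : ∀ Z : Ω → ℝ, AEMeasurable Z P →
      Integrable (fun ω => max 0 (min 1 ((Z ω - ρ) / δ))) P := fun Z hZ =>
    Integrable.of_bound (hL.continuous.measurable.comp_aemeasurable hZ).aestronglyMeasurable M
      (ae_of_all _ fun ω => hM _)
  have h1 : P.real {ω | ρ + δ ≤ X ω} ≤ ∫ ω, max 0 (min 1 ((X ω - ρ) / δ)) ∂P := by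
    have := mul_meas_ge_le_integral_of_nonneg (μ := P)
      (f := fun ω => max 0 (min 1 ((X ω - ρ) / δ))) (ae_of_all _ fun ω => le_max_left _ _)
      (hi X hX) 1
    rw [one_mul] at this
    refine le_trans (measureReal_mono (fun ω hω => ?_) (measure_ne_top _ _)) this
    have hω' : ρ + δ ≤ X ω := hω
    show (1 : ℝ) ≤ max 0 (min 1 ((X ω - ρ) / δ))
    refine le_max_of_le_right (le_min le_rfl ?_)
    rw [le_div_iff₀ hδ]
    linarith
  have h2 : ∫ ω, max 0 (min 1 ((Y ω - ρ) / δ)) ∂P ≤ P.real {ω | ρ ≤ Y ω} := by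
    have hns : NullMeasurableSet {ω | ρ ≤ Y ω} P :=
      nullMeasurableSet_le aemeasurable_const hY
    have hind : ∫ ω, ({ω | ρ ≤ Y ω}.indicator fun _ => (1 : ℝ)) ω ∂P = P.real {ω | ρ ≤ Y ω} := by
      rw [integral_indicator₀ hns]
      simp
    rw [← hind]
    refine integral_mono (hi Y hY) ((integrable_const (1 : ℝ)).indicator₀ hns) fun ω => ?_
    by_cases h : ρ ≤ Y ω
    · rw [Set.indicator_of_mem (show ω ∈ {ω | ρ ≤ Y ω} from h)]
      exact max_le zero_le_one (min_le_left _ _)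
    · rw [Set.indicator_of_notMem (show ω ∉ {ω | ρ ≤ Y ω} from h)]
      refine max_le le_rfl ((min_le_right _ _).trans ?_)
      exact div_nonpos_of_nonpos_of_nonneg (by linarith [not_le.1 h]) hδ.le
  rw [← ofReal_measureReal, ← ofReal_measureReal, ← ENNReal.ofReal_add measureReal_nonneg
    (abs_nonneg _)]
  refine ENNReal.ofReal_le_ofReal ?_
  linarith [le_abs_self (∫ ω, max 0 (min 1 ((X ω - ρ) / δ)) ∂P -
    ∫ ω, max 0 (min 1 ((Y ω - ρ) / δ)) ∂P)]

variable {X Y : ℕ → Ω → ℝ}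

lemma exists_measure_ge_le_add (hX : ∀ n, AEMeasurable (X n) P) (hY : ∀ n, AEMeasurable (Y n) P)
    (h : ∀ ψ : ℝ → ℝ, BoundedLipschitz ψ →
      Tendsto (fun n => |(∫ ω, ψ (X n ω) ∂P) - ∫ ω, ψ (Y n ω) ∂P|) atTop (𝓝 0))
    (ρ : ℝ) {δ : ℝ} (hδ : 0 < δ) : ∃ e : ℕ → ℝ≥0∞, Tendsto e atTop (𝓝 0) ∧
      ∀ n, P {ω | ρ + δ ≤ X n ω} ≤ P {ω | ρ ≤ Y n ω} + e n := by
  refine ⟨_, ?_, fun n => measure_ge_add_le (hX n) (hY n) ρ hδ⟩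
  rw [← ENNReal.ofReal_zero]
  exact ENNReal.tendsto_ofReal (h _ (boundedLipschitz_ramp ρ hδ))

lemma BoundedLipschitz.comp_neg {ψ : ℝ → ℝ} (hψ : BoundedLipschitz ψ) :
    BoundedLipschitz fun t => ψ (-t) := by
  obtain ⟨⟨M, hM⟩, L, hL⟩ := hψ
  exact ⟨⟨M, fun t => hM _⟩, L * 1, hL.comp LipschitzWith.id.neg⟩

lemma exists_measure_le_le_add (hX : ∀ n, AEMeasurable (X n) P) (hY : ∀ n, AEMeasurable (Y n) P)
    (h : ∀ ψ : ℝ → ℝ, BoundedLipschitz ψ →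
      Tendsto (fun n => |(∫ ω, ψ (X n ω) ∂P) - ∫ ω, ψ (Y n ω) ∂P|) atTop (𝓝 0))
    (ρ : ℝ) {δ : ℝ} (hδ : 0 < δ) : ∃ e : ℕ → ℝ≥0∞, Tendsto e atTop (𝓝 0) ∧
      ∀ n, P {ω | X n ω ≤ ρ - δ} ≤ P {ω | Y n ω ≤ ρ} + e n := by
  obtain ⟨e, he, hle⟩ := exists_measure_ge_le_add (X := fun n ω => -X n ω)
    (Y := fun n ω => -Y n ω) (fun n => (hX n).neg) (fun n => (hY n).neg)
    (fun ψ hψ => h _ hψ.comp_neg) (-ρ) hδ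
  refine ⟨e, he, fun n => ?_⟩
  have e1 : {ω | X n ω ≤ ρ - δ} = {ω | -ρ + δ ≤ -X n ω} :=
    Set.ext fun ω => show X n ω ≤ ρ - δ ↔ -ρ + δ ≤ -X n ω by constructor <;> intro h <;> linarith
  have e2 : {ω | Y n ω ≤ ρ} = {ω | -ρ ≤ -Y n ω} :=
    Set.ext fun ω => show Y n ω ≤ ρ ↔ -ρ ≤ -Y n ω from neg_le_neg_iff.symm
  rw [e1, e2]
  exact hle n

lemma limsup_le_and_liminf_le_of_le_add {u v e : ℕ → ℝ≥0∞} (he : Tendsto e atTop (𝓝 0))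
    (h : ∀ n, u n ≤ v n + e n) :
    limsup u atTop ≤ limsup v atTop ∧ liminf u atTop ≤ liminf v atTop := by
  constructor
  · rw [← ENNReal.limsup_add_of_right_tendsto_zero he v]
    exact limsup_le_limsup (Eventually.of_forall h)
  · rw [← ENNReal.liminf_add_of_right_tendsto_zero he v]
    exact liminf_le_liminf (Eventually.of_forall h)

/-- A deviation of `Y` by `ε` forces one of the two one-sided events; each is compared, with loss
`ε/2`, to a deviation of `X` by `ε/2`. -/
lemma tendstoInMeasure_const_of_tendsto_integral_sub (hX : ∀ n, AEMeasurable (X n) P)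
    (hY : ∀ n, AEMeasurable (Y n) P)
    (h : ∀ ψ : ℝ → ℝ, BoundedLipschitz ψ →
      Tendsto (fun n => |(∫ ω, ψ (Y n ω) ∂P) - ∫ ω, ψ (X n ω) ∂P|) atTop (𝓝 0))
    {ρ : ℝ} (hρ : TendstoInMeasure P X atTop fun _ => ρ) :
    TendstoInMeasure P Y atTop fun _ => ρ := by
  rw [tendstoInMeasure_iff_dist] at hρ ⊢
  intro ε hε
  obtain ⟨e, he, hle⟩ := exists_measure_ge_le_add hY hX h (ρ + ε / 2) (half_pos hε)
  obtain ⟨e', he', hle'⟩ := exists_measure_le_le_add hY hX h (ρ - ε / 2) (half_pos hε)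
  have hlim := ((hρ _ (half_pos hε)).add he).add ((hρ _ (half_pos hε)).add he')
  simp only [add_zero] at hlim
  refine tendsto_of_tendsto_of_tendsto_of_le_of_le tendsto_const_nhds hlim
    (fun _ => zero_le) fun n => ?_
  have hsub : {ω | ε ≤ dist (Y n ω) ρ} ⊆
      {ω | ρ + ε / 2 + ε / 2 ≤ Y n ω} ∪ {ω | Y n ω ≤ ρ - ε / 2 - ε / 2} := by
    intro ω hω
    have hω' : ε ≤ |Y n ω - ρ| := hω
    rcases le_abs.1 hω' with h | h
    · exact Or.inl (show ρ + ε / 2 + ε / 2 ≤ Y n ω by linarith)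
    · exact Or.inr (show Y n ω ≤ ρ - ε / 2 - ε / 2 by linarith)
  refine (measure_mono hsub).trans ((measure_union_le _ _).trans (add_le_add
    ((hle n).trans (add_le_add_left (measure_mono fun ω hω => ?_) _))
    ((hle' n).trans (add_le_add_left (measure_mono fun ω hω => ?_) _))))
  · have hω' : ρ + ε / 2 ≤ X n ω := hω
    exact le_abs.2 (Or.inl (show ε / 2 ≤ X n ω - ρ by linarith))
  · have hω' : X n ω ≤ ρ - ε / 2 := hω
    exact le_abs.2 (Or.inr (show ε / 2 ≤ -(X n ω - ρ) by linarith))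

end Consequences

lemma IsSample.aemeasurable {Ω : Type*} [MeasurableSpace Ω] {P : Measure Ω} {n p : ℕ}
    {μ : Measure (EuclideanSpace ℝ (Fin p))} {ν : Measure ℝ}
    {x : Fin n → Ω → EuclideanSpace ℝ (Fin p)} {ε : Fin n → Ω → ℝ} (h : IsSample P μ ν x ε) :
    AEMeasurable (fun ω i => (x i ω, ε i ω)) P :=
  aemeasurable_pi_lambda _ fun i =>
    (h.law_x i).aemeasurable.prodMk (h.law_noise i).aemeasurable

end EmpiricalRisk

/-! ### The universality theorem -/

theorem theorem1
    {Ω : Type*} [MeasurableSpace Ω] (P : Measure Ω) [IsProbabilityMeasure P]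
    -- the constants
    (γ : ℝ) (hγ : 0 < γ) (R K : ℝ≥0) (hR : 0 < R) (hK : 0 < K)
    (k kstar : ℕ) (hk : 0 < k) (hkstar : 0 < kstar)
    (Kr : ℝ → ℝ) (hKr : ∀ B, 0 ≤ B → 0 < Kr B)
    -- proportional asymptotics
    (p : ℕ → ℕ) (hp : Tendsto (fun n => (p n : ℝ) / (n : ℝ)) atTop (𝓝 γ))
    -- the symmetric convex sets
    (S : ∀ n, Set (EuclideanSpace ℝ (Fin (p n))))
    (hSconvex : ∀ n, Convex ℝ (S n)) (hSsymm : ∀ n, ∀ θ ∈ S n, -θ ∈ S n)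
    (hSbdd : ∀ n, S n ⊆ Metric.closedBall 0 (R : ℝ))
    -- loss and labeling functions
    (ℓ : EuclideanSpace ℝ (Fin (k + 1)) → ℝ) (η : EuclideanSpace ℝ (Fin (kstar + 1)) → ℝ)
    (hloss : LipschitzLossLabel K ℓ η ∨ SmoothLossLabel R K ℓ η)
    -- constraint sets
    (C : ∀ n, Set (EuclideanSpace ℝ (Fin (p n))))
    (hCcompact : ∀ n, IsCompact (C n)) (hCne : ∀ n, (C n).Nonempty) (hCS : ∀ n, C n ⊆ S n)
    -- distribution parameters
    (Θstar : ∀ n, Params (p n) kstar) (hΘstar : ∀ n j, Θstar n j ∈ S n)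
    -- law of the noise
    (ν : ℕ → Measure ℝ) (hν : ∀ n, psi2Norm (fun t : ℝ => t) (ν n) ≤ (K : ℝ≥0∞))
    -- regularizer
    (r : ∀ n, Params (p n) k → ℝ) (hr : ∀ n, LocallyLipschitzReg Kr (r n))
    -- law of the features and covariance of the Gaussian model
    (μ : ∀ n, Measure (EuclideanSpace ℝ (Fin (p n))))
    (Cov : ∀ n, Matrix (Fin (p n)) (Fin (p n)) ℝ) (hCov : ∀ n, (Cov n).PosSemidef)
    (hsub : ∀ n, SubgaussianAlong K (S n) (μ n) (Cov n))
    (hgauss : AsymptoticallyGaussianAlong S μ Cov)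
    -- the samples
    (x g : ∀ n, Fin n → Ω → EuclideanSpace ℝ (Fin (p n))) (ε : ∀ n, Fin n → Ω → ℝ)
    (hx : ∀ n, IsSample P (μ n) (ν n) (x n) (ε n))
    (hg : ∀ n, IsSample P (multivariateGaussian 0 (Cov n)) (ν n) (g n) (ε n))
    -- the minimal risks of the two models
    (RX RG : ℕ → Ω → ℝ)
    (hRX : ∀ n ω, RX n ω = minRisk ℓ (r n) (C n) (fun i => x n i ω)
      (fun i => response η (Θstar n) (x n i ω) (ε n i ω)))
    (hRG : ∀ n ω, RG n ω = minRisk ℓ (r n) (C n) (fun i => g n i ω)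
      (fun i => response η (Θstar n) (g n i ω) (ε n i ω))) :
    (∀ ψ : ℝ → ℝ, BoundedLipschitz ψ →
      Tendsto (fun n => |(∫ ω, ψ (RX n ω) ∂P) - ∫ ω, ψ (RG n ω) ∂P|) atTop (𝓝 0)) ∧
    (∀ ρ δ : ℝ, 0 < δ →
      limsup (fun n => P {ω | ρ + δ ≤ RX n ω}) atTop ≤ limsup (fun n => P {ω | ρ ≤ RG n ω}) atTop ∧
      liminf (fun n => P {ω | ρ + δ ≤ RX n ω}) atTop ≤ liminf (fun n => P {ω | ρ ≤ RG n ω}) atTop ∧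
      limsup (fun n => P {ω | RX n ω ≤ ρ - δ}) atTop ≤ limsup (fun n => P {ω | RG n ω ≤ ρ}) atTop ∧
      liminf (fun n => P {ω | RX n ω ≤ ρ - δ}) atTop ≤ liminf (fun n => P {ω | RG n ω ≤ ρ}) atTop) ∧
    (∀ ρ : ℝ, TendstoInMeasure P RX atTop (fun _ => ρ) ↔
      TendstoInMeasure P RG atTop (fun _ => ρ)) := by
  have hT : (0 : ℝ) < 2 * (R + 1) * K := by
    have : (0 : ℝ) < K := hK
    positivity
  have h0 : ∀ n, (0 : EuclideanSpace ℝ (Fin (p n))) ∈ S n := fun n =>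
    zero_mem_of_convex_symm (hSconvex n) (hSsymm n) ((hCne n).mono (hCS n))
  have hexp := fun n θ hθ => (hsub n).expSqLe hK (hSconvex n) (h0 n) (hSbdd n) (θ := θ) hθ
  have hnoise : ∀ n, ExpSqLe (2 * (R + 1) * K) (fun e => e) (ν n) := fun n =>
    expSqLe_of_psi2Norm_le (hν n) (by
      have : (0 : ℝ) < K := hK
      nlinarith [mul_nonneg R.coe_nonneg this.le])
  obtain ⟨hℓ0, c, hc, hℓ, hη⟩ := exists_quadLipschitz hloss
  have hprob := fun n (hn : 0 < n) => (hx n).isProbabilityMeasure hn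
  have hcont : ∀ n, Continuous fun z : Fin n → EuclideanSpace ℝ (Fin (p n)) × ℝ =>
      sampleMinRisk ℓ η (Θstar n) (r n) (C n) z := fun n =>
    continuous_sampleMinRisk hℓ.continuous hη.continuous (hr n).continuous (hCcompact n)
  have eX : ∀ n, RX n =
      fun ω => sampleMinRisk ℓ η (Θstar n) (r n) (C n) fun i => (x n i ω, ε n i ω) := fun n =>
    funext (hRX n)
  have eG : ∀ n, RG n =
      fun ω => sampleMinRisk ℓ η (Θstar n) (r n) (C n) fun i => (g n i ω, ε n i ω) := fun n =>
    funext (hRG n)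
  have mX : ∀ n, AEMeasurable (RX n) P := fun n => by
    rw [eX]
    exact (hcont n).measurable.comp_aemeasurable (hx n).aemeasurable
  have mG : ∀ n, AEMeasurable (RG n) P := fun n => by
    rw [eG]
    exact (hcont n).measurable.comp_aemeasurable (hg n).aemeasurable
  have hmain : ∀ ψ : ℝ → ℝ, BoundedLipschitz ψ →
      Tendsto (fun n => |(∫ ω, ψ (RX n ω) ∂P) - ∫ ω, ψ (RG n ω) ∂P|) atTop (𝓝 0) := by
    intro ψ hψ
    have hψc : Continuous ψ := hψ.2.choose_spec.continuous
    rw [Metric.tendsto_atTop']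
    intro δ hδ
    -- With `δ/32` the bound `16ε` becomes `δ/2`, strictly below `δ`.
    have hev := (eventually_abs_integral_sampleMinRisk_sub_le hγ hk hp hc hℓ hη hℓ0 hR hSconvex
      hSsymm h0 hSbdd hCcompact hCne hCS hΘstar hr hKr (fun n hn => (hprob n hn).1)
      (fun n hn => (hprob n hn).2) hT (fun n θ hθ => (hexp n θ hθ).1)
      (fun n θ hθ => (hexp n θ hθ).2) hnoise hgauss hψ (show 0 < δ / 32 by positivity)).and
      (eventually_gt_atTop 0)
    obtain ⟨n₀, hn₀⟩ := eventually_atTop.1 hev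
    refine ⟨n₀, fun n hn => ?_⟩
    obtain ⟨hle, hpos⟩ := hn₀ n hn.le
    have _ := (hprob n hpos).1
    have _ := (hprob n hpos).2
    have hVψ := (hψc.comp (hcont n)).measurable.aestronglyMeasurable
      (μ := Measure.pi fun _ : Fin n => (μ n).prod (ν n))
    have hVψ' := (hψc.comp (hcont n)).measurable.aestronglyMeasurable
      (μ := Measure.pi fun _ : Fin n => (multivariateGaussian 0 (Cov n)).prod (ν n))
    have i1 : ∫ ω, ψ (RX n ω) ∂P = ∫ z, ψ (sampleMinRisk ℓ η (Θstar n) (r n) (C n) z)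
        ∂(Measure.pi fun _ : Fin n => (μ n).prod (ν n)) := by
      rw [eX]
      exact (hx n).hasLaw.integral_comp hVψ
    have i2 : ∫ ω, ψ (RG n ω) ∂P = ∫ z, ψ (sampleMinRisk ℓ η (Θstar n) (r n) (C n) z)
        ∂(Measure.pi fun _ : Fin n => (multivariateGaussian 0 (Cov n)).prod (ν n)) := by
      rw [eG]
      exact (hg n).hasLaw.integral_comp hVψ'
    rw [Real.dist_eq, sub_zero, abs_abs, i1, i2]
    refine hle.trans_lt ?_
    linarith
  have hmain' : ∀ ψ : ℝ → ℝ, BoundedLipschitz ψ →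
      Tendsto (fun n => |(∫ ω, ψ (RG n ω) ∂P) - ∫ ω, ψ (RX n ω) ∂P|) atTop (𝓝 0) :=
    fun ψ hψ => by simpa only [abs_sub_comm] using hmain ψ hψ
  refine ⟨hmain, fun ρ δ hδ => ?_, fun ρ => ⟨?_, ?_⟩⟩
  · obtain ⟨e, he, hle⟩ := exists_measure_ge_le_add mX mG hmain ρ hδ
    obtain ⟨e', he', hle'⟩ := exists_measure_le_le_add mX mG hmain ρ hδ
    obtain ⟨a, b⟩ := limsup_le_and_liminf_le_of_le_add he hle
    obtain ⟨a', b'⟩ := limsup_le_and_liminf_le_of_le_add he' hle'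
    exact ⟨a, b, a', b'⟩
  · exact tendstoInMeasure_const_of_tendsto_integral_sub mX mG hmain'
  · exact tendstoInMeasure_const_of_tendsto_integral_sub mG mX hmain
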